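/- **Definitions.** Order $\mathbb{R}^m$ coordinatewise, let $e_1,\dots,e_m$ be the standard basis, and let the *rank* of a point be the sum of its coordinates; the rank of a set $P$ (a polytope or a finite poset in $\mathbb{R}^m$) is the sum of the minimum and the maximum rank of its points. Let $L(m)=\{x\in\mathbb{R}^m : 0\le x_1\le\dots\le x_m\le 1\}$ and, for $n\ge 1$, let $L(m,n)=L(m)\cap\frac1n\mathbb{Z}^m$. A *symmetric chain* of $L(m,n)$ is a set $\{c_0<c_1<\dots<c_r\}\subseteq L(m,n)$ in which consecutive elements differ in rank by exactly $\frac1n$ and the ranks of $c_0$ and $c_r$ add up to the rank of $L(m,n)$. A *symmetric chain decomposition* of $L(m,n)$ is a partition of it into symmetric chains. A *partial simplex* is a simplex from which some open sub-simplices (relative interiors of convex hulls of sets of vertices), other than the relative interior of the whole simplex, have been removed. A *swipe* consists of a direction $e_i$ and two partial simplices $S^s,S^e$ (its starting and ending *turning sets*) such that translation by nonnegative multiples of $e_i$ defines a bijection from $S^s$ to $S^e$: each point of $S^s$ has exactly one such translate in $S^e$, each point of $S^e$ is such a translate of exactly one point of $S^s$, and vertices correspond to vertices. The point set of the swipe,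 also denoted $S$, is the union of the segments joining corresponding points; it is required to be convex. Swipes $S_0,\dots,S_k$ are *compatible* if $S_i^e=S_{i+1}^s$ for $0\le i<k$. A *real snake* is a polytope (that is, a closed set) of the form $S_0\cup\dots\cup S_k$, with $S_0,\dots,S_k$ compatible, such that whenever $i<j$ and $x\in S_i\cap S_j$, the point $x$ lies in $S_i^e$, in $S_j^s$, and in $S_l^s\cap S_l^e$ for all $i<l<j$. A point $x\in S_i$ is *$i$-halted* if either $x\in S_i^s$ and $x\in S_l^s\cap S_l^e$ for all $l<i$, or $x\in S_i^e$ and $x\in S_l^s\cap S_l^e$ for all $l>i$. A *fake snake* is a union $T_0\cup\dots\cup T_k$, where $S_0,\dots,S_k$ are compatible and $T_i$ is $S_i$ without its $i$-halted points, such that whenever $i<j$ and $x\in T_i\cap T_j$, the point $x$ lies in $S_i^e$, in $S_j^s$, and in $T_l\cap S_l^s\cap S_l^e$ for all $i<l<j$. A snake is *symmetric* in $P$ if for any two corresponding vertices of the closures of $S_0^s$ and $S_k^e$ the ranks add up to the rank of $P$. A *geometric symmetric chain decomposition* of $P$ is a partition of $P$ into finitely many symmetric snakes. It satisfies the *strong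 hyperplane condition* if for every swipe, of direction $e_i$ say, each of its two turning sets lies in some hyperplane $\sum_j a_jx_j=b$ with all $a_j$ integers, $b$ rational and $a_i=\pm1$. The *chains* of a geometric symmetric chain decomposition are the following sets. Let $v_0\in S_0^s$ be a point of the first turning set of one of its snakes, and let $v_1,\dots,v_{k+1}$ be the points successively corresponding to it in $S_0^e=S_1^s,\ S_1^e=S_2^s,\ \dots,\ S_k^e$. For a real snake the chain of $v_0$ is the broken line $v_0v_1\cdots v_{k+1}$; for a fake snake it is this broken line without its endpoints $v_0$ and $v_{k+1}$, if that is nonempty. **Theorem.** 1. For $1\le m\le 5$ the polytope $L(m)$ has a geometric symmetric chain decomposition. For $1\le m\le 4$ there is one that satisfies the strong hyperplane condition and has the property that, for every $n\ge1$, the nonempty intersections of its chains with $\frac1n\mathbb{Z}^m$ form a symmetric chain decomposition of $L(m,n)$. 2. For every $n\ge 1$ there is a collection of pairwise disjoint symmetric chains of $L(5,27n)$ whose union contains $L(5,n)$. -/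

import Mathlib

namespace YoungChains

/-! ### Ranks, the polytopes `L(m)` and the posets `L(m,n)` -/

/-- The rank of a point of `ℝ^m` is the sum of its coordinates. -/
noncomputable def rk {m : ℕ} (x : Fin m → ℝ) : ℝ := ∑ i, x i

/-- The rank of a set (a polytope `P`, or a poset `P(n)`) is the sum of the minimum and the maximum
rank of its points. It is only used for nonempty compact sets. -/
noncomputable def totalRank {m : ℕ} (A : Set (Fin m → ℝ)) : ℝ :=
  sInf (rk '' A) + sSup (rk '' A)

/-- The polytope `L(m) = {0 ≤ x_1 ≤ … ≤ x_m ≤ 1}`. -/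
def youngPolytope (m : ℕ) : Set (Fin m → ℝ) :=
  {x | Monotone x ∧ ∀ i, 0 ≤ x i ∧ x i ≤ 1}

/-- The points of denominator `n`, i.e. the lattice `(1/n) ℤ^m` (used for `n ≥ 1`). -/
def latticePoints (m n : ℕ) : Set (Fin m → ℝ) :=
  {x | ∀ i, ∃ z : ℤ, x i = (z : ℝ) / (n : ℝ)}

/-- The Young poset `L(m,n)`, as the set of points of denominator `n` of `L(m)`;
its order is the coordinatewise order of `ℝ^m`. -/
def youngPoset (m n : ℕ) : Set (Fin m → ℝ) := youngPolytope m ∩ latticePoints m n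

/-! ### Symmetric chains in discrete posets -/

/-- `C` is a symmetric chain of the poset `Q ⊆ (1/n) ℤ^m`: its elements are
`c_0 < c_1 < … < c_r`, no rank is skipped (consecutive ranks differ by `1/n`), and the ranks of
`c_0` and `c_r` add up to the rank of `Q`. -/
def IsSymmetricChain {m : ℕ} (n : ℕ) (Q C : Set (Fin m → ℝ)) : Prop :=
  ∃ (r : ℕ) (c : Fin (r + 1) → (Fin m → ℝ)),
    C = Set.range c ∧ (∀ i, c i ∈ Q) ∧
    (∀ i : Fin r, c i.castSucc ≤ c i.succ ∧ rk (c i.succ) = rk (c i.castSucc) + 1 / (n : ℝ)) ∧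
    rk (c 0) + rk (c (Fin.last r)) = totalRank Q

/-- A symmetric chain decomposition of `Q ⊆ (1/n) ℤ^m`: a partition of `Q` into symmetric
chains. -/
def IsSymmetricChainDecomposition {m : ℕ} (n : ℕ) (Q : Set (Fin m → ℝ))
    (𝒞 : Set (Set (Fin m → ℝ))) : Prop :=
  (∀ C ∈ 𝒞, IsSymmetricChain n Q C) ∧ 𝒞.PairwiseDisjoint id ∧ ⋃₀ 𝒞 = Q

/-! ### Partial simplices and swipes -/

/-- A partial simplex of dimension `d` in `ℝ^m`: a simplex with some open sub-simplices removed,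
the relative interior of the whole simplex not being removed. Sub-simplices are given by their sets
of vertices. -/
structure PartialSimplex (m d : ℕ) where
  vertex : Fin (d + 1) → (Fin m → ℝ)
  affineIndependent : AffineIndependent ℝ vertex
  removed : Set (Finset (Fin (d + 1)))
  univ_not_removed : Finset.univ ∉ removed

/-- The open sub-simplex on the vertices in `s`: the points all of whose barycentric coordinates
at the vertices in `s` are positive and whose other barycentric coordinates vanish. -/
def PartialSimplex.openFace {m d : ℕ} (S : PartialSimplex m d) (s : Finset (Fin (d + 1))) :
    Set (Fin m → ℝ) :=
  {x | ∃ w : Fin (d + 1) → ℝ, (∑ j, w j = 1) ∧ (∀ j ∈ s, 0 < w j) ∧ (∀ j ∉ s, w j = 0) ∧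
    x = ∑ j, w j • S.vertex j}

/-- The underlying point set of a partial simplex. -/
def PartialSimplex.carrier {m d : ℕ} (S : PartialSimplex m d) : Set (Fin m → ℝ) :=
  convexHull ℝ (Set.range S.vertex) \ ⋃ s ∈ S.removed, S.openFace s

/-- `y` is obtained from `x` by translation by a nonnegative multiple of `e_i`. -/
def Translates {m : ℕ} (i : Fin m) (x y : Fin m → ℝ) : Prop :=
  ∃ t : ℝ, 0 ≤ t ∧ y = x + t • (Pi.single i 1 : Fin m → ℝ)

/-- A swipe: a coordinate direction together with two partial simplices, the starting and ending
turning sets, such that translation by nonnegative multiples of `e_dir` is a bijection between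
their points. The vertices are labelled so that corresponding vertices have the same label. -/
structure Swipe (m d : ℕ) where
  dir : Fin m
  start : PartialSimplex m d
  finish : PartialSimplex m d
  vertex_translates : ∀ j, Translates dir (start.vertex j) (finish.vertex j)
  existsUnique_finish : ∀ x ∈ start.carrier, ∃! y, y ∈ finish.carrier ∧ Translates dir x y
  existsUnique_start : ∀ y ∈ finish.carrier, ∃! x, x ∈ start.carrier ∧ Translates dir x y
  convex : Convex ℝ {z : Fin m → ℝ | ∃ x ∈ start.carrier, ∃ y ∈ finish.carrier,
    Translates dir x y ∧ z ∈ segment ℝ x y}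

/-- The point set of a swipe: the union of all segments joining a point of the starting turning
set to the corresponding point of the ending turning set. -/
def Swipe.carrier {m d : ℕ} (S : Swipe m d) : Set (Fin m → ℝ) :=
  {z | ∃ x ∈ S.start.carrier, ∃ y ∈ S.finish.carrier,
    Translates S.dir x y ∧ z ∈ segment ℝ x y}

/-! ### Snakes -/

/-- A compatible sequence of swipes `S_0, …, S_k`: the ending turning set of each swipe is the
starting turning set of the next one. -/
structure SwipeSequence (m : ℕ) where
  d : ℕ
  k : ℕ
  swipe : Fin (k + 1) → Swipe m d
  compatible : ∀ i : Fin k, (swipe i.castSucc).finish = (swipe i.succ).start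

namespace SwipeSequence

variable {m : ℕ}

/-- `x` lies in both turning sets of the `i`-th swipe. -/
def InBoth (S : SwipeSequence m) (i : Fin (S.k + 1)) (x : Fin m → ℝ) : Prop :=
  x ∈ (S.swipe i).start.carrier ∧ x ∈ (S.swipe i).finish.carrier

/-- The union of the swipes. -/
def realCarrier (S : SwipeSequence m) : Set (Fin m → ℝ) := ⋃ i, (S.swipe i).carrier

/-- The sequence forms a real snake: the union of the swipes is a polytope (a finite union of
swipes is one precisely if it is closed), and the non self-intersecting condition holds. -/
def IsReal (S : SwipeSequence m) : Prop :=
  IsClosed S.realCarrier ∧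
  ∀ i j, i < j → ∀ x, x ∈ (S.swipe i).carrier → x ∈ (S.swipe j).carrier →
    x ∈ (S.swipe i).finish.carrier ∧ x ∈ (S.swipe j).start.carrier ∧
    ∀ l, i < l → l < j → S.InBoth l x

/-- The point `x` is `i`-halted. -/
def Halted (S : SwipeSequence m) (i : Fin (S.k + 1)) (x : Fin m → ℝ) : Prop :=
  ((∀ l, l < i → S.InBoth l x) ∧ x ∈ (S.swipe i).start.carrier) ∨
  ((∀ l, i < l → S.InBoth l x) ∧ x ∈ (S.swipe i).finish.carrier)

/-- The `i`-th swipe without its `i`-halted points. -/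
def trimmed (S : SwipeSequence m) (i : Fin (S.k + 1)) : Set (Fin m → ℝ) :=
  {x | x ∈ (S.swipe i).carrier ∧ ¬ S.Halted i x}

/-- The union of the trimmed swipes. -/
def fakeCarrier (S : SwipeSequence m) : Set (Fin m → ℝ) := ⋃ i, S.trimmed i

/-- The sequence forms a fake snake: the non self-intersecting condition holds for the trimmed
swipes. -/
def IsFake (S : SwipeSequence m) : Prop :=
  ∀ i j, i < j → ∀ x, x ∈ S.trimmed i → x ∈ S.trimmed j →
    x ∈ (S.swipe i).finish.carrier ∧ x ∈ (S.swipe j).start.carrier ∧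
    ∀ l, i < l → l < j → x ∈ S.trimmed l ∧ S.InBoth l x

/-- The successive turning points `v_0, …, v_{k+1}` of one of the chains swept out: `v_i` and
`v_{i+1}` are corresponding points of the two turning sets of `S_i`. -/
def IsPath (S : SwipeSequence m) (v : Fin (S.k + 2) → (Fin m → ℝ)) : Prop :=
  ∀ i : Fin (S.k + 1),
    v i.castSucc ∈ (S.swipe i).start.carrier ∧ v i.succ ∈ (S.swipe i).finish.carrier ∧
    Translates (S.swipe i).dir (v i.castSucc) (v i.succ)

end SwipeSequence

/-- A broken line through the points `v_0, …, v_{k+1}`. -/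
def brokenLine {m k : ℕ} (v : Fin (k + 2) → (Fin m → ℝ)) : Set (Fin m → ℝ) :=
  ⋃ i : Fin (k + 1), segment ℝ (v i.castSucc) (v i.succ)

/-- A snake is either a real snake or a fake snake. -/
inductive Snake (m : ℕ) where
  | real (S : SwipeSequence m) (h : S.IsReal) : Snake m
  | fake (S : SwipeSequence m) (h : S.IsFake) : Snake m

namespace Snake

variable {m : ℕ}

/-- The compatible sequence of swipes of a snake. -/
def seq : Snake m → SwipeSequence m
  | real S _ => S
  | fake S _ => S

/-- The point set of a snake. -/
def carrier : Snake m → Set (Fin m → ℝ)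
  | real S _ => S.realCarrier
  | fake S _ => S.fakeCarrier

/-- The (nonempty) chains of a snake: closed chains, containing both endpoints, for a real snake,
and open chains, omitting both endpoints, for a fake snake. -/
def chains : Snake m → Set (Set (Fin m → ℝ))
  | real S _ => {C | ∃ v, S.IsPath v ∧ C = brokenLine v}
  | fake S _ => {C | C.Nonempty ∧
      ∃ v, S.IsPath v ∧ C = brokenLine v \ {v 0, v (Fin.last (S.k + 1))}}

/-- A snake is symmetric in `P` if, for corresponding vertices of the first starting and the last
ending turning set, the ranks add up to the rank of `P`. -/
def IsSymmetric (R : Snake m) (P : Set (Fin m → ℝ)) : Prop :=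
  ∀ j, rk ((R.seq.swipe 0).start.vertex j) +
    rk ((R.seq.swipe (Fin.last R.seq.k)).finish.vertex j) = totalRank P

end Snake

/-! ### Geometric symmetric chain decompositions -/

/-- A geometric symmetric chain decomposition of `P`: a partition of `P` into finitely many
symmetric snakes. -/
structure GeometricSCD {m : ℕ} (P : Set (Fin m → ℝ)) where
  N : ℕ
  snake : Fin N → Snake m
  disjoint : ∀ a b, a ≠ b → Disjoint (snake a).carrier (snake b).carrier
  cover : ⋃ a, (snake a).carrier = P
  symmetric : ∀ a, (snake a).IsSymmetric P

namespace GeometricSCD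

variable {m : ℕ} {P : Set (Fin m → ℝ)}

/-- The set `T` lies in a hyperplane `∑ a_j x_j = b` with integers `a_j`, a rational `b`, and
`a_i = ± 1`. -/
def StrongHyperplane {m : ℕ} (i : Fin m) (T : Set (Fin m → ℝ)) : Prop :=
  ∃ (a : Fin m → ℤ) (b : ℚ), (a i = 1 ∨ a i = -1) ∧
    ∀ x ∈ T, ∑ j, (a j : ℝ) * x j = (b : ℝ)

/-- The strong hyperplane condition: both turning sets of every swipe, of direction `e_i` say, lie
in a hyperplane `∑ a_j x_j = b` with integers `a_j`, a rational `b`, and `a_i = ± 1`. -/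
def StrongHyperplaneCondition (D : GeometricSCD P) : Prop :=
  ∀ (a : Fin D.N) (i : Fin ((D.snake a).seq.k + 1)),
    StrongHyperplane ((D.snake a).seq.swipe i).dir ((D.snake a).seq.swipe i).start.carrier ∧
    StrongHyperplane ((D.snake a).seq.swipe i).dir ((D.snake a).seq.swipe i).finish.carrier

/-- All chains of the decomposition. -/
def chains (D : GeometricSCD P) : Set (Set (Fin m → ℝ)) := ⋃ a, (D.snake a).chains

/-- The nonempty restrictions of the chains to the points of denominator `n`. -/
def restrictedChains (D : GeometricSCD P) (n : ℕ) : Set (Set (Fin m → ℝ)) :=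
  {C' | C'.Nonempty ∧ ∃ C ∈ D.chains, C' = C ∩ latticePoints m n}

end GeometricSCD

end YoungChains

/-! ### Partial simplices in barycentric coordinates. -/

namespace YoungChains

/-! The gaps 1 - x_m, x_m - x_(m-1), ..., x_2 - x_1, x_1 are barycentric coordinates on the simplex
L(m), whose vertices have ranks 0, 1, ..., m in this order. Moving in a coordinate direction shifts
mass from one gap to the next, so a chain is a way of letting mass flow from the first gap to the
last.

For m = 3, 4, 5 partition the vertices by rank into groups: {0,1,2,3}; {1,3} and {0,2,4}; {0,5},
{1,3} and {2,4}. Each group has a positive convex combination of rank m/2, which serves as a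
motionless vertex of all turning simplices. Subtracting from x the largest possible multiples of
these fixed points leaves a residue with a vanishing gap in every group. The residues of given mass
form a join of boundaries of simplices, a 2-sphere made of 4, 6 or 8 triangles. It remains to sweep
this sphere by broken lines. They are parametrised by the weights of two further vertices: vertex 0
travels along edges from the zero point to the all-one point, and vertex 1 starts and ends at
midpoints of edges with ranks adding up to m. Two ways of interleaving the moves of these two
vertices give two discs with the same boundary, formed by the two extreme lines and the two end
segments. One disc is taken closed (the real snake) and the other open (the fake snake, with
positive weights at vertices 0 and 1 and without endpoints). For m = 2 the sphere degenerates to a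
path and for m = 1 to a single line, so one real snake suffices.

Every swipe of such an affine family is controlled by hyperplanes transversal to its direction:
`BrokenFamily.eq_of_parallel` gives the bijections between turning sets, and
`BrokenFamily.mem_trimmed` identifies halted points with endpoints. Hence a partition into lines
(`ChainSystem`) is a geometric decomposition.

For the lattice statements, moving along e_i from a lattice point to a hyperplane with integral
coefficients multiplies the denominator at most by the absolute value of the coefficient at i. For m
≤ 4 all relevant coefficients are ±1, so a line with one lattice point has all its turning points in
the lattice, and then its lattice points skip no rank. For m = 5 the fixed points mix two vertices
in the ratio 1 : 3, coefficients ±3 occur, and their product along a line is at most 27 in absolute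
value (`BrokenFamily.point_mem_latticePoints`). -/

/-- The weights of a point of a simplex, with positive weight at the vertices in `req`. -/
def weightSet {d : ℕ} (req : Finset (Fin (d + 1))) : Set (Fin (d + 1) → ℝ) :=
  {w | (∀ j, 0 ≤ w j) ∧ ∑ j, w j = 1 ∧ ∀ j ∈ req, 0 < w j}

theorem convex_weightSet {d : ℕ} (req : Finset (Fin (d + 1))) : Convex ℝ (weightSet req) := by
  rintro w ⟨h0, h1, h2⟩ w' ⟨h0', h1', h2'⟩ a b ha hb hab
  refine ⟨fun j => ?_, ?_, fun j hj => ?_⟩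
  · have := h0 j; have := h0' j
    simp only [Pi.add_apply, Pi.smul_apply, smul_eq_mul]; positivity
  · simp only [Pi.add_apply, Pi.smul_apply, smul_eq_mul, Finset.sum_add_distrib,
      ← Finset.mul_sum, h1, h1', mul_one, hab]
  · have h := h2 j hj; have h' := h2' j hj
    simp only [Pi.add_apply, Pi.smul_apply, smul_eq_mul]
    rcases ha.eq_or_lt with rfl | ha
    · have : b = 1 := by linarith
      subst this; simpa using h'
    · have := mul_pos ha h; have := mul_nonneg hb h'.le; linarith

theorem weightSet_empty {d : ℕ} :
    weightSet (∅ : Finset (Fin (d + 1))) = stdSimplex ℝ (Fin (d + 1)) := by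
  ext w; simp [weightSet, stdSimplex]

theorem eq_of_sum_smul_eq {m d : ℕ} {v : Fin (d + 1) → Fin m → ℝ} (hv : AffineIndependent ℝ v)
    {w w' : Fin (d + 1) → ℝ} (h : ∑ j, w j = ∑ j, w' j)
    (h' : ∑ j, w j • v j = ∑ j, w' j • v j) : w = w' := by
  funext j
  have := hv.eq_zero_of_sum_eq_zero (s := Finset.univ) (w := fun j => w j - w' j)
    (by simp [h]) (by simp [sub_smul, h']) j (Finset.mem_univ j)
  linarith

theorem affineIndependent_of_sum {m d : ℕ} {v : Fin (d + 1) → Fin m → ℝ}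
    (h : ∀ w : Fin (d + 1) → ℝ, ∑ j, w j = 0 → ∑ j, w j • v j = 0 → ∀ j, w j = 0) :
    AffineIndependent ℝ v := by
  rw [affineIndependent_iff]
  intro s w h0 h1 e he
  have := h (fun j => if j ∈ s then w j else 0) (by simpa using h0) (by simpa using h1) e
  simpa [he] using this

/-- The simplex with the open faces not containing all the vertices in `req` removed. -/
def PartialSimplex.ofRequired {m d : ℕ} (v : Fin (d + 1) → Fin m → ℝ)
    (hv : AffineIndependent ℝ v) (req : Finset (Fin (d + 1))) : PartialSimplex m d where
  vertex := v
  affineIndependent := hv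
  removed := {s | ¬ req ⊆ s}
  univ_not_removed := by simp

/-- A point lies in exactly one open face, spanned by the support of its barycentric coordinates, so
it survives the removal precisely when this support contains `req`. -/
theorem PartialSimplex.mem_carrier_ofRequired {m d : ℕ} {v : Fin (d + 1) → Fin m → ℝ}
    {hv : AffineIndependent ℝ v} {req : Finset (Fin (d + 1))} {x : Fin m → ℝ} :
    x ∈ (PartialSimplex.ofRequired v hv req).carrier ↔
      ∃ w ∈ weightSet req, x = ∑ j, w j • v j := by
  have key : convexHull ℝ (Set.range v) = {x | ∃ w ∈ stdSimplex ℝ (Fin (d + 1)),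
      x = ∑ j, w j • v j} := by
    apply Set.Subset.antisymm
    · apply convexHull_min
      · rintro _ ⟨j, rfl⟩
        exact ⟨Pi.single j 1, single_mem_stdSimplex ℝ j, by simp [Pi.single_apply]⟩
      · rintro _ ⟨w, hw, rfl⟩ _ ⟨w', hw', rfl⟩ a b ha hb hab
        refine ⟨_, convex_stdSimplex ℝ _ hw hw' ha hb hab, ?_⟩
        simp [add_smul, mul_smul, Finset.sum_add_distrib, Finset.smul_sum]
    · rintro _ ⟨w, hw, rfl⟩
      exact (convex_convexHull ℝ _).sum_mem (fun j _ => hw.1 j) hw.2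
        fun j _ => subset_convexHull ℝ _ ⟨j, rfl⟩
  constructor
  · rintro ⟨hx, hx'⟩
    change x ∈ convexHull ℝ (Set.range v) at hx
    rw [key] at hx
    obtain ⟨w, hw, rfl⟩ := hx
    refine ⟨w, ⟨hw.1, hw.2, ?_⟩, rfl⟩
    by_contra hcon
    push Not at hcon
    obtain ⟨j, hj, hjw⟩ := hcon
    apply hx'
    rw [Set.mem_iUnion₂]
    -- The removed face containing the point is the one on its support.
    refine ⟨Finset.univ.filter fun j => 0 < w j, ?_, w, hw.2, by simp, ?_, rfl⟩
    · intro hsub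
      have := hsub hj
      simp only [Finset.mem_filter] at this
      linarith [this.2]
    · intro j hj
      simp only [Finset.mem_filter, Finset.mem_univ, true_and, not_lt] at hj
      exact le_antisymm hj (hw.1 j)
  · rintro ⟨w, hw, rfl⟩
    refine ⟨?_, ?_⟩
    · change _ ∈ convexHull ℝ (Set.range v)
      rw [key]
      exact ⟨w, ⟨hw.1, hw.2.1⟩, rfl⟩
    · rw [Set.mem_iUnion₂]
      rintro ⟨s, hs, w', h1, h2, h3, h4⟩
      have hww : w = w' := eq_of_sum_smul_eq hv (by rw [hw.2.1, h1]) h4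
      subst hww
      apply hs
      intro j hj
      by_contra hjs
      exact (hw.2.2 j hj).ne' (h3 j hjs)

/-! ### Affine families of broken lines and their swipes. -/

/-- The vertices of the successive turning simplices of an affine family of broken lines. -/
noncomputable def turningVertex {m d : ℕ} (base : Fin (d + 1) → Fin m → ℝ) (dir : ℕ → Fin m)
    (len : ℕ → Fin (d + 1) → ℝ) : ℕ → Fin (d + 1) → Fin m → ℝ
  | 0 => base
  | i + 1 => fun j => turningVertex base dir len i j + len i j • Pi.single (dir i) 1

/-- An affine family of broken lines: they start at the points of a simplex, they all have the same
sequence of directions, and the lengths of their edges depend affinely on the starting point.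
Moreover each of the turning simplices lies in a hyperplane transversal to the edges that meet
it. -/
structure BrokenFamily (m d : ℕ) where
  k : ℕ
  base : Fin (d + 1) → Fin m → ℝ
  dir : ℕ → Fin m
  len : ℕ → Fin (d + 1) → ℝ
  normal : ℕ → Fin m → ℤ
  level : ℕ → ℤ
  base_indep : AffineIndependent ℝ base
  len_nonneg : ∀ i ≤ k, ∀ j, 0 ≤ len i j
  on_hyperplane : ∀ i ≤ k + 1, ∀ j,
    ∑ c, (normal i c : ℝ) * turningVertex base dir len i j c = level i
  normal_out : ∀ i ≤ k, normal i (dir i) ≠ 0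
  normal_in : ∀ i ≤ k, normal (i + 1) (dir i) ≠ 0

namespace BrokenFamily

variable {m d : ℕ} (B : BrokenFamily m d)

/-- The vertices of the turning simplices. -/
noncomputable abbrev vertex (i : ℕ) : Fin (d + 1) → Fin m → ℝ :=
  turningVertex B.base B.dir B.len i

/-- The turning points of the broken line of weight `w`. -/
noncomputable def point (i : ℕ) (w : Fin (d + 1) → ℝ) : Fin m → ℝ := ∑ j, w j • B.vertex i j

/-- The lengths of the edges of the broken line of weight `w`. -/
noncomputable def edge (i : ℕ) (w : Fin (d + 1) → ℝ) : ℝ := ∑ j, w j * B.len i j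

theorem point_succ (i : ℕ) (w : Fin (d + 1) → ℝ) :
    B.point (i + 1) w = B.point i w + B.edge i w • (Pi.single (B.dir i) 1 : Fin m → ℝ) := by
  simp [point, edge, vertex, turningVertex, Finset.sum_add_distrib, Finset.sum_smul, mul_smul]

theorem edge_nonneg {i : ℕ} (hi : i ≤ B.k) {w : Fin (d + 1) → ℝ} (hw : ∀ j, 0 ≤ w j) :
    0 ≤ B.edge i w :=
  Finset.sum_nonneg fun j _ => mul_nonneg (hw j) (B.len_nonneg i hi j)

theorem sum_normal_point {i : ℕ} (hi : i ≤ B.k + 1) (w : Fin (d + 1) → ℝ) :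
    ∑ c, (B.normal i c : ℝ) * B.point i w c = (∑ j, w j) * B.level i := by
  simp only [point, Finset.sum_apply, Pi.smul_apply, smul_eq_mul, Finset.mul_sum]
  rw [Finset.sum_comm, Finset.sum_mul]
  refine Finset.sum_congr rfl fun j _ => ?_
  rw [← B.on_hyperplane i hi j, Finset.mul_sum]
  exact Finset.sum_congr rfl fun c _ => by ring

theorem sum_mul_add_smul_single (a : Fin m → ℝ) (x : Fin m → ℝ) (t : ℝ) (i : Fin m) :
    ∑ c, a c * (x + t • (Pi.single i 1 : Fin m → ℝ)) c = ∑ c, a c * x c + t * a i := by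
  simp [mul_add, Finset.sum_add_distrib, Pi.single_apply, mul_comm]

/-- An affine relation among the vertices of the next simplex makes the same combination of the
present vertices a multiple of the direction. The hyperplane through the present simplex is
transversal to that direction, so the multiple vanishes and the relation already holds for the
present vertices. -/
theorem vertex_indep {i : ℕ} (hi : i ≤ B.k + 1) : AffineIndependent ℝ (B.vertex i) := by
  induction i with
  | zero => exact B.base_indep
  | succ i ih =>
    apply affineIndependent_of_sum
    intro w h0 h1
    change B.point (i + 1) w = 0 at h1
    have h2 := B.sum_normal_point (i := i) (by omega) w
    have h3 : B.point i w = 0 + (- B.edge i w) • (Pi.single (B.dir i) 1 : Fin m → ℝ) := by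
      rw [B.point_succ] at h1
      rw [zero_add, neg_smul]
      exact eq_neg_of_add_eq_zero_left h1
    rw [h3, sum_mul_add_smul_single, h0] at h2
    have h4 : (B.normal i (B.dir i) : ℝ) ≠ 0 := by exact_mod_cast B.normal_out i (by omega)
    have h5 : B.edge i w = 0 := by simpa [h4] using h2
    have h6 : ∑ j, w j • B.vertex i j = 0 := by simpa [h5, point] using h3
    exact fun j => (ih (by omega)).eq_zero_of_sum_eq_zero h0 h6 j (Finset.mem_univ j)

/-- The turning partial simplices. -/
noncomputable def simplex (req : Finset (Fin (d + 1))) (i : ℕ) (hi : i ≤ B.k + 1) :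
    PartialSimplex m d :=
  PartialSimplex.ofRequired (B.vertex i) (B.vertex_indep hi) req

variable {B} {req : Finset (Fin (d + 1))}

theorem mem_simplex {i : ℕ} {hi : i ≤ B.k + 1} {x : Fin m → ℝ} :
    x ∈ (B.simplex req i hi).carrier ↔ ∃ w ∈ weightSet req, x = B.point i w :=
  PartialSimplex.mem_carrier_ofRequired

theorem point_injOn {i : ℕ} (hi : i ≤ B.k + 1) {w w' : Fin (d + 1) → ℝ}
    (hw : w ∈ weightSet req) (hw' : w' ∈ weightSet req) (h : B.point i w = B.point i w') :
    w = w' :=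
  eq_of_sum_smul_eq (B.vertex_indep hi) (by rw [hw.2.1, hw'.2.1]) h

theorem translates_point {i : ℕ} (hi : i ≤ B.k) {w : Fin (d + 1) → ℝ}
    (hw : w ∈ weightSet req) : Translates (B.dir i) (B.point i w) (B.point (i + 1) w) :=
  ⟨B.edge i w, B.edge_nonneg hi hw.1, B.point_succ i w⟩

/-- A line transversal to the hyperplane of a turning simplex meets it in one point only. All
injectivity statements for swipes rest on this. -/
theorem eq_of_parallel {i : ℕ} (hi : i ≤ B.k + 1) {e : Fin m} (he : B.normal i e ≠ 0)
    {w w' : Fin (d + 1) → ℝ} (hw : w ∈ weightSet req) (hw' : w' ∈ weightSet req) {t : ℝ}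
    (h : B.point i w = B.point i w' + t • (Pi.single e 1 : Fin m → ℝ)) : w = w' := by
  have h2 := B.sum_normal_point hi w
  rw [h, sum_mul_add_smul_single, B.sum_normal_point hi w', hw.2.1, hw'.2.1] at h2
  have h4 : (B.normal i e : ℝ) ≠ 0 := by exact_mod_cast he
  have h5 : t = 0 := by simpa [h4] using h2
  exact point_injOn hi hw hw' (by simpa [h5] using h)

theorem eq_of_translates_succ {i : ℕ} (hi : i ≤ B.k) {w w' : Fin (d + 1) → ℝ}
    (hw : w ∈ weightSet req) (hw' : w' ∈ weightSet req)
    (h : Translates (B.dir i) (B.point i w) (B.point (i + 1) w')) : w' = w := by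
  obtain ⟨t, -, ht⟩ := h
  refine eq_of_parallel (i := i + 1) (by omega) (B.normal_in i hi) hw' hw
    (t := t - B.edge i w) ?_
  rw [ht, B.point_succ, sub_smul]
  abel

/-- `x` lies on the `i`-th edge of the broken line of weight `w`. -/
def OnEdge (B : BrokenFamily m d) (i : ℕ) (w : Fin (d + 1) → ℝ) (x : Fin m → ℝ) : Prop :=
  ∃ t : ℝ, 0 ≤ t ∧ t ≤ B.edge i w ∧ x = B.point i w + t • (Pi.single (B.dir i) 1 : Fin m → ℝ)

theorem mem_segment_iff_onEdge {i : ℕ} {w : Fin (d + 1) → ℝ} (h : 0 ≤ B.edge i w)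
    {x : Fin m → ℝ} : x ∈ segment ℝ (B.point i w) (B.point (i + 1) w) ↔ B.OnEdge i w x := by
  rw [segment_eq_image', B.point_succ]
  constructor
  · rintro ⟨θ, ⟨h0, h1⟩, rfl⟩
    refine ⟨θ * B.edge i w, by positivity, mul_le_of_le_one_left h h1, ?_⟩
    simp [mul_smul]
  · rintro ⟨t, h0, h1, rfl⟩
    rcases h.eq_or_lt with h | h
    · exact ⟨0, by simp, by simp [show t = 0 by linarith]⟩
    · refine ⟨t / B.edge i w, ⟨by positivity, div_le_one_of_le₀ h1 h.le⟩, ?_⟩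
      simp [smul_smul, div_mul_cancel₀ _ h.ne']

theorem point_combination (i : ℕ) (a b : ℝ) (w w' : Fin (d + 1) → ℝ) :
    B.point i (a • w + b • w') = a • B.point i w + b • B.point i w' := by
  simp [point, add_smul, mul_smul, Finset.sum_add_distrib, Finset.smul_sum]

theorem edge_combination (i : ℕ) (a b : ℝ) (w w' : Fin (d + 1) → ℝ) :
    B.edge i (a • w + b • w') = a * B.edge i w + b * B.edge i w' := by
  simp [edge, add_mul, mul_assoc, Finset.sum_add_distrib, Finset.mul_sum]

/-- Starting points and edge lengths are both linear in the weight, so the position along the edge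
can be averaged together with the weight. -/
theorem convex_onEdge (i : ℕ) : Convex ℝ {x | ∃ w ∈ weightSet req, B.OnEdge i w x} := by
  rintro _ ⟨w, hw, t, h0, h1, rfl⟩ _ ⟨w', hw', t', h0', h1', rfl⟩ a b ha hb hab
  refine ⟨_, convex_weightSet req hw hw' ha hb hab, a * t + b * t', by positivity, ?_, ?_⟩
  · rw [edge_combination]; gcongr
  · rw [point_combination]; simp only [smul_add, add_smul, mul_smul]; abel

theorem exists_translates_segment_iff {i : ℕ} (hi : i ≤ B.k) {z : Fin m → ℝ} :
    (∃ x ∈ (B.simplex req i (by omega)).carrier,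
      ∃ y ∈ (B.simplex req (i + 1) (by omega)).carrier,
      Translates (B.dir i) x y ∧ z ∈ segment ℝ x y) ↔ ∃ w ∈ weightSet req, B.OnEdge i w z := by
  constructor
  · rintro ⟨x, hx, y, hy, hxy, hz⟩
    obtain ⟨w, hw, rfl⟩ := mem_simplex.1 hx
    obtain ⟨w', hw', rfl⟩ := mem_simplex.1 hy
    obtain rfl := eq_of_translates_succ hi hw hw' hxy
    exact ⟨_, hw, (mem_segment_iff_onEdge (B.edge_nonneg hi hw.1)).1 hz⟩
  · rintro ⟨w, hw, hz⟩
    exact ⟨_, mem_simplex.2 ⟨w, hw, rfl⟩, _, mem_simplex.2 ⟨w, hw, rfl⟩,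
      translates_point hi hw, (mem_segment_iff_onEdge (B.edge_nonneg hi hw.1)).2 hz⟩

variable (B req) in
/-- The swipes of a family of broken lines. -/
noncomputable def toSwipe (i : ℕ) (hi : i ≤ B.k) : Swipe m d where
  dir := B.dir i
  start := B.simplex req i (by omega)
  finish := B.simplex req (i + 1) (by omega)
  vertex_translates j := ⟨B.len i j, B.len_nonneg i hi j, rfl⟩
  existsUnique_finish := by
    intro x hx
    obtain ⟨w, hw, rfl⟩ := mem_simplex.1 hx
    refine ⟨B.point (i + 1) w, ⟨mem_simplex.2 ⟨w, hw, rfl⟩, translates_point hi hw⟩, ?_⟩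
    rintro y ⟨hy, hty⟩
    obtain ⟨w', hw', rfl⟩ := mem_simplex.1 hy
    rw [eq_of_translates_succ hi hw hw' hty]
  existsUnique_start := by
    intro y hy
    obtain ⟨w, hw, rfl⟩ := mem_simplex.1 hy
    refine ⟨B.point i w, ⟨mem_simplex.2 ⟨w, hw, rfl⟩, translates_point hi hw⟩, ?_⟩
    rintro x ⟨hx, htx⟩
    obtain ⟨w', hw', rfl⟩ := mem_simplex.1 hx
    rw [eq_of_translates_succ hi hw' hw htx]
  convex := by
    simp only [exists_translates_segment_iff hi]
    exact convex_onEdge i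

theorem mem_carrier_toSwipe {i : ℕ} {hi : i ≤ B.k} {x : Fin m → ℝ} :
    x ∈ (B.toSwipe req i hi).carrier ↔ ∃ w ∈ weightSet req, B.OnEdge i w x :=
  exists_translates_segment_iff hi

theorem eq_of_onEdge_point {i : ℕ} (hi : i ≤ B.k) {w w' : Fin (d + 1) → ℝ}
    (hw : w ∈ weightSet req) (hw' : w' ∈ weightSet req) (h : B.OnEdge i w (B.point i w')) :
    w' = w := by
  obtain ⟨t, -, -, ht⟩ := h
  exact eq_of_parallel (by omega) (B.normal_out i hi) hw' hw ht

theorem eq_of_onEdge_point_succ {i : ℕ} (hi : i ≤ B.k) {w w' : Fin (d + 1) → ℝ}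
    (hw : w ∈ weightSet req) (hw' : w' ∈ weightSet req)
    (h : B.OnEdge i w (B.point (i + 1) w')) : w' = w := by
  obtain ⟨t, h0, -, ht⟩ := h
  exact eq_of_translates_succ hi hw hw' ⟨t, h0, ht⟩

theorem onEdge_point {i : ℕ} (hi : i ≤ B.k) {w : Fin (d + 1) → ℝ} (hw : w ∈ weightSet req) :
    B.OnEdge i w (B.point i w) :=
  ⟨0, le_rfl, B.edge_nonneg hi hw.1, by simp⟩

theorem point_mono {i j : ℕ} (hij : i ≤ j) (hj : j ≤ B.k + 1) {w : Fin (d + 1) → ℝ}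
    (hw : w ∈ weightSet req) : B.point i w ≤ B.point j w := by
  induction j, hij using Nat.le_induction with
  | base => exact le_rfl
  | succ j hij ih =>
    refine (ih (by omega)).trans ?_
    rw [B.point_succ]
    have := B.edge_nonneg (i := j) (by omega) hw.1
    exact le_add_of_nonneg_right (smul_nonneg this (by simp [Pi.single_nonneg]))

theorem OnEdge.point_le {i : ℕ} {w : Fin (d + 1) → ℝ} {x : Fin m → ℝ} (h : B.OnEdge i w x) :
    B.point i w ≤ x := by
  obtain ⟨t, h0, -, rfl⟩ := h
  exact le_add_of_nonneg_right (smul_nonneg h0 (by simp [Pi.single_nonneg]))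

theorem OnEdge.le_point_succ {i : ℕ} {w : Fin (d + 1) → ℝ} {x : Fin m → ℝ}
    (h : B.OnEdge i w x) : x ≤ B.point (i + 1) w := by
  obtain ⟨t, -, h1, rfl⟩ := h
  rw [B.point_succ]
  gcongr
  simp [Pi.single_nonneg]

/-- Lines are monotone: a point on both an earlier and a later edge is squeezed between turning
points, and everything in between is degenerate. -/
theorem OnEdge.eq_point {i j l : ℕ} {w : Fin (d + 1) → ℝ} {x : Fin m → ℝ}
    (hw : w ∈ weightSet req) (h : B.OnEdge i w x) (h' : B.OnEdge j w x) (hil : i < l)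
    (hlj : l ≤ j) (hj : j ≤ B.k) : x = B.point l w :=
  le_antisymm (h.le_point_succ.trans (point_mono hil (by omega) hw))
    ((point_mono hlj (by omega) hw).trans h'.point_le)

theorem OnEdge.eq_point_of_eq_zero {i l : ℕ} {w : Fin (d + 1) → ℝ} {x : Fin m → ℝ}
    (hw : w ∈ weightSet req) (h : B.OnEdge i w x) (hi : i ≤ B.k) (hx : x = B.point 0 w)
    (hl : l ≤ i) : x = B.point l w :=
  le_antisymm (hx.le.trans (point_mono (Nat.zero_le l) (by omega) hw))
    ((point_mono hl (by omega) hw).trans h.point_le)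

theorem OnEdge.eq_point_of_eq_last {i l : ℕ} {w : Fin (d + 1) → ℝ} {x : Fin m → ℝ}
    (hw : w ∈ weightSet req) (h : B.OnEdge i w x) (hx : x = B.point (B.k + 1) w)
    (hl : i < l) (hlk : l ≤ B.k + 1) : x = B.point l w :=
  le_antisymm (h.le_point_succ.trans (point_mono hl (by omega) hw))
    ((point_mono hlk le_rfl hw).trans hx.ge)

end BrokenFamily

/-! ### Real and fake snakes swept out by a family. -/

namespace BrokenFamily

variable {m d : ℕ} {B : BrokenFamily m d} {req : Finset (Fin (d + 1))}

variable (B) in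
/-- The broken line of weight `w`. -/
def trace (w : Fin (d + 1) → ℝ) : Set (Fin m → ℝ) := {x | ∃ i ≤ B.k, B.OnEdge i w x}

variable (B) in
/-- The broken line of weight `w` without its endpoints. -/
def openTrace (w : Fin (d + 1) → ℝ) : Set (Fin m → ℝ) :=
  {x | x ∈ B.trace w ∧ x ≠ B.point 0 w ∧ x ≠ B.point (B.k + 1) w}

variable (B req) in
/-- The compatible sequence of swipes of a family of broken lines. -/
noncomputable def toSequence : SwipeSequence m where
  d := d
  k := B.k
  swipe i := B.toSwipe req i (Nat.lt_succ_iff.1 i.2)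
  compatible _ := rfl

theorem mem_carrier_swipe {i : Fin (B.k + 1)} {x : Fin m → ℝ} :
    x ∈ ((B.toSequence req).swipe i).carrier ↔ ∃ w ∈ weightSet req, B.OnEdge i w x :=
  mem_carrier_toSwipe (hi := Nat.lt_succ_iff.1 i.2)

theorem mem_start_swipe {i : Fin (B.k + 1)} {x : Fin m → ℝ} :
    x ∈ ((B.toSequence req).swipe i).start.carrier ↔
      ∃ w ∈ weightSet req, x = B.point i w :=
  mem_simplex (hi := i.2.le)

theorem mem_finish_swipe {i : Fin (B.k + 1)} {x : Fin m → ℝ} :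
    x ∈ ((B.toSequence req).swipe i).finish.carrier ↔
      ∃ w ∈ weightSet req, x = B.point (i + 1) w :=
  mem_simplex (hi := Nat.succ_le_of_lt i.2)

theorem mem_realCarrier {x : Fin m → ℝ} :
    x ∈ (B.toSequence req).realCarrier ↔ ∃ w ∈ weightSet req, x ∈ B.trace w := by
  rw [SwipeSequence.realCarrier, Set.mem_iUnion]
  constructor
  · rintro ⟨i, hi⟩
    obtain ⟨w, hw, h⟩ := mem_carrier_swipe.1 hi
    exact ⟨w, hw, i, Nat.lt_succ_iff.1 i.2, h⟩
  · rintro ⟨w, hw, i, hi, h⟩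
    exact ⟨⟨i, Nat.lt_succ_iff.2 hi⟩, mem_carrier_swipe.2 ⟨w, hw, h⟩⟩

theorem continuous_point (i : ℕ) : Continuous (B.point i) := by
  unfold point; fun_prop

theorem continuous_edge (i : ℕ) : Continuous (B.edge i) := by
  unfold edge; fun_prop

variable (B) in
theorem isClosed_realCarrier : IsClosed (B.toSequence ∅).realCarrier := by
  refine isClosed_iUnion_of_finite fun i : Fin (B.k + 1) => ?_
  -- Measuring the position on an edge as a fraction of its length makes the swipe a continuous
  -- image of a fixed compact set.
  have : ((B.toSequence ∅).swipe i).carrier =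
      (fun p : (Fin (d + 1) → ℝ) × ℝ => B.point i p.1 +
        (p.2 * B.edge i p.1) • (Pi.single (B.dir i) 1 : Fin m → ℝ)) ''
        (stdSimplex ℝ (Fin (d + 1)) ×ˢ Set.Icc 0 1) := by
    ext x
    rw [mem_carrier_swipe, weightSet_empty]
    constructor
    · rintro ⟨w, hw, h⟩
      have h0 := B.edge_nonneg (Nat.lt_succ_iff.1 i.2) hw.1
      rw [← mem_segment_iff_onEdge h0, segment_eq_image', B.point_succ] at h
      obtain ⟨t, ht, rfl⟩ := h
      exact ⟨(w, t), ⟨hw, ht⟩, by simp [mul_smul]⟩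
    · rintro ⟨⟨w, t⟩, ⟨hw, ht⟩, rfl⟩
      have h0 := B.edge_nonneg (Nat.lt_succ_iff.1 i.2) hw.1
      exact ⟨w, hw, _, mul_nonneg ht.1 h0, mul_le_of_le_one_left h0 ht.2, rfl⟩
  rw [this]
  have h1 := B.continuous_point i
  have h2 := B.continuous_edge i
  exact (((isCompact_stdSimplex ℝ _).prod isCompact_Icc).image (by fun_prop)).isClosed

theorem inBoth_of_eq {x : Fin m → ℝ} {w : Fin (d + 1) → ℝ} (hw : w ∈ weightSet req)
    {l : Fin (B.k + 1)} (h : x = B.point l w) (h' : x = B.point (l + 1) w) :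
    (B.toSequence req).InBoth l x :=
  ⟨mem_start_swipe.2 ⟨w, hw, h⟩, mem_finish_swipe.2 ⟨w, hw, h'⟩⟩

/-- Disjointness of the lines reduces self-intersection of the snake to a single line meeting
itself, which by monotonicity happens only at degenerate edges. -/
theorem isReal (h : ∀ w ∈ weightSet (∅ : Finset (Fin (d + 1))), ∀ w' ∈ weightSet ∅,
    ∀ x ∈ B.trace w, x ∈ B.trace w' → w = w') : (B.toSequence ∅).IsReal := by
  refine ⟨B.isClosed_realCarrier, fun i j hij x hi hj => ?_⟩
  obtain ⟨w, hw, hxi⟩ := mem_carrier_swipe.1 hi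
  obtain ⟨w', hw', hxj⟩ := mem_carrier_swipe.1 hj
  have hik : (i : ℕ) ≤ B.k := Nat.lt_succ_iff.1 i.2
  have hjk : (j : ℕ) ≤ B.k := Nat.lt_succ_iff.1 j.2
  have hij' : (i : ℕ) < j := hij
  obtain rfl := h w hw w' hw' x ⟨i, hik, hxi⟩ ⟨j, hjk, hxj⟩
  have key : ∀ l, (i : ℕ) < l → l ≤ j → x = B.point l w :=
    fun l h1 h2 => hxi.eq_point hw hxj h1 h2 hjk
  refine ⟨mem_finish_swipe.2 ⟨w, hw, key _ (by omega) (by omega)⟩,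
    mem_start_swipe.2 ⟨w, hw, key _ (by omega) (by omega)⟩, fun l h1 h2 => ?_⟩
  have h1' : (i : ℕ) < l := h1
  have h2' : (l : ℕ) < j := h2
  exact inBoth_of_eq hw (key _ (by omega) (by omega)) (key _ (by omega) (by omega))

/-- Membership of `x` in both turning sets concerns the sets only, and the weights could a priori
differ from swipe to swipe. A translation by 0 counts as a translation, so transversality forces the
same weight at each step backwards. -/
theorem eq_point_zero_of_inBoth {x : Fin m → ℝ} {w : Fin (d + 1) → ℝ}
    (hw : w ∈ weightSet req) : ∀ i ≤ B.k, x = B.point i w →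
    (∀ l : Fin (B.k + 1), (l : ℕ) < i → (B.toSequence req).InBoth l x) → x = B.point 0 w
  | 0, _, h, _ => h
  | i + 1, hi, h, hb => by
    have hb' := hb ⟨i, by omega⟩ (Nat.lt_succ_self i)
    obtain ⟨w', hw', h'⟩ := mem_start_swipe.1 hb'.1
    have h' : x = B.point i w' := h'
    obtain rfl : w = w' := eq_of_translates_succ (B := B) (i := i) (by omega) hw' hw ⟨0, le_rfl, by
      rw [zero_smul, add_zero, ← h, h']⟩
    exact eq_point_zero_of_inBoth hw i (by omega) h' fun l hl => hb l (by omega)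

theorem eq_point_last_of_inBoth {x : Fin m → ℝ} {w : Fin (d + 1) → ℝ}
    (hw : w ∈ weightSet req) {i : ℕ} (hi : i ≤ B.k + 1) (h : x = B.point i w)
    (hb : ∀ l : Fin (B.k + 1), i ≤ (l : ℕ) → (B.toSequence req).InBoth l x) :
    x = B.point (B.k + 1) w := by
  induction hi using Nat.decreasingInduction with
  | self => exact h
  | of_succ i hi ih =>
    obtain ⟨w', hw', h'⟩ := mem_finish_swipe.1 (hb (⟨i, by omega⟩ : Fin (B.k + 1)) le_rfl).2
    have h' : x = B.point (i + 1) w' := h'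
    obtain rfl : w' = w := eq_of_translates_succ (B := B) (i := i) (by omega) hw hw' ⟨0, le_rfl, by
      rw [zero_smul, add_zero, ← h, h']⟩
    exact ih h' fun l hl => hb l (by omega)

/-- Halting at the start (or the end) means that nothing of the line of `x` has moved before (or
moves after), so the halted points are the endpoints of the lines. -/
theorem mem_trimmed {i : Fin (B.k + 1)} {x : Fin m → ℝ} :
    x ∈ (B.toSequence req).trimmed i ↔ ∃ w ∈ weightSet req, B.OnEdge i w x ∧
      x ≠ B.point 0 w ∧ x ≠ B.point (B.k + 1) w := by
  have hik : (i : ℕ) ≤ B.k := Nat.lt_succ_iff.1 i.2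
  constructor
  · rintro ⟨hx, hh⟩
    obtain ⟨w, hw, h⟩ := mem_carrier_swipe.1 hx
    refine ⟨w, hw, h, fun hx0 => hh (Or.inl ⟨fun l hl => ?_, ?_⟩),
      fun hx1 => hh (Or.inr ⟨fun l hl => ?_, ?_⟩)⟩
    · have hl : (l : ℕ) < i := hl
      exact inBoth_of_eq hw (h.eq_point_of_eq_zero hw hik hx0 (by omega))
        (h.eq_point_of_eq_zero hw hik hx0 (by omega))
    · exact mem_start_swipe.2 ⟨w, hw, h.eq_point_of_eq_zero hw hik hx0 le_rfl⟩
    · have hl : (i : ℕ) < l := hl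
      have hl' := l.2
      have hl' : (l : ℕ) < B.k + 1 := hl'
      exact inBoth_of_eq hw (h.eq_point_of_eq_last hw hx1 (by omega) (by omega))
        (h.eq_point_of_eq_last hw hx1 (by omega) (by omega))
    · exact mem_finish_swipe.2 ⟨w, hw, h.eq_point_of_eq_last hw hx1 (by omega) (by omega)⟩
  · rintro ⟨w, hw, h, h0, h1⟩
    refine ⟨mem_carrier_swipe.2 ⟨w, hw, h⟩, ?_⟩
    rintro (⟨hb, hs⟩ | ⟨hb, hs⟩)
    · obtain ⟨w', hw', hx⟩ := mem_start_swipe.1 hs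
      obtain rfl := eq_of_onEdge_point hik hw hw' (hx ▸ h)
      exact h0 (eq_point_zero_of_inBoth hw' i hik hx fun l hl => hb l hl)
    · obtain ⟨w', hw', hx⟩ := mem_finish_swipe.1 hs
      obtain rfl := eq_of_onEdge_point_succ hik hw hw' (hx ▸ h)
      exact h1 (eq_point_last_of_inBoth hw' (by omega) hx fun l hl => hb l hl)

theorem mem_fakeCarrier {x : Fin m → ℝ} :
    x ∈ (B.toSequence req).fakeCarrier ↔ ∃ w ∈ weightSet req, x ∈ B.openTrace w := by
  rw [SwipeSequence.fakeCarrier, Set.mem_iUnion]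
  constructor
  · rintro ⟨i, hi⟩
    obtain ⟨w, hw, h, h0⟩ := mem_trimmed.1 hi
    exact ⟨w, hw, ⟨i, Nat.lt_succ_iff.1 i.2, h⟩, h0⟩
  · rintro ⟨w, hw, ⟨i, hi, h⟩, h0⟩
    exact ⟨⟨i, Nat.lt_succ_iff.2 hi⟩, mem_trimmed.2 ⟨w, hw, h, h0⟩⟩

theorem isFake (h : ∀ w ∈ weightSet req, ∀ w' ∈ weightSet req,
    ∀ x ∈ B.openTrace w, x ∈ B.openTrace w' → w = w') : (B.toSequence req).IsFake := by
  intro i j hij x hi hj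
  obtain ⟨w, hw, hxi, hx0⟩ := mem_trimmed.1 hi
  obtain ⟨w', hw', hxj, hx1⟩ := mem_trimmed.1 hj
  have hik : (i : ℕ) ≤ B.k := Nat.lt_succ_iff.1 i.2
  have hjk : (j : ℕ) ≤ B.k := Nat.lt_succ_iff.1 j.2
  have hij' : (i : ℕ) < j := hij
  obtain rfl := h w hw w' hw' x ⟨⟨i, hik, hxi⟩, hx0⟩ ⟨⟨j, hjk, hxj⟩, hx1⟩
  have key : ∀ l, (i : ℕ) < l → l ≤ j → x = B.point l w :=
    fun l h1 h2 => hxi.eq_point hw hxj h1 h2 hjk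
  refine ⟨mem_finish_swipe.2 ⟨w, hw, key _ (by omega) (by omega)⟩,
    mem_start_swipe.2 ⟨w, hw, key _ (by omega) (by omega)⟩, fun l h1 h2 => ?_⟩
  have h1' : (i : ℕ) < l := h1
  have h2' : (l : ℕ) < j := h2
  refine ⟨mem_trimmed.2 ⟨w, hw, ?_, hx0⟩,
    inBoth_of_eq hw (key _ (by omega) (by omega)) (key _ (by omega) (by omega))⟩
  rw [key l (by omega) (by omega)]
  exact onEdge_point (by omega) hw

/-- The starting point fixes a weight, and transversality forces every later turning point to have
that weight. -/
theorem isPath_iff {v : Fin (B.k + 2) → Fin m → ℝ} :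
    (B.toSequence req).IsPath v ↔ ∃ w ∈ weightSet req, ∀ i, v i = B.point i w := by
  constructor
  · intro h
    obtain ⟨w, hw, h0⟩ := mem_start_swipe.1 (h 0).1
    refine ⟨w, hw, fun i => ?_⟩
    induction i using Fin.induction with
    | zero => exact h0
    | succ i ih =>
      obtain ⟨-, h2, h3⟩ := h i
      obtain ⟨w', hw', h4⟩ := mem_finish_swipe.1 h2
      have h3 : Translates (B.dir i) (v i.castSucc) (v i.succ) := h3
      have h4 : v i.succ = B.point (i + 1) w' := h4
      rw [ih, h4] at h3
      rw [h4, eq_of_translates_succ (Nat.lt_succ_iff.1 i.2) hw hw' h3]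
      rfl
  · rintro ⟨w, hw, h⟩ i
    have hi : (i : ℕ) ≤ B.k := Nat.lt_succ_iff.1 i.2
    refine ⟨mem_start_swipe.2 ⟨w, hw, h i.castSucc⟩, mem_finish_swipe.2 ⟨w, hw, h i.succ⟩, ?_⟩
    have h1 := h i.castSucc
    have h2 := h i.succ
    change Translates (B.dir i) (v i.castSucc) (v i.succ)
    rw [h1, h2]
    exact translates_point hi hw

theorem brokenLine_eq_trace {w : Fin (d + 1) → ℝ} (hw : w ∈ weightSet req) :
    brokenLine (fun i : Fin (B.k + 2) => B.point i w) = B.trace w := by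
  ext x
  rw [brokenLine, Set.mem_iUnion]
  constructor
  · rintro ⟨i, hi⟩
    have hik : (i : ℕ) ≤ B.k := Nat.lt_succ_iff.1 i.2
    exact ⟨i, hik, (mem_segment_iff_onEdge (B.edge_nonneg hik hw.1)).1 hi⟩
  · rintro ⟨i, hi, h⟩
    exact ⟨⟨i, Nat.lt_succ_iff.2 hi⟩, (mem_segment_iff_onEdge (B.edge_nonneg hi hw.1)).2 h⟩

end BrokenFamily

/-! ### Chain systems and the geometric decompositions they define. -/

/-- A finite system of families of broken lines, some of them taken with their endpoints (real ones)
and the others without (fake ones), such that every point of `P` lies on a unique line. -/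
structure ChainSystem {m : ℕ} (P : Set (Fin m → ℝ)) (d N : ℕ) where
  family : Fin N → BrokenFamily m d
  fake : Fin N → Prop
  req : Fin N → Finset (Fin (d + 1))
  req_real : ∀ a, ¬ fake a → req a = ∅
  chain : Fin N → (Fin (d + 1) → ℝ) → Set (Fin m → ℝ)
  chain_real : ∀ a, ¬ fake a → chain a = (family a).trace
  chain_fake : ∀ a, fake a → chain a = (family a).openTrace
  unique : ∀ a, ∀ w ∈ weightSet (req a), ∀ b, ∀ w' ∈ weightSet (req b), ∀ x ∈ chain a w,
    x ∈ chain b w' → a = b ∧ w = w'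
  mem_iff : ∀ x, x ∈ P ↔ ∃ a, ∃ w ∈ weightSet (req a), x ∈ chain a w
  symmetric : ∀ a j, rk ((family a).vertex 0 j) + rk ((family a).vertex ((family a).k + 1) j) =
    totalRank P

namespace ChainSystem

variable {m d N : ℕ} {P : Set (Fin m → ℝ)} (S : ChainSystem P d N)

theorem isReal {a : Fin N} (ha : ¬ S.fake a) :
    ((S.family a).toSequence (S.req a)).IsReal := by
  have h := S.unique a
  have h' := fun w hw w' hw' x hx hx' => (h w hw a w' hw' x hx hx').2
  rw [S.chain_real a ha, S.req_real a ha] at h'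
  rw [S.req_real a ha]
  exact BrokenFamily.isReal h'

theorem isFake {a : Fin N} (ha : S.fake a) :
    ((S.family a).toSequence (S.req a)).IsFake := by
  have h := S.unique a
  have h' := fun w hw w' hw' x hx hx' => (h w hw a w' hw' x hx hx').2
  rw [S.chain_fake a ha] at h'
  exact BrokenFamily.isFake h'

open Classical in
/-- The snakes of a chain system. -/
noncomputable def snake (a : Fin N) : Snake m :=
  if h : S.fake a then .fake _ (S.isFake h) else .real _ (S.isReal h)

theorem seq_snake (a : Fin N) : (S.snake a).seq = (S.family a).toSequence (S.req a) := by
  unfold snake; split <;> rfl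

theorem mem_carrier_snake {a : Fin N} {x : Fin m → ℝ} :
    x ∈ (S.snake a).carrier ↔ ∃ w ∈ weightSet (S.req a), x ∈ S.chain a w := by
  unfold snake
  split
  · rename_i h; rw [S.chain_fake a h]; exact BrokenFamily.mem_fakeCarrier
  · rename_i h; rw [S.chain_real a h]; exact BrokenFamily.mem_realCarrier

/-- Nonemptiness is needed because a degenerate line without its endpoints is empty and does not
count as a chain of a fake snake. -/
theorem mem_chains_snake {a : Fin N} {C : Set (Fin m → ℝ)} (hC : C.Nonempty) :
    C ∈ (S.snake a).chains ↔ ∃ w ∈ weightSet (S.req a), C = S.chain a w := by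
  unfold snake
  split
  · rename_i h
    rw [S.chain_fake a h]
    constructor
    · rintro ⟨-, v, hv, rfl⟩
      obtain ⟨w, hw, hvw⟩ := BrokenFamily.isPath_iff.1 hv
      obtain rfl : v = fun i : Fin ((S.family a).k + 2) => (S.family a).point i w := funext hvw
      refine ⟨w, hw, ?_⟩
      change brokenLine (fun i : Fin ((S.family a).k + 2) => (S.family a).point i w) \ _ = _
      rw [BrokenFamily.brokenLine_eq_trace hw]
      ext x
      simp only [BrokenFamily.openTrace, Set.mem_sdiff, Set.mem_insert_iff,
        Set.mem_singleton_iff, not_or]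
      exact Iff.rfl
    · rintro ⟨w, hw, rfl⟩
      refine ⟨hC, fun i => (S.family a).point i w,
        BrokenFamily.isPath_iff.2 ⟨w, hw, fun i => rfl⟩, ?_⟩
      change _ = brokenLine (fun i : Fin ((S.family a).k + 2) => (S.family a).point i w) \ _
      rw [BrokenFamily.brokenLine_eq_trace hw]
      ext x
      simp only [BrokenFamily.openTrace, Set.mem_sdiff, Set.mem_insert_iff,
        Set.mem_singleton_iff, not_or]
      exact Iff.rfl
  · rename_i h
    rw [S.chain_real a h]
    constructor
    · rintro ⟨v, hv, rfl⟩
      obtain ⟨w, hw, hvw⟩ := BrokenFamily.isPath_iff.1 hv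
      obtain rfl : v = fun i : Fin ((S.family a).k + 2) => (S.family a).point i w := funext hvw
      exact ⟨w, hw, BrokenFamily.brokenLine_eq_trace hw⟩
    · rintro ⟨w, hw, rfl⟩
      exact ⟨fun i => (S.family a).point i w,
        BrokenFamily.isPath_iff.2 ⟨w, hw, fun i => rfl⟩,
        (BrokenFamily.brokenLine_eq_trace hw).symm⟩

/-- The geometric symmetric chain decomposition given by a chain system. -/
noncomputable def toGeometricSCD : GeometricSCD P where
  N := N
  snake := S.snake
  disjoint a b hab := by
    rw [Set.disjoint_left]
    intro x hx hx'
    obtain ⟨w, hw, h⟩ := S.mem_carrier_snake.1 hx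
    obtain ⟨w', hw', h'⟩ := S.mem_carrier_snake.1 hx'
    exact hab (S.unique a w hw b w' hw' x h h').1
  cover := by
    ext x
    rw [Set.mem_iUnion, S.mem_iff]
    exact exists_congr fun a => S.mem_carrier_snake
  symmetric a := by
    unfold snake
    split <;> exact S.symmetric a

end ChainSystem

/-! ### Ranks, lattice points and integral hyperplanes. -/

theorem rk_add_smul_single {m : ℕ} (x : Fin m → ℝ) (t : ℝ) (i : Fin m) :
    rk (x + t • (Pi.single i 1 : Fin m → ℝ)) = rk x + t := by
  simp [rk, Finset.sum_add_distrib, Pi.single_apply]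

theorem rk_mono {m : ℕ} {x y : Fin m → ℝ} (h : x ≤ y) : rk x ≤ rk y :=
  Finset.sum_le_sum fun i _ => h i

theorem eq_of_le_of_rk_eq {m : ℕ} {x y : Fin m → ℝ} (h : x ≤ y) (h' : rk x = rk y) : x = y := by
  have := (Finset.sum_eq_sum_iff_of_le fun i _ => h i).1 h'
  exact funext fun i => this i (Finset.mem_univ i)

theorem latticePoints_mono {m n n' : ℕ} (h : n ∣ n') (hn' : n' ≠ 0) :
    latticePoints m n ⊆ latticePoints m n' := by
  obtain ⟨c, rfl⟩ := h
  intro x hx i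
  obtain ⟨z, hz⟩ := hx i
  have hn : (n : ℝ) ≠ 0 := by rintro h; simp_all
  have hc : (c : ℝ) ≠ 0 := by rintro h; simp_all
  exact ⟨z * c, by rw [hz]; push_cast; field_simp⟩

theorem exists_sum_eq_of_mem_latticePoints {m n : ℕ} {x : Fin m → ℝ}
    (hx : x ∈ latticePoints m n) (a : Fin m → ℤ) :
    ∃ z : ℤ, ∑ c, (a c : ℝ) * x c = z / n := by
  choose z hz using hx
  refine ⟨∑ c, a c * z c, ?_⟩
  push_cast
  rw [Finset.sum_div]
  exact Finset.sum_congr rfl fun c _ => by rw [hz c]; ring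

theorem exists_rk_eq_of_mem_latticePoints {m n : ℕ} {x : Fin m → ℝ}
    (hx : x ∈ latticePoints m n) : ∃ z : ℤ, rk x = z / n := by
  simpa [rk] using exists_sum_eq_of_mem_latticePoints hx 1

theorem add_smul_single_mem_latticePoints {m n : ℕ} {x : Fin m → ℝ}
    (hx : x ∈ latticePoints m n) {t : ℝ} {z : ℤ} (ht : t = z / n) (i : Fin m) :
    x + t • (Pi.single i 1 : Fin m → ℝ) ∈ latticePoints m n := by
  intro c
  obtain ⟨z', hz'⟩ := hx c
  by_cases hc : c = i
  · subst hc
    exact ⟨z' + z, by simp [hz', ht, add_div]⟩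
  · exact ⟨z', by simp [hz', hc]⟩

/-- The equation determines `t` as a quotient by `a i` of an element of (1/n)ℤ, so the denominator
grows at most by the factor |a i|. -/
theorem mem_latticePoints_of_hyperplane {m n : ℕ} (hn : n ≠ 0) {x : Fin m → ℝ}
    (hx : x ∈ latticePoints m n) (a : Fin m → ℤ) (b : ℤ) {i : Fin m} (hi : a i ≠ 0) {t : ℝ}
    (h : ∑ c, (a c : ℝ) * (x + t • (Pi.single i 1 : Fin m → ℝ)) c = b) :
    x + t • (Pi.single i 1 : Fin m → ℝ) ∈ latticePoints m (n * (a i).natAbs) := by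
  obtain ⟨z, hz⟩ := exists_sum_eq_of_mem_latticePoints hx a
  rw [BrokenFamily.sum_mul_add_smul_single, hz] at h
  have hn' : (n : ℝ) ≠ 0 := by exact_mod_cast hn
  have ha : (a i : ℝ) ≠ 0 := by exact_mod_cast hi
  have hab : (((a i).natAbs : ℕ) : ℝ) = (((a i).sign : ℤ) : ℝ) * a i := by
    have := Int.sign_mul_self_eq_abs (a i)
    rw [← Int.cast_mul, this, Nat.cast_natAbs]
  have hs : (((a i).sign : ℤ) : ℝ) ≠ 0 := by
    exact_mod_cast (Int.sign_eq_zero_iff_zero.not.2 hi)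
  -- Here t = (bn - z) / (n a_i); the sign turns the denominator a_i into its absolute value.
  refine add_smul_single_mem_latticePoints (z := (b * n - z) * (a i).sign)
    (latticePoints_mono (Dvd.intro _ rfl) (by simp [hn, hi]) hx) ?_ i
  push_cast
  rw [hab]
  field_simp
  field_simp at h
  linarith

/-! ### Lattice points on broken lines. -/

namespace BrokenFamily

variable {m d : ℕ} {B : BrokenFamily m d} {req : Finset (Fin (d + 1))} {n : ℕ}
  {w : Fin (d + 1) → ℝ} {x : Fin m → ℝ}

theorem sum_normal_point_eq (hw : w ∈ weightSet req) {i : ℕ} (hi : i ≤ B.k + 1) :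
    ∑ c, (B.normal i c : ℝ) * B.point i w c = B.level i := by
  rw [B.sum_normal_point hi, hw.2.1, one_mul]

/-- Going forward from `x`, the hyperplane hit at the end of each edge contributes its coefficient
in the direction of that edge. -/
theorem point_mem_latticePoints_of_lt (hn : n ≠ 0) (hw : w ∈ weightSet req)
    (hx : x ∈ latticePoints m n) {i : ℕ} (h : B.OnEdge i w x) {q : ℕ} (hiq : i + 1 ≤ q)
    (hq : q ≤ B.k + 1) : B.point q w ∈ latticePoints m
      (n * ∏ r ∈ Finset.range q, (B.normal (r + 1) (B.dir r)).natAbs) := by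
  have hpos : ∀ q ≤ B.k + 1, ∏ r ∈ Finset.range q, (B.normal (r + 1) (B.dir r)).natAbs ≠ 0 :=
    fun q hq => Finset.prod_ne_zero_iff.2 fun r hr =>
      Int.natAbs_ne_zero.2 (B.normal_in r (by have := Finset.mem_range.1 hr; omega))
  induction q, hiq using Nat.le_induction with
  | base =>
    obtain ⟨t, -, -, rfl⟩ := h
    have h1 : B.point (i + 1) w = B.point i w + t • (Pi.single (B.dir i) 1 : Fin m → ℝ) +
        (B.edge i w - t) • (Pi.single (B.dir i) 1 : Fin m → ℝ) := by
      rw [B.point_succ, sub_smul]; abel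
    have h2 := mem_latticePoints_of_hyperplane hn hx (B.normal (i + 1)) (B.level (i + 1))
      (B.normal_in i (by omega)) (t := B.edge i w - t) (by
        rw [← h1]; exact sum_normal_point_eq hw hq)
    rw [← h1] at h2
    refine latticePoints_mono (mul_dvd_mul_left _ ?_) (mul_ne_zero hn (hpos _ hq)) h2
    rw [Finset.prod_range_succ]
    exact Dvd.intro_left _ rfl
  | succ q hiq ih =>
    have h0 := ih (by omega)
    have h1 := B.point_succ q w
    have h2 := mem_latticePoints_of_hyperplane (mul_ne_zero hn (hpos q (by omega))) h0
      (B.normal (q + 1)) (B.level (q + 1))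
      (B.normal_in q (by omega)) (t := B.edge q w) (by
        rw [← h1]; exact sum_normal_point_eq hw hq)
    rw [← h1] at h2
    rwa [Finset.prod_range_succ, ← mul_assoc]

/-- Going backward from `x`, the relevant hyperplane is the one at the start of each edge, which
accounts for the second product in `IsDenominator`. -/
theorem point_mem_latticePoints_of_le (hn : n ≠ 0) (hw : w ∈ weightSet req)
    (hx : x ∈ latticePoints m n) {i : ℕ} (hi : i ≤ B.k) (h : B.OnEdge i w x) {q : ℕ}
    (hq : q ≤ i) : B.point q w ∈ latticePoints m
      (n * ∏ r ∈ Finset.Ico q (B.k + 1), (B.normal r (B.dir r)).natAbs) := by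
  have hpos : ∀ q, ∏ r ∈ Finset.Ico q (B.k + 1), (B.normal r (B.dir r)).natAbs ≠ 0 :=
    fun q => Finset.prod_ne_zero_iff.2 fun r hr =>
      Int.natAbs_ne_zero.2 (B.normal_out r (by have := Finset.mem_Ico.1 hr; omega))
  induction hq using Nat.decreasingInduction with
  | self =>
    obtain ⟨t, -, -, rfl⟩ := h
    have h1 : B.point i w = B.point i w + t • (Pi.single (B.dir i) 1 : Fin m → ℝ) +
        (-t) • (Pi.single (B.dir i) 1 : Fin m → ℝ) := by
      rw [neg_smul]; abel
    have h2 := mem_latticePoints_of_hyperplane hn hx (B.normal i) (B.level i)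
      (B.normal_out i hi) (t := -t) (by
        rw [← h1]; exact sum_normal_point_eq hw (by omega))
    rw [← h1] at h2
    refine latticePoints_mono (mul_dvd_mul_left _ ?_) (mul_ne_zero hn (hpos _)) h2
    exact Finset.dvd_prod_of_mem (fun r => (B.normal r (B.dir r)).natAbs)
      (Finset.mem_Ico.2 ⟨le_rfl, by omega⟩)
  | of_succ q hq ih =>
    have h1 : B.point q w = B.point (q + 1) w +
        (-B.edge q w) • (Pi.single (B.dir q) 1 : Fin m → ℝ) := by
      rw [B.point_succ, neg_smul]; abel
    have h2 := mem_latticePoints_of_hyperplane (mul_ne_zero hn (hpos _)) ih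
      (B.normal q) (B.level q) (B.normal_out q (by omega)) (t := -B.edge q w) (by
        rw [← h1]; exact sum_normal_point_eq hw (by omega))
    rw [← h1] at h2
    rwa [Finset.prod_eq_prod_Ico_succ_bot (by omega), mul_comm (_ : ℕ) (∏ _ ∈ _, _), ← mul_assoc]

/-- The number by which denominators may get multiplied along a broken line. -/
def IsDenominator (B : BrokenFamily m d) (D : ℕ) : Prop :=
  D ≠ 0 ∧ ∏ r ∈ Finset.range (B.k + 1), (B.normal (r + 1) (B.dir r)).natAbs ∣ D ∧
    ∏ r ∈ Finset.range (B.k + 1), (B.normal r (B.dir r)).natAbs ∣ D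

theorem point_mem_latticePoints {D : ℕ} (hD : B.IsDenominator D) (hn : n ≠ 0)
    (hw : w ∈ weightSet req) (hx : x ∈ latticePoints m n) (h : x ∈ B.trace w) {q : ℕ}
    (hq : q ≤ B.k + 1) : B.point q w ∈ latticePoints m (n * D) := by
  obtain ⟨i, hi, h⟩ := h
  rcases le_or_gt q i with hqi | hqi
  · refine latticePoints_mono (mul_dvd_mul_left _ (dvd_trans ?_ hD.2.2)) (mul_ne_zero hn hD.1)
      (point_mem_latticePoints_of_le hn hw hx hi h hqi)
    rw [Finset.range_eq_Ico]
    exact Finset.prod_dvd_prod_of_subset _ _ _ (Finset.Ico_subset_Ico (Nat.zero_le _) le_rfl)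
  · refine latticePoints_mono (mul_dvd_mul_left _ (dvd_trans ?_ hD.2.1)) (mul_ne_zero hn hD.1)
      (point_mem_latticePoints_of_lt hn hw hx h hqi hq)
    exact Finset.prod_dvd_prod_of_subset _ _ _ (Finset.range_mono hq)

/-- A piecewise intermediate value argument: rank grows at unit speed along every edge. -/
theorem exists_onEdge_rk_eq {ρ : ℝ} (h0 : rk (B.point 0 w) ≤ ρ) :
    ∀ i ≤ B.k, ρ ≤ rk (B.point (i + 1) w) → ∃ l ≤ i, ∃ x, B.OnEdge l w x ∧ rk x = ρ := by
  have key : ∀ i ≤ B.k, rk (B.point i w) ≤ ρ → ρ ≤ rk (B.point (i + 1) w) →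
      ∃ x, B.OnEdge i w x ∧ rk x = ρ := fun i hi h1 h2 => by
    rw [B.point_succ, rk_add_smul_single] at h2
    exact ⟨_, ⟨ρ - rk (B.point i w), by linarith, by linarith, rfl⟩, by
      rw [rk_add_smul_single]; ring⟩
  intro i
  induction i with
  | zero => exact fun hi h => ⟨0, le_rfl, key 0 hi h0 h⟩
  | succ i ih =>
    intro hi h
    rcases le_total ρ (rk (B.point (i + 1) w)) with h' | h'
    · obtain ⟨l, hl, hx⟩ := ih (by omega) h'
      exact ⟨l, by omega, hx⟩
    · exact ⟨i + 1, le_rfl, key _ hi h' h⟩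

/-- From a turning point in the lattice, a rank in (1/n)ℤ is reached on the following edge after a
step in (1/n)ℤ, hence at a lattice point. -/
theorem exists_mem_trace_rk_eq
    (hl : ∀ q ≤ B.k + 1, B.point q w ∈ latticePoints m n) {z : ℤ}
    (h0 : rk (B.point 0 w) ≤ z / n) (h1 : (z / n : ℝ) ≤ rk (B.point (B.k + 1) w)) :
    ∃ x, x ∈ B.trace w ∧ x ∈ latticePoints m n ∧ rk x = z / n := by
  obtain ⟨l, hlk, x, ⟨t, ht0, ht1, rfl⟩, hx⟩ := exists_onEdge_rk_eq h0 B.k le_rfl h1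
  refine ⟨_, ⟨l, hlk, t, ht0, ht1, rfl⟩, ?_, hx⟩
  obtain ⟨z', hz'⟩ := exists_rk_eq_of_mem_latticePoints (hl l (by omega))
  refine add_smul_single_mem_latticePoints (hl l (by omega)) (z := z - z') ?_ _
  rw [rk_add_smul_single, hz'] at hx
  push_cast
  rw [sub_div]; linarith

theorem le_total_of_mem_trace (hw : w ∈ weightSet req) {y : Fin m → ℝ} (hx : x ∈ B.trace w)
    (hy : y ∈ B.trace w) : x ≤ y ∨ y ≤ x := by
  obtain ⟨i, hi, hx⟩ := hx
  obtain ⟨j, hj, hy⟩ := hy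
  rcases lt_trichotomy i j with h | rfl | h
  · exact Or.inl (hx.le_point_succ.trans ((point_mono h (by omega) hw).trans hy.point_le))
  · obtain ⟨t, -, -, rfl⟩ := hx
    obtain ⟨t', -, -, rfl⟩ := hy
    have hs : (0 : Fin m → ℝ) ≤ Pi.single (B.dir i) 1 := by simp [Pi.single_nonneg]
    rcases le_total t t' with h | h
    · left; gcongr
    · right; gcongr
  · exact Or.inr (hy.le_point_succ.trans ((point_mono h (by omega) hw).trans hx.point_le))

/-- A line is totally ordered and rank is strictly monotone, so along it order is comparison of
ranks. -/
theorem le_of_mem_trace_of_rk_le (hw : w ∈ weightSet req) {y : Fin m → ℝ} (hx : x ∈ B.trace w)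
    (hy : y ∈ B.trace w) (h : rk x ≤ rk y) : x ≤ y := by
  rcases le_total_of_mem_trace hw hx hy with h' | h'
  · exact h'
  · exact (eq_of_le_of_rk_eq h' (le_antisymm (rk_mono h') h)).ge

theorem point_zero_le (hw : w ∈ weightSet req) (hx : x ∈ B.trace w) : B.point 0 w ≤ x := by
  obtain ⟨i, hi, hx⟩ := hx
  exact (point_mono (Nat.zero_le i) (by omega) hw).trans hx.point_le

theorem le_point_last (hw : w ∈ weightSet req) (hx : x ∈ B.trace w) :
    x ≤ B.point (B.k + 1) w := by
  obtain ⟨i, hi, hx⟩ := hx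
  exact hx.le_point_succ.trans (point_mono (by omega) le_rfl hw)

/-- The lattice points of a broken line, with `s` of them omitted at each end, form a symmetric
chain. -/
theorem isSymmetricChain_of_trace (hw : w ∈ weightSet req) (hn : n ≠ 0)
    (hl : ∀ q ≤ B.k + 1, B.point q w ∈ latticePoints m n) {Q : Set (Fin m → ℝ)}
    (hQ : B.trace w ∩ latticePoints m n ⊆ Q)
    (hr : rk (B.point 0 w) + rk (B.point (B.k + 1) w) = totalRank Q) (s : ℕ)
    {C : Set (Fin m → ℝ)} (hne : C.Nonempty)
    (hC : ∀ x, x ∈ C ↔ x ∈ B.trace w ∧ x ∈ latticePoints m n ∧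
      rk (B.point 0 w) + s / n ≤ rk x ∧ rk x + s / n ≤ rk (B.point (B.k + 1) w)) :
    IsSymmetricChain n Q C := by
  obtain ⟨z0, hz0⟩ := exists_rk_eq_of_mem_latticePoints (hl 0 (by omega))
  obtain ⟨z1, hz1⟩ := exists_rk_eq_of_mem_latticePoints (hl (B.k + 1) le_rfl)
  have hn' : (0 : ℝ) < n := by positivity
  rw [hz0, hz1] at hC
  have hC' : ∀ x, x ∈ C ↔ x ∈ B.trace w ∧ x ∈ latticePoints m n ∧ ∃ z : ℤ, rk x = z / n ∧
      z0 + s ≤ z ∧ z + s ≤ z1 := by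
    intro x
    rw [hC]
    refine and_congr_right fun _ => and_congr_right fun hx => ?_
    obtain ⟨z, hz⟩ := exists_rk_eq_of_mem_latticePoints hx
    have e1 : (z0 / n + s / n : ℝ) ≤ z / n ↔ z0 + s ≤ z := by
      rw [← add_div, div_le_div_iff_of_pos_right hn']; exact_mod_cast Iff.rfl
    have e2 : (z / n + s / n : ℝ) ≤ z1 / n ↔ z + s ≤ z1 := by
      rw [← add_div, div_le_div_iff_of_pos_right hn']; exact_mod_cast Iff.rfl
    rw [hz, e1, e2]
    constructor
    · exact fun h => ⟨z, rfl, h⟩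
    · rintro ⟨z', h, h'⟩
      have : z = z' := by exact_mod_cast (div_left_inj' hn'.ne').1 h
      rwa [this]
  obtain ⟨y, hy⟩ := hne
  obtain ⟨-, -, zy, -, hy1, hy2⟩ := (hC' y).1 hy
  -- Nonemptiness guarantees that removing s ranks at each end leaves at least one; r + 1 is the
  -- number of ranks left.
  obtain ⟨r, hr'⟩ : ∃ r : ℕ, z1 = z0 + 2 * s + r := ⟨(z1 - z0 - 2 * s).toNat, by omega⟩
  have hex : ∀ i : Fin (r + 1), ∃ x, x ∈ B.trace w ∧ x ∈ latticePoints m n ∧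
      rk x = ((z0 + s + (i : ℕ) : ℤ) : ℝ) / n := by
    intro i
    have hi := i.2
    apply exists_mem_trace_rk_eq hl
    · rw [hz0]; gcongr; omega
    · rw [hz1]; gcongr; omega
  choose c hc1 hc2 hc3 using hex
  refine ⟨r, c, ?_, fun i => hQ ⟨hc1 i, hc2 i⟩, fun i => ?_, ?_⟩
  · ext x
    rw [hC']
    constructor
    · rintro ⟨h1, h2, z, h3, h4, h5⟩
      refine ⟨⟨(z - z0 - s).toNat, by omega⟩, ?_⟩
      have h6 : rk (c ⟨(z - z0 - s).toNat, by omega⟩) = rk x := by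
        rw [hc3, h3]; congr 2; simp only; omega
      exact le_antisymm (le_of_mem_trace_of_rk_le hw (hc1 _) h1 h6.le)
        (le_of_mem_trace_of_rk_le hw h1 (hc1 _) h6.ge)
    · rintro ⟨i, rfl⟩
      have hi := i.2
      exact ⟨hc1 i, hc2 i, _, hc3 i, by omega, by omega⟩
  · have h1 : rk (c i.succ) = rk (c i.castSucc) + 1 / n := by
      rw [hc3, hc3, ← add_div]; congr 1; simp; ring
    refine ⟨le_of_mem_trace_of_rk_le hw (hc1 _) (hc1 _) ?_, h1⟩
    rw [h1]
    have : (0 : ℝ) ≤ 1 / n := by positivity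
    linarith
  · rw [← hr, hc3, hc3, hz0, hz1, hr', ← add_div, ← add_div]
    congr 1
    simp
    ring

end BrokenFamily

/-! ### From chain systems to symmetric chains. -/

namespace BrokenFamily

variable {m d : ℕ} {B : BrokenFamily m d} {req : Finset (Fin (d + 1))}

theorem rk_point (i : ℕ) (w : Fin (d + 1) → ℝ) :
    rk (B.point i w) = ∑ j, w j * rk (B.vertex i j) := by
  simp only [rk, point, Finset.sum_apply, Pi.smul_apply, smul_eq_mul, Finset.mul_sum]
  exact Finset.sum_comm

end BrokenFamily

namespace ChainSystem

variable {m d N n : ℕ} {P : Set (Fin m → ℝ)} (S : ChainSystem P d N) {a : Fin N}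
  {w : Fin (d + 1) → ℝ}

theorem chain_subset_trace : S.chain a w ⊆ (S.family a).trace w := by
  by_cases h : S.fake a
  · rw [S.chain_fake a h]; exact fun x hx => hx.1
  · rw [S.chain_real a h]

/-- The rank of a turning point is linear in the weight, so symmetry at the vertices passes to every
line. -/
theorem rk_endpoints (hw : w ∈ weightSet (S.req a)) :
    rk ((S.family a).point 0 w) + rk ((S.family a).point ((S.family a).k + 1) w) =
      totalRank P := by
  rw [BrokenFamily.rk_point, BrokenFamily.rk_point, ← Finset.sum_add_distrib]
  simp only [← mul_add, S.symmetric, ← Finset.sum_mul, hw.2.1, one_mul]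

theorem isSymmetricChain (hn : n ≠ 0) (hw : w ∈ weightSet (S.req a))
    (hP : (S.family a).trace w ⊆ P) (hr : totalRank (P ∩ latticePoints m n) = totalRank P)
    (hl : ∀ q ≤ (S.family a).k + 1, (S.family a).point q w ∈ latticePoints m n)
    (hne : (S.chain a w ∩ latticePoints m n).Nonempty) :
    IsSymmetricChain n (P ∩ latticePoints m n) (S.chain a w ∩ latticePoints m n) := by
  have hn' : (0 : ℝ) < n := by positivity
  have h1 : (S.family a).trace w ∩ latticePoints m n ⊆ P ∩ latticePoints m n :=
    Set.inter_subset_inter_left _ hP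
  have h2 := (S.rk_endpoints hw).trans hr.symm
  by_cases h : S.fake a
  -- The endpoints are lattice points and lattice ranks are spaced by 1/n, so omitting the endpoints
  -- means omitting one rank at each end.
  · refine BrokenFamily.isSymmetricChain_of_trace hw hn hl h1 h2 1 hne fun x => ?_
    rw [S.chain_fake a h]
    have step : ∀ y ∈ latticePoints m n, ∀ z ∈ latticePoints m n, y ≤ z → y ≠ z →
        rk y + (1 : ℕ) / n ≤ rk z := by
      intro y hy z hz hyz hne
      have hlt : rk y < rk z :=
        lt_of_le_of_ne (rk_mono hyz) fun h => hne (eq_of_le_of_rk_eq hyz h)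
      obtain ⟨p, hp⟩ := exists_rk_eq_of_mem_latticePoints hy
      obtain ⟨q, hq⟩ := exists_rk_eq_of_mem_latticePoints hz
      rw [hp, hq, div_lt_div_iff_of_pos_right hn'] at hlt
      rw [hp, hq, ← add_div, div_le_div_iff_of_pos_right hn']
      have : p < q := by exact_mod_cast hlt
      exact_mod_cast (by omega : p + 1 ≤ q)
    have h1n : (0 : ℝ) < (1 : ℕ) / n := by positivity
    constructor
    · rintro ⟨⟨hx, hx0, hx1⟩, hxl⟩
      exact ⟨hx, hxl, step _ (hl 0 (by omega)) _ hxl (BrokenFamily.point_zero_le hw hx) hx0.symm,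
        step _ hxl _ (hl _ le_rfl) (BrokenFamily.le_point_last hw hx) hx1⟩
    · rintro ⟨hx, hxl, h3, h4⟩
      refine ⟨⟨hx, ?_, ?_⟩, hxl⟩
      · rintro rfl; linarith
      · rintro rfl; linarith
  · refine BrokenFamily.isSymmetricChain_of_trace hw hn hl h1 h2 0 hne fun x => ?_
    rw [S.chain_real a h]
    constructor
    · rintro ⟨hx, hxl⟩
      refine ⟨hx, hxl, ?_, ?_⟩
      · simpa using rk_mono (BrokenFamily.point_zero_le hw hx)
      · simpa using rk_mono (BrokenFamily.le_point_last hw hx)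
    · rintro ⟨hx, hxl, -, -⟩
      exact ⟨hx, hxl⟩

/-- The nonempty sets of points of denominator `n` on the chains of a system whose turning points
have denominator `n`. -/
def latticeChains (n : ℕ) : Set (Set (Fin m → ℝ)) :=
  {C | C.Nonempty ∧ ∃ a, ∃ w ∈ weightSet (S.req a),
    (∀ q ≤ (S.family a).k + 1, (S.family a).point q w ∈ latticePoints m n) ∧
    C = S.chain a w ∩ latticePoints m n}

theorem pairwiseDisjoint_latticeChains : (S.latticeChains n).PairwiseDisjoint id := by
  rintro _ ⟨-, a, w, hw, -, rfl⟩ _ ⟨-, a', w', hw', -, rfl⟩ hne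
  rw [Function.onFun, Set.disjoint_left]
  rintro x ⟨hx, -⟩ ⟨hx', -⟩
  obtain ⟨rfl, rfl⟩ := S.unique a w hw a' w' hw' x hx hx'
  exact hne rfl

/-- The line through a point of denominator `n` has all its turning points of denominator `n * D`,
so it is among the chosen lines. -/
theorem subset_sUnion_latticeChains {D : ℕ} (hD : ∀ a, (S.family a).IsDenominator D)
    (hn : n ≠ 0) : P ∩ latticePoints m n ⊆ ⋃₀ S.latticeChains (n * D) := by
  rintro x ⟨hx, hxl⟩
  obtain ⟨a, w, hw, h⟩ := (S.mem_iff x).1 hx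
  have hxl' := latticePoints_mono (Dvd.intro D rfl) (mul_ne_zero hn (hD a).1) hxl
  exact ⟨S.chain a w ∩ latticePoints m (n * D), ⟨⟨x, h, hxl'⟩, a, w, hw,
    fun q hq => BrokenFamily.point_mem_latticePoints (hD a) hn hw
    hxl (S.chain_subset_trace h) hq, rfl⟩, h, hxl'⟩

theorem isSymmetricChain_of_mem_latticeChains (hn : n ≠ 0)
    (hP : ∀ a, ∀ w ∈ weightSet (S.req a), (S.family a).trace w ⊆ P)
    (hr : totalRank (P ∩ latticePoints m n) = totalRank P) {C : Set (Fin m → ℝ)}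
    (hC : C ∈ S.latticeChains n) : IsSymmetricChain n (P ∩ latticePoints m n) C := by
  obtain ⟨hne, a, w, hw, hl, rfl⟩ := hC
  exact S.isSymmetricChain hn hw (hP a w hw) hr hl hne

/-- When denominators do not grow, a line that meets the lattice at all turns only at lattice
points. -/
theorem restrictedChains_eq (hD : ∀ a, (S.family a).IsDenominator 1) (hn : n ≠ 0) :
    S.toGeometricSCD.restrictedChains n = S.latticeChains n := by
  ext C
  constructor
  · rintro ⟨hne, C, hC, rfl⟩
    obtain ⟨x, hx⟩ := hne
    rw [GeometricSCD.chains, Set.mem_iUnion] at hC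
    obtain ⟨a, ha⟩ := hC
    obtain ⟨w, hw, rfl⟩ := (S.mem_chains_snake ⟨x, hx.1⟩).1 ha
    refine ⟨⟨x, hx⟩, a, w, hw, fun q hq => ?_, rfl⟩
    have := BrokenFamily.point_mem_latticePoints (hD a) hn hw hx.2 (S.chain_subset_trace hx.1) hq
    rwa [mul_one] at this
  · rintro ⟨hne, a, w, hw, -, rfl⟩
    refine ⟨hne, S.chain a w, ?_, rfl⟩
    rw [GeometricSCD.chains, Set.mem_iUnion]
    exact ⟨a, (S.mem_chains_snake (hne.mono Set.inter_subset_left)).2 ⟨w, hw, rfl⟩⟩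

theorem isSymmetricChainDecomposition (hD : ∀ a, (S.family a).IsDenominator 1) (hn : n ≠ 0)
    (hP : ∀ a, ∀ w ∈ weightSet (S.req a), (S.family a).trace w ⊆ P)
    (hr : totalRank (P ∩ latticePoints m n) = totalRank P) :
    IsSymmetricChainDecomposition n (P ∩ latticePoints m n)
      (S.toGeometricSCD.restrictedChains n) := by
  rw [S.restrictedChains_eq hD hn]
  refine ⟨fun C hC => S.isSymmetricChain_of_mem_latticeChains hn hP hr hC,
    S.pairwiseDisjoint_latticeChains, Set.Subset.antisymm ?_ ?_⟩
  · rintro x ⟨_, ⟨-, a, w, hw, -, rfl⟩, hx, hxl⟩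
    exact ⟨(S.mem_iff x).2 ⟨a, w, hw, hx⟩, hxl⟩
  · simpa using S.subset_sUnion_latticeChains hD hn

/-- A product of absolute values dividing 1 has all factors 1, so each relevant coefficient is ±1.
-/
theorem strongHyperplaneCondition (hD : ∀ a, (S.family a).IsDenominator 1) :
    S.toGeometricSCD.StrongHyperplaneCondition := by
  have hout : ∀ a, ∀ i ≤ (S.family a).k,
      ((S.family a).normal i ((S.family a).dir i)).natAbs = 1 := fun a i hi => by
    have := (Finset.dvd_prod_of_mem (fun r =>
      ((S.family a).normal r ((S.family a).dir r)).natAbs) (Finset.mem_range.2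
        (Nat.lt_succ_of_le hi))).trans (hD a).2.2
    exact Nat.dvd_one.1 this
  have hin : ∀ a, ∀ i ≤ (S.family a).k,
      ((S.family a).normal (i + 1) ((S.family a).dir i)).natAbs = 1 := fun a i hi => by
    have := (Finset.dvd_prod_of_mem (fun r =>
      ((S.family a).normal (r + 1) ((S.family a).dir r)).natAbs) (Finset.mem_range.2
        (Nat.lt_succ_of_le hi))).trans (hD a).2.1
    exact Nat.dvd_one.1 this
  have key : ∀ a (i : Fin ((S.family a).k + 1)),
      GeometricSCD.StrongHyperplane ((S.family a).dir i)
        (((S.family a).toSequence (S.req a)).swipe i).start.carrier ∧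
      GeometricSCD.StrongHyperplane ((S.family a).dir i)
        (((S.family a).toSequence (S.req a)).swipe i).finish.carrier := by
    intro a i
    have hi : (i : ℕ) ≤ (S.family a).k := Nat.lt_succ_iff.1 i.2
    refine ⟨⟨(S.family a).normal i, (S.family a).level i, Int.natAbs_eq_iff.1 (hout a i hi), ?_⟩,
      ⟨(S.family a).normal (i + 1), (S.family a).level (i + 1),
        Int.natAbs_eq_iff.1 (hin a i hi), ?_⟩⟩
    · intro x hx
      obtain ⟨w, hw, rfl⟩ := BrokenFamily.mem_start_swipe.1 hx
      simpa using BrokenFamily.sum_normal_point_eq hw (Nat.le_succ_of_le hi)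
    · intro x hx
      obtain ⟨w, hw, rfl⟩ := BrokenFamily.mem_finish_swipe.1 hx
      simpa using BrokenFamily.sum_normal_point_eq hw (Nat.succ_le_succ hi)
  intro a
  -- The index type of the swipes depends on the sequence, so the equality with `toSequence` is
  -- substituted for a general sequence.
  have aux : ∀ Q : SwipeSequence m, Q = (S.family a).toSequence (S.req a) →
      ∀ i : Fin (Q.k + 1),
      GeometricSCD.StrongHyperplane (Q.swipe i).dir (Q.swipe i).start.carrier ∧
      GeometricSCD.StrongHyperplane (Q.swipe i).dir (Q.swipe i).finish.carrier := by
    rintro _ rfl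
    exact key a
  exact aux _ (S.seq_snake a)

end ChainSystem

/-! ### Convexity and rank of the Young polytopes. -/

theorem convex_youngPolytope (m : ℕ) : Convex ℝ (youngPolytope m) := by
  rintro x ⟨hx, hx'⟩ y ⟨hy, hy'⟩ a b ha hb hab
  refine ⟨fun i j hij => ?_, fun i => ⟨?_, ?_⟩⟩
  · have := hx hij; have := hy hij
    simp only [Pi.add_apply, Pi.smul_apply, smul_eq_mul]; gcongr
  · have := (hx' i).1; have := (hy' i).1
    simp only [Pi.add_apply, Pi.smul_apply, smul_eq_mul]; positivity
  · have h1 := mul_le_mul_of_nonneg_left (hx' i).2 ha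
    have h2 := mul_le_mul_of_nonneg_left (hy' i).2 hb
    simp only [Pi.add_apply, Pi.smul_apply, smul_eq_mul]; linarith

theorem totalRank_of_subset {m : ℕ} {A : Set (Fin m → ℝ)} (hA : A ⊆ youngPolytope m)
    (h0 : 0 ∈ A) (h1 : 1 ∈ A) : totalRank A = m := by
  have e0 : IsLeast (rk '' A) 0 := by
    refine ⟨⟨0, h0, by simp [rk]⟩, ?_⟩
    rintro _ ⟨x, hx, rfl⟩
    exact Finset.sum_nonneg fun i _ => ((hA hx).2 i).1
  have e1 : IsGreatest (rk '' A) m := by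
    refine ⟨⟨1, h1, by simp [rk]⟩, ?_⟩
    rintro _ ⟨x, hx, rfl⟩
    calc rk x ≤ ∑ i : Fin m, (1 : ℝ) := Finset.sum_le_sum fun i _ => ((hA hx).2 i).2
      _ = m := by simp
  rw [totalRank, e0.csInf_eq, e1.csSup_eq, zero_add]

theorem zero_mem_youngPolytope (m : ℕ) : 0 ∈ youngPolytope m :=
  ⟨fun _ _ _ => le_rfl, fun _ => ⟨le_rfl, zero_le_one⟩⟩

theorem one_mem_youngPolytope (m : ℕ) : 1 ∈ youngPolytope m :=
  ⟨fun _ _ _ => le_rfl, fun _ => ⟨zero_le_one, le_rfl⟩⟩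

theorem totalRank_youngPolytope (m : ℕ) : totalRank (youngPolytope m) = m :=
  totalRank_of_subset subset_rfl (zero_mem_youngPolytope m) (one_mem_youngPolytope m)

/-- Minimum and maximum rank are attained at the points 0 and 1, which have denominator n for every
n. -/
theorem totalRank_youngPoset (m : ℕ) {n : ℕ} (hn : n ≠ 0) :
    totalRank (youngPolytope m ∩ latticePoints m n) = totalRank (youngPolytope m) := by
  rw [totalRank_youngPolytope]
  have hn' : (n : ℝ) ≠ 0 := by exact_mod_cast hn
  exact totalRank_of_subset Set.inter_subset_left
    ⟨zero_mem_youngPolytope m, fun _ => ⟨0, by simp⟩⟩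
    ⟨one_mem_youngPolytope m, fun _ => ⟨n, by simp [hn']⟩⟩

/-! ### Rational families, whose defining conditions are checked by evaluation. -/

namespace BrokenFamily

variable {m d : ℕ} {B : BrokenFamily m d}

theorem point_apply (i : ℕ) (w : Fin (d + 1) → ℝ) (c : Fin m) : B.point i w c =
    ∑ j, w j * B.base j c + ∑ l ∈ Finset.range i, if c = B.dir l then B.edge l w else 0 := by
  induction i with
  | zero => simp [point, turningVertex]
  | succ i ih =>
    rw [B.point_succ, Finset.sum_range_succ, Pi.add_apply, ih, add_assoc]
    simp [Pi.single_apply]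

/-- Since rank is strictly monotone along a line, avoiding the endpoints becomes two strict linear
inequalities, suited to linear arithmetic. -/
theorem mem_openTrace_iff {req : Finset (Fin (d + 1))} {w : Fin (d + 1) → ℝ} {x : Fin m → ℝ}
    (hw : w ∈ weightSet req) : x ∈ B.openTrace w ↔ x ∈ B.trace w ∧ rk (B.point 0 w) < rk x ∧
      rk x < rk (B.point (B.k + 1) w) := by
  refine and_congr_right fun hx => and_congr ?_ ?_
  · exact ⟨fun h => lt_of_le_of_ne (rk_mono (point_zero_le hw hx)) fun h' =>
      h (eq_of_le_of_rk_eq (point_zero_le hw hx) h').symm, fun h h' => h.ne (by rw [h'])⟩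
  · exact ⟨fun h => lt_of_le_of_ne (rk_mono (le_point_last hw hx)) fun h' =>
      h (eq_of_le_of_rk_eq (le_point_last hw hx) h'), fun h h' => h.ne (by rw [h'])⟩

end BrokenFamily

/-- The data of an affine family of broken lines with rational turning points. -/
structure RationalFamily (m d : ℕ) where
  k : ℕ
  base : Fin (d + 1) → Fin m → ℚ
  dir : ℕ → Fin m
  len : ℕ → Fin (d + 1) → ℚ
  normal : ℕ → Fin m → ℤ
  level : ℕ → ℤ

namespace RationalFamily

variable {m d : ℕ} (F : RationalFamily m d)

/-- The vertices of the turning simplices. -/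
def vertex (i : ℕ) (j : Fin (d + 1)) (c : Fin m) : ℚ :=
  F.base j c + ∑ l ∈ Finset.range i, if c = F.dir l then F.len l j else 0

/-- The conditions under which rational data give a family of broken lines in `L(m)` whose endpoints
have complementary ranks. -/
structure IsValid : Prop where
  len_nonneg : ∀ i < F.k + 1, ∀ j, 0 ≤ F.len i j
  on_hyperplane : ∀ i < F.k + 2, ∀ j, ∑ c, (F.normal i c : ℚ) * F.vertex i j c = F.level i
  normal_out : ∀ i < F.k + 1, F.normal i (F.dir i) ≠ 0
  normal_in : ∀ i < F.k + 1, F.normal (i + 1) (F.dir i) ≠ 0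
  vertex_mono : ∀ i < F.k + 2, ∀ j, ∀ c c', c ≤ c' → F.vertex i j c ≤ F.vertex i j c'
  vertex_bound : ∀ i < F.k + 2, ∀ j c, 0 ≤ F.vertex i j c ∧ F.vertex i j c ≤ 1
  symmetric : ∀ j, ∑ c, F.vertex 0 j c + ∑ c, F.vertex (F.k + 1) j c = m

variable {F}

theorem turningVertex_eq (i : ℕ) (j : Fin (d + 1)) (c : Fin m) :
    turningVertex (fun j c => (F.base j c : ℝ)) F.dir (fun l j => (F.len l j : ℝ)) i j c =
      (F.vertex i j c : ℝ) := by
  induction i with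
  | zero => simp [turningVertex, vertex]
  | succ i ih =>
    change turningVertex _ _ _ i j c + _ = _
    rw [ih, vertex, vertex, Finset.sum_range_succ]
    push_cast
    simp only [Pi.smul_apply, Pi.single_apply, smul_eq_mul, mul_ite, mul_one, mul_zero, add_assoc]
    split <;> simp

/-- The affine family of broken lines with given rational turning points. -/
noncomputable def toBrokenFamily (F : RationalFamily m d) (h : F.IsValid)
    (hi : AffineIndependent ℝ fun j c => (F.base j c : ℝ)) : BrokenFamily m d where
  k := F.k
  base := fun j c => F.base j c
  dir := F.dir
  len := fun l j => F.len l j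
  normal := F.normal
  level := F.level
  base_indep := hi
  len_nonneg i hi j := by exact_mod_cast h.len_nonneg i (by omega) j
  on_hyperplane i hi j := by
    simp only [turningVertex_eq]
    exact_mod_cast h.on_hyperplane i (by omega) j
  normal_out i hi := h.normal_out i (by omega)
  normal_in i hi := h.normal_in i (by omega)

variable {h : F.IsValid} {hi : AffineIndependent ℝ fun j c => (F.base j c : ℝ)}

theorem vertex_mem_youngPolytope {i : ℕ} (hik : i ≤ (F.toBrokenFamily h hi).k + 1)
    (j : Fin (d + 1)) : (F.toBrokenFamily h hi).vertex i j ∈ youngPolytope m := by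
  have hv : ∀ c, (F.toBrokenFamily h hi).vertex i j c = F.vertex i j c :=
    fun c => turningVertex_eq i j c
  have hik : i < F.k + 2 := Nat.lt_succ_of_le hik
  refine ⟨fun c c' hc => ?_, fun c => ?_⟩
  · rw [hv, hv]; exact_mod_cast h.vertex_mono i hik j c c' hc
  · rw [hv]; exact_mod_cast h.vertex_bound i hik j c

theorem rk_vertex_add_rk_vertex (j : Fin (d + 1)) : rk ((F.toBrokenFamily h hi).vertex 0 j) +
    rk ((F.toBrokenFamily h hi).vertex ((F.toBrokenFamily h hi).k + 1) j) =
      totalRank (youngPolytope m) := by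
  rw [totalRank_youngPolytope]
  have hv : ∀ i c, (F.toBrokenFamily h hi).vertex i j c = F.vertex i j c :=
    fun i c => turningVertex_eq i j c
  simp only [rk, hv]
  exact_mod_cast h.symmetric j

theorem onEdge_iff {i : ℕ} {w : Fin (d + 1) → ℝ} {x : Fin m → ℝ} :
    (F.toBrokenFamily h hi).OnEdge i w x ↔ ∃ t, 0 ≤ t ∧ t ≤ ∑ j, w j * (F.len i j : ℝ) ∧
      ∀ c, x c = ∑ j, w j * (F.vertex i j c : ℝ) + if c = F.dir i then t else 0 := by
  refine exists_congr fun t => and_congr_right fun _ => and_congr Iff.rfl ?_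
  rw [funext_iff]
  refine forall_congr' fun c => ?_
  have hv : ∀ j, (F.toBrokenFamily h hi).vertex i j c = F.vertex i j c :=
    fun j => turningVertex_eq i j c
  simp only [Pi.add_apply, Pi.single_apply, BrokenFamily.point, Finset.sum_apply, Pi.smul_apply,
    smul_eq_mul, hv, mul_ite, mul_one, mul_zero]
  exact Iff.rfl

/-- The trace of a line, in coordinates. -/
theorem mem_trace_iff {w : Fin (d + 1) → ℝ} {x : Fin m → ℝ} :
    x ∈ (F.toBrokenFamily h hi).trace w ↔ ∃ i ≤ F.k, ∃ t, 0 ≤ t ∧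
      t ≤ ∑ j, w j * (F.len i j : ℝ) ∧
      ∀ c, x c = ∑ j, w j * (F.vertex i j c : ℝ) + if c = F.dir i then t else 0 :=
  exists_congr fun _ => and_congr Iff.rfl onEdge_iff

theorem rk_point_last {w : Fin (d + 1) → ℝ} (hw : ∑ j, w j = 1) :
    rk ((F.toBrokenFamily h hi).point ((F.toBrokenFamily h hi).k + 1) w) =
      m - rk ((F.toBrokenFamily h hi).point 0 w) := by
  rw [eq_sub_iff_add_eq', BrokenFamily.rk_point, BrokenFamily.rk_point,
    ← Finset.sum_add_distrib]
  simp only [← mul_add, rk_vertex_add_rk_vertex, ← Finset.sum_mul, hw, one_mul,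
    totalRank_youngPolytope]

theorem mem_openTrace_iff {req : Finset (Fin (d + 1))} {w : Fin (d + 1) → ℝ} {x : Fin m → ℝ}
    (hw : w ∈ weightSet req) : x ∈ (F.toBrokenFamily h hi).openTrace w ↔
      x ∈ (F.toBrokenFamily h hi).trace w ∧
      ∑ c, ∑ j, w j * (F.base j c : ℝ) < ∑ c, x c ∧
      ∑ c, x c < m - ∑ c, ∑ j, w j * (F.base j c : ℝ) := by
  rw [BrokenFamily.mem_openTrace_iff hw, rk_point_last hw.2.1]
  simp only [rk, BrokenFamily.point_apply, Finset.range_zero, Finset.sum_empty, add_zero]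
  exact Iff.rfl

/-- By convexity it is enough that all turning vertices lie in the polytope. -/
theorem trace_subset_youngPolytope {req : Finset (Fin (d + 1))} {w : Fin (d + 1) → ℝ}
    (hw : w ∈ weightSet req) : (F.toBrokenFamily h hi).trace w ⊆ youngPolytope m := by
  rintro x ⟨i, hik, hx⟩
  rw [← BrokenFamily.mem_segment_iff_onEdge
    ((F.toBrokenFamily h hi).edge_nonneg hik hw.1)] at hx
  have key : ∀ l ≤ (F.toBrokenFamily h hi).k + 1,
      (F.toBrokenFamily h hi).point l w ∈ youngPolytope m := fun l hl =>
    (convex_youngPolytope m).sum_mem (fun j _ => hw.1 j) hw.2.1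
      fun j _ => vertex_mem_youngPolytope hl j
  exact (convex_youngPolytope m).segment_subset (key i (by omega)) (key _ (by omega)) hx

end RationalFamily

/-- Splits off the common part of two gaps, i.e. the multiple of a fixed point, and leaves a residue
with a vanishing gap. -/
theorem exists_eq_add_min {y z : ℝ} (hy : 0 ≤ y) (hz : 0 ≤ z) :
    ∃ v y' z', 0 ≤ v ∧ 0 ≤ y' ∧ 0 ≤ z' ∧ y = v + y' ∧ z = v + z' ∧ (y' = 0 ∨ z' = 0) := by
  rcases le_total y z with h | h
  exacts [⟨y, 0, z - y, hy, le_rfl, by linarith, by ring, by ring, Or.inl rfl⟩,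
    ⟨z, y - z, 0, hz, by linarith, le_rfl, by ring, by ring, Or.inr rfl⟩]

/-- A chain system consisting of a single real family. -/
def ChainSystem.ofSingle {m d : ℕ} {P : Set (Fin m → ℝ)} (R : BrokenFamily m d)
    (hRR : ∀ w ∈ weightSet (∅ : Finset (Fin (d + 1))), ∀ w' ∈ weightSet ∅, ∀ x ∈ R.trace w,
      x ∈ R.trace w' → w = w')
    (hP : ∀ x, x ∈ P ↔ ∃ w ∈ weightSet ∅, x ∈ R.trace w)
    (hs : ∀ j, rk (R.vertex 0 j) + rk (R.vertex (R.k + 1) j) = totalRank P) :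
    ChainSystem P d 1 where
  family _ := R
  fake _ := False
  req _ := ∅
  req_real _ _ := rfl
  chain _ := R.trace
  chain_real _ _ := rfl
  chain_fake _ h := h.elim
  unique a w hw b w' hw' x hx hx' := ⟨Subsingleton.elim a b, hRR w hw w' hw' x hx hx'⟩
  mem_iff x := by simpa using hP x
  symmetric _ := hs

/-- A chain system consisting of a real and a fake family. -/
def ChainSystem.ofPair {m d : ℕ} {P : Set (Fin m → ℝ)} (R F : BrokenFamily m d)
    (req : Finset (Fin (d + 1)))
    (hRR : ∀ w ∈ weightSet (∅ : Finset (Fin (d + 1))), ∀ w' ∈ weightSet ∅, ∀ x ∈ R.trace w,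
      x ∈ R.trace w' → w = w')
    (hFF : ∀ w ∈ weightSet req, ∀ w' ∈ weightSet req, ∀ x ∈ F.openTrace w,
      x ∈ F.openTrace w' → w = w')
    (hRF : ∀ w ∈ weightSet ∅, ∀ w' ∈ weightSet req, ∀ x ∈ R.trace w, x ∉ F.openTrace w')
    (hP : ∀ x, x ∈ P ↔ (∃ w ∈ weightSet ∅, x ∈ R.trace w) ∨
      ∃ w ∈ weightSet req, x ∈ F.openTrace w)
    (hsR : ∀ j, rk (R.vertex 0 j) + rk (R.vertex (R.k + 1) j) = totalRank P)
    (hsF : ∀ j, rk (F.vertex 0 j) + rk (F.vertex (F.k + 1) j) = totalRank P) :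
    ChainSystem P d 2 where
  family := ![R, F]
  fake a := a = 1
  req := ![∅, req]
  req_real a ha := by fin_cases a <;> simp at ha ⊢
  chain := ![R.trace, F.openTrace]
  chain_real a ha := by fin_cases a <;> simp at ha ⊢
  chain_fake a ha := by subst ha; rfl
  unique a w hw b w' hw' x hx hx' := by
    fin_cases a <;> fin_cases b
    · exact ⟨rfl, hRR w hw w' hw' x hx hx'⟩
    · exact (hRF w hw w' hw' x hx hx').elim
    · exact (hRF w' hw' w hw x hx' hx).elim
    · exact ⟨rfl, hFF w hw w' hw' x hx hx'⟩
  mem_iff x := by simpa using hP x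
  symmetric a := by
    fin_cases a
    · exact hsR
    · exact hsF

open BrokenFamily

/-! ### The decompositions of `L(1)` and `L(2)` -/

/-- The snake of `L(1)`. -/
def linearReal : RationalFamily 1 0 where
  k := 0
  base := ![![0]]
  dir := fun _ => 0
  len := fun _ => ![1]
  normal := fun _ => ![1]
  level := fun | 0 => 0 | _ => 1

theorem linearReal_isValid : linearReal.IsValid := by constructor <;> decide +kernel

theorem linearReal_indep : AffineIndependent ℝ fun j c => (linearReal.base j c : ℝ) :=
  have : Subsingleton (Fin (0 + 1)) := inferInstanceAs (Subsingleton (Fin 1))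
  affineIndependent_of_subsingleton ℝ _

/-- The broken line of `L(1)`. -/
noncomputable abbrev linearLines : BrokenFamily 1 0 :=
  linearReal.toBrokenFamily linearReal_isValid linearReal_indep

theorem linearLines_isDenominator : linearLines.IsDenominator 1 := by
  refine ⟨one_ne_zero, ?_⟩
  change (∏ r ∈ Finset.range 1, (linearReal.normal (r + 1) (linearReal.dir r)).natAbs ∣ 1) ∧
    (∏ r ∈ Finset.range 1, (linearReal.normal r (linearReal.dir r)).natAbs ∣ 1)
  decide +kernel

theorem linear_unique (w : Fin 1 → ℝ) (hw : w ∈ weightSet ∅) (w' : Fin 1 → ℝ)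
    (hw' : w' ∈ weightSet ∅) : w = w' := by
  have h := hw.2.1
  have h' := hw'.2.1
  rw [Fin.sum_univ_one] at h h'
  ext j
  rw [Subsingleton.elim j 0, h, h']

theorem linear_cover (x : Fin 1 → ℝ) :
    x ∈ youngPolytope 1 ↔ ∃ w ∈ weightSet ∅, x ∈ linearLines.trace w := by
  refine ⟨fun ⟨_, hx⟩ => ⟨1, ⟨fun _ => zero_le_one, by simp, by simp⟩,
    RationalFamily.mem_trace_iff.2 ⟨0, le_rfl, x 0, (hx 0).1, ?_, fun c => ?_⟩⟩,
    fun ⟨w, hw, h⟩ => RationalFamily.trace_subset_youngPolytope hw h⟩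
  · simpa [linearReal] using (hx 0).2
  · rw [Subsingleton.elim c 0]
    simp [linearReal, RationalFamily.vertex]

/-- The geometric symmetric chain decomposition of `L(1)`. -/
noncomputable def linearSystem : ChainSystem (youngPolytope 1) 0 1 :=
  ChainSystem.ofSingle linearLines (fun w hw w' hw' _ _ _ => linear_unique w hw w' hw') linear_cover
    RationalFamily.rk_vertex_add_rk_vertex

/-- The snake of `L(2)`. -/
def quadraticReal : RationalFamily 2 1 where
  k := 1
  -- The second vertex is the midpoint of the vertices of rank 0 and 2; it has middle rank and never
  -- moves.
  base := ![![0, 0], ![1/2, 1/2]]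
  dir := fun | 0 => 1 | _ => 0
  len := fun _ => ![1, 0]
  normal := fun | 1 => ![1, 1] | _ => ![-1, 1]
  level := fun | 1 => 1 | _ => 0

theorem quadraticReal_isValid : quadraticReal.IsValid := by constructor <;> decide +kernel

theorem quadraticReal_indep : AffineIndependent ℝ fun j c => (quadraticReal.base j c : ℝ) := by
  refine affineIndependent_of_sum fun w h0 h1 => ?_
  simp [Fin.sum_univ_succ, funext_iff, Fin.forall_fin_succ, quadraticReal] at h0 h1 ⊢
  exact ⟨by linarith, by linarith⟩

/-- The broken lines of `L(2)`. -/
noncomputable abbrev quadraticLines : BrokenFamily 2 1 :=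
  quadraticReal.toBrokenFamily quadraticReal_isValid quadraticReal_indep

theorem quadraticLines_isDenominator : quadraticLines.IsDenominator 1 := by
  refine ⟨one_ne_zero, ?_⟩
  change (∏ r ∈ Finset.range 2, (quadraticReal.normal (r + 1) (quadraticReal.dir r)).natAbs ∣ 1) ∧
    (∏ r ∈ Finset.range 2, (quadraticReal.normal r (quadraticReal.dir r)).natAbs ∣ 1)
  decide +kernel

theorem mem_trace_quadratic {w : Fin 2 → ℝ} {x : Fin 2 → ℝ} : x ∈ quadraticLines.trace w ↔
    ∃ t, 0 ≤ t ∧ ((t ≤ w 0 ∧ x 0 = w 1 / 2 ∧ x 1 - x 0 = t) ∨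
      (t ≤ w 0 ∧ x 0 = w 1 / 2 + t ∧ x 1 - x 0 = w 0 - t)) := by
  rw [RationalFamily.mem_trace_iff]
  constructor
  · rintro ⟨i, hi, t, h0, h⟩
    refine ⟨t, h0, ?_⟩
    change i ≤ 1 at hi
    interval_cases i <;>
    simp [Fin.sum_univ_succ, quadraticReal, RationalFamily.vertex,
      Fin.forall_fin_succ] at h <;>
    obtain ⟨e, e0, e1⟩ := h <;> [left; right] <;>
    exact ⟨by linarith only [e], by linarith only [e0], by linarith only [e0, e1]⟩
  · rintro ⟨t, h0, h⟩
    rcases h with h | h <;> obtain ⟨e, e0, e1⟩ := h <;> [use 0; use 1] <;>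
    refine ⟨by change _ ≤ 1; norm_num, t, h0, ?_⟩ <;>
    simp [Fin.sum_univ_succ, quadraticReal, RationalFamily.vertex,
      Fin.forall_fin_succ] <;>
    exact ⟨by linarith only [e], by linarith only [e0], by linarith only [e0, e1]⟩

theorem quadratic_unique (w : Fin 2 → ℝ) (hw : w ∈ weightSet ∅) (w' : Fin 2 → ℝ)
    (hw' : w' ∈ weightSet ∅) (x : Fin 2 → ℝ) (hx : x ∈ quadraticLines.trace w)
    (hx' : x ∈ quadraticLines.trace w') : w = w' := by
  have p := hw.2.1
  have q := hw'.2.1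
  rw [Fin.sum_univ_two] at p q
  obtain ⟨t, h0, ht⟩ := mem_trace_quadratic.1 hx
  obtain ⟨t', h0', ht'⟩ := mem_trace_quadratic.1 hx'
  have h : w 0 = w' 0 := by
    rcases ht with ⟨e, e0, e1⟩ | ⟨e, e0, e1⟩ <;> rcases ht' with ⟨f, f0, f1⟩ | ⟨f, f0, f1⟩ <;>
    linarith
  ext j
  fin_cases j
  exacts [h, show w 1 = w' 1 by linarith]

theorem quadratic_cover (x : Fin 2 → ℝ) :
    x ∈ youngPolytope 2 ↔ ∃ w ∈ weightSet ∅, x ∈ quadraticLines.trace w := by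
  refine ⟨fun ⟨hm, hx⟩ => ?_, fun ⟨w, hw, h⟩ => RationalFamily.trace_subset_youngPolytope hw h⟩
  have x0 := (hx 0).1
  have x1 : x 0 ≤ x 1 := hm (by decide)
  have x2 := (hx 1).2
  have key : ∀ q, 0 ≤ q → q ≤ 1 → x ∈ quadraticLines.trace ![q, 1 - q] →
      ∃ w ∈ weightSet ∅, x ∈ quadraticLines.trace w := fun q h0 h1 h =>
    ⟨_, ⟨Fin.forall_fin_two.2 ⟨h0, sub_nonneg.2 h1⟩, by simp, by simp⟩, h⟩
  -- The weight at the fixed vertex is twice the smaller of the two outer gaps; the case tells which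
  -- edge of the line carries x.
  rcases le_total (x 0) (1 - x 1) with h | h
  · refine key (1 - 2 * x 0) (by linarith) (by linarith)
      (mem_trace_quadratic.2 ⟨x 1 - x 0, by linarith, Or.inl ?_⟩)
    simp only [Matrix.cons_val_zero, Matrix.cons_val_one]
    exact ⟨by linarith, by linarith, trivial⟩
  · refine key (2 * x 1 - 1) (by linarith) (by linarith)
      (mem_trace_quadratic.2 ⟨x 0 + x 1 - 1, by linarith, Or.inr ?_⟩)
    simp only [Matrix.cons_val_zero, Matrix.cons_val_one]
    exact ⟨by linarith, by linarith, by linarith⟩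

/-- The geometric symmetric chain decomposition of `L(2)`. -/
noncomputable def quadraticSystem : ChainSystem (youngPolytope 2) 1 1 :=
  ChainSystem.ofSingle quadraticLines quadratic_unique quadratic_cover
    RationalFamily.rk_vertex_add_rk_vertex

/-! ### The decomposition of `L(3)` -/

/-- The real snake of `L(3)`. -/
def cubicReal : RationalFamily 3 2 where
  k := 3
  -- The second vertex is the midpoint of the vertices of rank 0 and 2, and travels to the midpoint
  -- of those of rank 1 and 3. The third is the barycentre of L(3), which stays fixed.
  base := ![![0, 0, 0], ![0, 1/2, 1/2], ![1/4, 1/2, 3/4]]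
  dir := fun | 0 => 2 | 1 => 1 | 2 => 0 | _ => 2
  len := fun | 0 => ![1, 0, 0] | 1 => ![1, 0, 0] | 2 => ![1, 1/2, 0] | _ => ![0, 1/2, 0]
  normal := fun
    | 0 => ![-1, -1, 1] | 1 => ![-1, 1, 1] | 2 => ![-1, -1, 1] | 3 => ![1, -2, 1] | _ => ![-1, 1, 1]
  level := fun | 0 => 0 | 1 => 1 | 2 => 0 | 3 => 0 | _ => 1

/-- The fake snake of `L(3)`. -/
def cubicFake : RationalFamily 3 2 where
  k := 3
  base := cubicReal.base
  -- The lines of vertices 0 and 1 are the same as in the real snake, but their moves are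
  -- interleaved in another order.
  dir := fun | 0 => 0 | 1 => 2 | 2 => 1 | _ => 0
  len := fun | 0 => ![0, 1/2, 0] | 1 => ![1, 1/2, 0] | 2 => ![1, 0, 0] | _ => ![1, 0, 0]
  normal := fun
    | 0 => ![-1, -1, 1] | 1 => ![1, -2, 1] | 2 => ![-1, 1, 1] | 3 => ![-1, -1, 1] | _ => ![-1, 1, 1]
  level := fun | 0 => 0 | 1 => 0 | 2 => 1 | 3 => 0 | _ => 1

theorem cubicReal_isValid : cubicReal.IsValid := by constructor <;> decide +kernel

theorem cubicFake_isValid : cubicFake.IsValid := by constructor <;> decide +kernel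

theorem cubicReal_indep : AffineIndependent ℝ fun j c => (cubicReal.base j c : ℝ) := by
  refine affineIndependent_of_sum fun w h0 h1 => ?_
  simp [Fin.sum_univ_succ, funext_iff, Fin.forall_fin_succ, cubicReal] at h0 h1 ⊢
  refine ⟨?_, ?_, ?_⟩ <;> linarith

theorem cubicFake_indep : AffineIndependent ℝ fun j c => (cubicFake.base j c : ℝ) :=
  cubicReal_indep

/-- The broken lines of the real snake of `L(3)`. -/
noncomputable abbrev cubicRealLines : BrokenFamily 3 2 :=
  cubicReal.toBrokenFamily cubicReal_isValid cubicReal_indep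

/-- The broken lines of the fake snake of `L(3)`. -/
noncomputable abbrev cubicFakeLines : BrokenFamily 3 2 :=
  cubicFake.toBrokenFamily cubicFake_isValid cubicFake_indep

theorem cubicRealLines_isDenominator : cubicRealLines.IsDenominator 1 := by
  refine ⟨one_ne_zero, ?_⟩
  change (∏ r ∈ Finset.range 4, (cubicReal.normal (r + 1) (cubicReal.dir r)).natAbs ∣ 1) ∧
    (∏ r ∈ Finset.range 4, (cubicReal.normal r (cubicReal.dir r)).natAbs ∣ 1)
  decide +kernel

theorem cubicFakeLines_isDenominator : cubicFakeLines.IsDenominator 1 := by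
  refine ⟨one_ne_zero, ?_⟩
  change (∏ r ∈ Finset.range 4, (cubicFake.normal (r + 1) (cubicFake.dir r)).natAbs ∣ 1) ∧
    (∏ r ∈ Finset.range 4, (cubicFake.normal r (cubicFake.dir r)).natAbs ∣ 1)
  decide +kernel

/-- In gap coordinates each disjunct is one swipe, in which an amount `t` moves from one gap to its
neighbour. -/
theorem mem_trace_cubicReal {w : Fin 3 → ℝ} {x : Fin 3 → ℝ} :
    x ∈ cubicRealLines.trace w ↔ ∃ t, 0 ≤ t ∧
    ((t ≤ w 0 ∧ x 0 = w 2 / 4 ∧ x 1 - x 0 = w 2 / 4 + w 1 / 2 ∧ x 2 - x 1 = w 2 / 4 + t) ∨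
    (t ≤ w 0 ∧ x 0 = w 2 / 4 ∧ x 1 - x 0 = w 2 / 4 + w 1 / 2 + t ∧ x 2 - x 1 = w 2 / 4 + w 0 - t) ∨
    (t ≤ w 0 + w 1 / 2 ∧ x 0 = w 2 / 4 + t ∧ x 1 - x 0 = w 2 / 4 + w 0 + w 1 / 2 - t ∧
      x 2 - x 1 = w 2 / 4) ∨
    (t ≤ w 1 / 2 ∧ x 0 = w 2 / 4 + w 0 + w 1 / 2 ∧ x 1 - x 0 = w 2 / 4 ∧ x 2 - x 1 = w 2 / 4 +
      t)) := by
  rw [RationalFamily.mem_trace_iff]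
  constructor
  · rintro ⟨i, hi, t, h0, h⟩
    refine ⟨t, h0, ?_⟩
    change i ≤ 3 at hi
    interval_cases i <;>
    simp [Fin.sum_univ_succ, cubicReal, RationalFamily.vertex, Finset.sum_range_succ,
      Fin.forall_fin_succ] at h <;>
    [left; (iterate 1 right); (iterate 2 right); (iterate 3 right)] <;>
    try left
    all_goals
      obtain ⟨e, e0, e1, e2⟩ := h
      exact ⟨by linarith only [e], by linarith only [e0], by linarith only [e0, e1],
        by linarith only [e1, e2]⟩
  · rintro ⟨t, h0, h⟩
    rcases h with h | h | h | h <;>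
    obtain ⟨e, e0, e1, e2⟩ := h <;>
    [use 0; use 1; use 2; use 3] <;>
    refine ⟨by change _ ≤ 3; norm_num, t, h0, ?_⟩ <;>
    simp [Fin.sum_univ_succ, cubicReal, RationalFamily.vertex, Finset.sum_range_succ,
      Fin.forall_fin_succ] <;>
    exact ⟨by linarith only [e], by linarith only [e0], by linarith only [e0, e1],
      by linarith only [e0, e1, e2]⟩

theorem mem_trace_cubicFake {w : Fin 3 → ℝ} {x : Fin 3 → ℝ} :
    x ∈ cubicFakeLines.trace w ↔ ∃ t, 0 ≤ t ∧
    ((t ≤ w 1 / 2 ∧ x 0 = w 2 / 4 + t ∧ x 1 - x 0 = w 2 / 4 + w 1 / 2 - t ∧ x 2 - x 1 = w 2 / 4) ∨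
    (t ≤ w 0 + w 1 / 2 ∧ x 0 = w 2 / 4 + w 1 / 2 ∧ x 1 - x 0 = w 2 / 4 ∧ x 2 - x 1 = w 2 / 4 + t) ∨
    (t ≤ w 0 ∧ x 0 = w 2 / 4 + w 1 / 2 ∧ x 1 - x 0 = w 2 / 4 + t ∧ x 2 - x 1 = w 2 / 4 + w 0 +
      w 1 / 2 - t) ∨
    (t ≤ w 0 ∧ x 0 = w 2 / 4 + w 1 / 2 + t ∧ x 1 - x 0 = w 2 / 4 + w 0 - t ∧
      x 2 - x 1 = w 2 / 4 + w 1 / 2)) := by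
  rw [RationalFamily.mem_trace_iff]
  constructor
  · rintro ⟨i, hi, t, h0, h⟩
    refine ⟨t, h0, ?_⟩
    change i ≤ 3 at hi
    interval_cases i <;>
    simp [Fin.sum_univ_succ, cubicReal, cubicFake, RationalFamily.vertex, Finset.sum_range_succ,
      Fin.forall_fin_succ] at h <;>
    [left; (iterate 1 right); (iterate 2 right); (iterate 3 right)] <;>
    try left
    all_goals
      obtain ⟨e, e0, e1, e2⟩ := h
      exact ⟨by linarith only [e], by linarith only [e0], by linarith only [e0, e1],
        by linarith only [e1, e2]⟩
  · rintro ⟨t, h0, h⟩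
    rcases h with h | h | h | h <;>
    obtain ⟨e, e0, e1, e2⟩ := h <;>
    [use 0; use 1; use 2; use 3] <;>
    refine ⟨by change _ ≤ 3; norm_num, t, h0, ?_⟩ <;>
    simp [Fin.sum_univ_succ, cubicReal, cubicFake, RationalFamily.vertex, Finset.sum_range_succ,
      Fin.forall_fin_succ] <;>
    exact ⟨by linarith only [e], by linarith only [e0], by linarith only [e0, e1],
      by linarith only [e0, e1, e2]⟩

theorem mem_openTrace_cubicFake {w : Fin 3 → ℝ} {x : Fin 3 → ℝ} {req : Finset (Fin 3)}
    (hw : w ∈ weightSet req) : x ∈ cubicFakeLines.openTrace w ↔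
      x ∈ cubicFakeLines.trace w ∧ w 1 + 3 / 2 * w 2 < x 0 + x 1 + x 2 ∧
      x 0 + x 1 + x 2 < 3 - w 1 - 3 / 2 * w 2 := by
  rw [RationalFamily.mem_openTrace_iff hw]
  refine and_congr_right fun _ => ?_
  simp [Fin.sum_univ_succ, cubicReal, cubicFake]
  refine and_congr ⟨fun h => ?_, fun h => ?_⟩ ⟨fun h => ?_, fun h => ?_⟩ <;>
  linarith only [h]

theorem mem_weightSet_three {req : Finset (Fin 3)} {w : Fin 3 → ℝ}
    (hw : w ∈ weightSet req) : 0 ≤ w 0 ∧ 0 ≤ w 1 ∧ w 0 + w 1 + w 2 = 1 := by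
  have h := hw.2.1
  rw [Fin.sum_univ_three] at h
  exact ⟨hw.1 0, hw.1 1, h⟩

theorem eq_of_eq_three {w w' : Fin 3 → ℝ} (h : w 0 + w 1 + w 2 = 1) (h' : w' 0 + w' 1 + w' 2 = 1)
    (hz : w 2 = w' 2) (h0 : w 0 = w' 0) : w = w' := by
  ext j
  fin_cases j
  exacts [h0, show w 1 = w' 1 by linarith only [h, h', h0, hz], hz]

/-- On every swipe all four gaps are at least w 2 / 4 and one of them equals it. Hence the weight of
the fixed vertex is a function of the point alone, the same one for both snakes. -/
theorem cubicReal_weights {req : Finset (Fin 3)} {w : Fin 3 → ℝ} {x : Fin 3 → ℝ}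
    (hw : w ∈ weightSet req) (hx : x ∈ cubicRealLines.trace w) :
    w 2 = 4 * min (min (1 - x 2) (x 2 - x 1)) (min (x 1 - x 0) (x 0)) := by
  obtain ⟨p0, p1, p⟩ := mem_weightSet_three hw
  obtain ⟨t, h0, ht⟩ := mem_trace_cubicReal.1 hx
  rcases ht with ht | ht | ht | ht <;>
  obtain ⟨e, e0, e1, e2⟩ := ht
  iterate 4
    rcases le_total (1 - x 2) (x 2 - x 1) with h1 | h1 <;>
    rcases le_total (x 1 - x 0) (x 0) with h2 | h2 <;>
    simp only [h1, h2, min_eq_left, min_eq_right] <;>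
    [rcases le_total (1 - x 2) (x 1 - x 0) with h3 | h3; rcases le_total (1 - x 2)
      (x 0) with h3 | h3;
      rcases le_total (x 2 - x 1) (x 1 - x 0) with h3 | h3; rcases le_total (x 2 - x 1)
        (x 0) with h3 | h3] <;>
    simp only [h3, min_eq_left, min_eq_right] <;>
    linarith only [p0, p1, p, h0, h1, h2, h3, e, e0, e1, e2]

theorem cubicFake_weights {req : Finset (Fin 3)} {w : Fin 3 → ℝ} {x : Fin 3 → ℝ}
    (hw : w ∈ weightSet req) (hx : x ∈ cubicFakeLines.trace w) :
    w 2 = 4 * min (min (1 - x 2) (x 2 - x 1)) (min (x 1 - x 0) (x 0)) := by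
  obtain ⟨p0, p1, p⟩ := mem_weightSet_three hw
  obtain ⟨t, h0, ht⟩ := mem_trace_cubicFake.1 hx
  rcases ht with ht | ht | ht | ht <;>
  obtain ⟨e, e0, e1, e2⟩ := ht
  iterate 4
    rcases le_total (1 - x 2) (x 2 - x 1) with h1 | h1 <;>
    rcases le_total (x 1 - x 0) (x 0) with h2 | h2 <;>
    simp only [h1, h2, min_eq_left, min_eq_right] <;>
    [rcases le_total (1 - x 2) (x 1 - x 0) with h3 | h3; rcases le_total (1 - x 2)
      (x 0) with h3 | h3;
      rcases le_total (x 2 - x 1) (x 1 - x 0) with h3 | h3; rcases le_total (x 2 - x 1)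
        (x 0) with h3 | h3] <;>
    simp only [h3, min_eq_left, min_eq_right] <;>
    linarith only [p0, p1, p, h0, h1, h2, h3, e, e0, e1, e2]

/-- The weight of the fixed vertex, and therefore w 0 + w 1, is determined by x. The one remaining
parameter is compared for every pair of swipes by linear arithmetic. -/
theorem cubicReal_unique (w : Fin 3 → ℝ) (hw : w ∈ weightSet ∅) (w' : Fin 3 → ℝ)
    (hw' : w' ∈ weightSet ∅) (x : Fin 3 → ℝ) (hx : x ∈ cubicRealLines.trace w)
    (hx' : x ∈ cubicRealLines.trace w') : w = w' := by
  obtain ⟨p0, p1, p⟩ := mem_weightSet_three hw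
  obtain ⟨q0, q1, q⟩ := mem_weightSet_three hw'
  obtain a2 := cubicReal_weights hw hx
  obtain b2 := cubicReal_weights hw' hx'
  rw [← b2] at a2
  refine eq_of_eq_three p q a2 ?_
  clear b2
  obtain ⟨t, h0, ht⟩ := mem_trace_cubicReal.1 hx
  obtain ⟨t', h0', ht'⟩ := mem_trace_cubicReal.1 hx'
  rw [← a2] at ht' q
  have hs : w 0 + w 1 = w' 0 + w' 1 := by linarith only [p, q]
  clear p q hx hx' hw hw' a2
  generalize x 0 = y0, x 1 - x 0 = y1, x 2 - x 1 = y2 at ht ht'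
  rcases ht with ht | ht | ht | ht <;>
  obtain ⟨e, rfl, rfl, rfl⟩ := ht <;>
  rcases ht' with ht | ht | ht | ht <;>
  obtain ⟨f, f0, f1, f2⟩ := ht <;>
  linarith only [hs, p0, p1, q0, q1, h0, h0', e, f, f0, f1, f2]

theorem cubicFake_unique (w : Fin 3 → ℝ) (hw : w ∈ weightSet {0, 1}) (w' : Fin 3 → ℝ)
    (hw' : w' ∈ weightSet {0, 1}) (x : Fin 3 → ℝ) (hx : x ∈ cubicFakeLines.openTrace w)
    (hx' : x ∈ cubicFakeLines.openTrace w') : w = w' := by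
  obtain ⟨p0, p1, p⟩ := mem_weightSet_three hw
  obtain ⟨q0, q1, q⟩ := mem_weightSet_three hw'
  obtain a2 := cubicFake_weights hw hx.1
  obtain b2 := cubicFake_weights hw' hx'.1
  rw [← b2] at a2
  refine eq_of_eq_three p q a2 ?_
  clear b2
  obtain ⟨t, h0, ht⟩ := mem_trace_cubicFake.1 hx.1
  obtain ⟨t', h0', ht'⟩ := mem_trace_cubicFake.1 hx'.1
  rw [← a2] at ht' q
  have hs : w 0 + w 1 = w' 0 + w' 1 := by linarith only [p, q]
  clear p q hx hx' hw hw' a2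
  generalize x 0 = y0, x 1 - x 0 = y1, x 2 - x 1 = y2 at ht ht'
  rcases ht with ht | ht | ht | ht <;>
  obtain ⟨e, rfl, rfl, rfl⟩ := ht <;>
  rcases ht' with ht | ht | ht | ht <;>
  obtain ⟨f, f0, f1, f2⟩ := ht <;>
  linarith only [hs, p0, p1, q0, q1, h0, h0', e, f, f0, f1, f2]

/-- The two discs of the residual sphere meet only in their common boundary, which the fake snake
avoids: positive weights exclude the two extreme lines and the strict rank bounds exclude the end
segments. -/
theorem cubic_disjoint (w : Fin 3 → ℝ) (hw : w ∈ weightSet ∅) (w' : Fin 3 → ℝ)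
    (hw' : w' ∈ weightSet {0, 1}) (x : Fin 3 → ℝ) (hx : x ∈ cubicRealLines.trace w) :
    x ∉ cubicFakeLines.openTrace w' := by
  intro hx'
  obtain ⟨p0, p1, p⟩ := mem_weightSet_three hw
  obtain ⟨-, -, q⟩ := mem_weightSet_three hw'
  have q0 : 0 < w' 0 := hw'.2.2 0 (by decide)
  have q1 : 0 < w' 1 := hw'.2.2 1 (by decide)
  obtain a2 := cubicReal_weights hw hx
  obtain b2 := cubicFake_weights hw' hx'.1
  rw [← b2] at a2
  clear b2
  obtain ⟨hx', r, r'⟩ := (mem_openTrace_cubicFake hw').1 hx'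
  obtain ⟨t, h0, ht⟩ := mem_trace_cubicReal.1 hx
  obtain ⟨t', h0', ht'⟩ := mem_trace_cubicFake.1 hx'
  rw [← a2] at ht' q r r'
  have hs : w 0 + w 1 = w' 0 + w' 1 := by linarith only [p, q]
  replace r : w' 1 + 3 / 2 * w 2 < 3 * (x 0) + 2 * (x 1 - x 0) + (x 2 - x 1) := by
    linarith only [r]
  replace r' : 3 * (x 0) + 2 * (x 1 - x 0) + (x 2 - x 1) < 3 - w' 1 - 3 / 2 * w 2 := by
    linarith only [r']
  clear hx hx' hw hw' a2
  generalize x 0 = y0, x 1 - x 0 = y1, x 2 - x 1 = y2 at ht ht' r r'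
  rcases ht with ht | ht | ht | ht <;>
  obtain ⟨e, rfl, rfl, rfl⟩ := ht <;>
  rcases ht' with ht | ht | ht | ht <;>
  obtain ⟨f, f0, f1, f2⟩ := ht <;>
  linarith only [hs, q, p0, p1, q0, q1, h0, h0', e, f, f0, f1, f2, r, r']

theorem exists_mem_weightSet_three {q p r : ℝ} (hq : 0 ≤ q) (hp : 0 ≤ p) (hr : 0 ≤ r)
    (h : q + 2 * p + 4 * r = 1) :
    ∃ w ∈ weightSet (∅ : Finset (Fin 3)), w 0 = q ∧ w 1 = 2 * p ∧ w 2 = 4 * r := by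
  refine ⟨![q, 2 * p, 4 * r],
    ⟨fun j => ?_, ?_, fun j hj => absurd hj (Finset.notMem_empty j)⟩, rfl, rfl, rfl⟩
  · fin_cases j
    exacts [hq, mul_nonneg zero_le_two hp, mul_nonneg zero_le_four hr]
  · rw [Fin.sum_univ_three]
    exact h

theorem exists_mem_weightSet_three_of_pos {q p r : ℝ} (hq : 0 < q) (hp : 0 < p) (hr : 0 ≤ r)
    (h : q + 2 * p + 4 * r = 1) :
    ∃ w ∈ weightSet ({0, 1} : Finset (Fin 3)), w 0 = q ∧ w 1 = 2 * p ∧ w 2 = 4 * r := by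
  obtain ⟨w, ⟨h1, h2, -⟩, h0, h3, h4⟩ := exists_mem_weightSet_three hq.le hp.le hr h
  refine ⟨w, ⟨h1, h2, fun j hj => ?_⟩, h0, h3, h4⟩
  rcases Finset.mem_insert.1 hj with rfl | hj
  · rwa [h0]
  · rw [Finset.mem_singleton.1 hj, h3]
    exact mul_pos zero_lt_two hp

/-- Here r is the part of each gap due to the fixed vertex and a, b, c, d are the residual gaps. The
vanishing gap names a triangle and the inequality a region swept by one swipe; q and p are the
weights constant along its lines, up to the factor 2, and `t` is the mass already moved. -/
theorem exists_mem_trace_cubicReal {x : Fin 3 → ℝ} {r a b c d : ℝ} (hr : 0 ≤ r)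
    (ha : 0 ≤ a) (hb : 0 ≤ b) (hc : 0 ≤ c) (hd : 0 ≤ d)
    (h0 : x 0 = r + d) (h1 : x 1 - x 0 = r + c) (h2 : x 2 - x 1 = r + b) (h3 : 1 - x 2 = r + a)
    (h : (d = 0 ∧ c ≤ a) ∨
      (d = 0 ∧ a ≤ c) ∨
      (b = 0 ∧ a ≤ c + d) ∨
      (c = 0 ∧ a + b ≤ d)) :
    ∃ w ∈ weightSet ∅, x ∈ cubicRealLines.trace w := by
  have key : ∀ q p : ℝ, 0 ≤ q → 0 ≤ p → q + 2 * p = a + b + c + d →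
      (∀ w : Fin 3 → ℝ, w 0 = q → w 1 = 2 * p → w 2 = 4 * r → x ∈ cubicRealLines.trace w) →
      ∃ w ∈ weightSet ∅, x ∈ cubicRealLines.trace w := by
    intro q p hq hp h6 H
    obtain ⟨w, hw, w0, w1, w2⟩ := exists_mem_weightSet_three hq hp hr
      (by linarith only [h6, h0, h1, h2, h3])
    exact ⟨w, hw, H w w0 w1 w2⟩
  rcases h with ⟨rfl, h⟩ | ⟨rfl, h⟩ | ⟨rfl, h⟩ | ⟨rfl, h⟩
  · refine key (a + b - c) c (by linarith) (by linarith) (by ring)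
      fun w w0 w1 w2 => mem_trace_cubicReal.2 ⟨b, hb, ?_⟩
    left
    refine ⟨by linarith, ?_, ?_, ?_⟩ <;>
    linarith only [w0, w1, w2, h0, h1, h2]
  · refine key (b + c - a) a (by linarith) (by linarith) (by ring)
      fun w w0 w1 w2 => mem_trace_cubicReal.2 ⟨c - a, by linarith, ?_⟩
    right; left
    refine ⟨by linarith, ?_, ?_, ?_⟩ <;>
    linarith only [w0, w1, w2, h0, h1, h2]
  · refine key (c + d - a) a (by linarith) (by linarith) (by ring)
      fun w w0 w1 w2 => mem_trace_cubicReal.2 ⟨d, hd, ?_⟩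
    right; right; left
    refine ⟨by linarith, ?_, ?_, ?_⟩ <;>
    linarith only [w0, w1, w2, h0, h1, h2]
  · refine key (d - a - b) (a + b) (by linarith) (by linarith) (by ring)
      fun w w0 w1 w2 => mem_trace_cubicReal.2 ⟨b, hb, ?_⟩
    right; right; right
    refine ⟨by linarith, ?_, ?_, ?_⟩ <;>
    linarith only [w0, w1, w2, h0, h1, h2]

theorem exists_mem_openTrace_cubicFake {x : Fin 3 → ℝ} {r a b c d : ℝ} (hr : 0 ≤ r)
    (ha : 0 ≤ a) (hb : 0 ≤ b) (hc : 0 ≤ c) (hd : 0 ≤ d)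
    (h0 : x 0 = r + d) (h1 : x 1 - x 0 = r + c) (h2 : x 2 - x 1 = r + b) (h3 : 1 - x 2 = r + a)
    (h : (b = 0 ∧ 0 < d ∧ c + d < a) ∨
      (c = 0 ∧ 0 < d ∧ d < a + b) ∨
      (a = 0 ∧ 0 < d ∧ d < b) ∨
      (a = 0 ∧ (0 < b ∧ 0 < c) ∧ b ≤ d)) :
    ∃ w ∈ weightSet {0, 1}, x ∈ cubicFakeLines.openTrace w := by
  -- The two bounds on 3d + 2c + b are the endpoint conditions after removing the contribution of
  -- the fixed vertex: residual ranks run from 2p to 3(q + 2p) - 2p.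
  have key : ∀ q p : ℝ, 0 < q → 0 < p → q + 2 * p = a + b + c + d →
      2 * p < 3 * d + 2 * c + b →
      3 * d + 2 * c + b < 3 * q + 4 * p →
      (∀ w : Fin 3 → ℝ, w 0 = q → w 1 = 2 * p → w 2 = 4 * r → x ∈ cubicFakeLines.trace w) →
      ∃ w ∈ weightSet {0, 1}, x ∈ cubicFakeLines.openTrace w := by
    intro q p hq hp h6 h7 h8 H
    obtain ⟨w, hw, w0, w1, w2⟩ := exists_mem_weightSet_three_of_pos hq hp hr
      (by linarith only [h6, h0, h1, h2, h3])
    refine ⟨w, hw, (mem_openTrace_cubicFake hw).2 ⟨H w w0 w1 w2, ?_, ?_⟩⟩ <;>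
    linarith only [w0, w1, w2, h0, h1, h2, h3, h6, h7, h8]
  rcases h with ⟨rfl, h⟩ | ⟨rfl, h⟩ | ⟨rfl, h⟩ | ⟨rfl, h⟩
  · refine key (a - c - d) (c + d) (by linarith) (by linarith) (by ring) (by linarith) (by linarith)
      fun w w0 w1 w2 => mem_trace_cubicFake.2 ⟨d, hd, ?_⟩
    left
    refine ⟨by linarith, ?_, ?_, ?_⟩ <;>
    linarith only [w0, w1, w2, h0, h1, h2]
  · refine key (a + b - d) d (by linarith) (by linarith) (by ring) (by linarith) (by linarith)
      fun w w0 w1 w2 => mem_trace_cubicFake.2 ⟨b, hb, ?_⟩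
    right; left
    refine ⟨by linarith, ?_, ?_, ?_⟩ <;>
    linarith only [w0, w1, w2, h0, h1, h2]
  · refine key (b + c - d) d (by linarith) (by linarith) (by ring) (by linarith) (by linarith)
      fun w w0 w1 w2 => mem_trace_cubicFake.2 ⟨c, hc, ?_⟩
    right; right; left
    refine ⟨by linarith, ?_, ?_, ?_⟩ <;>
    linarith only [w0, w1, w2, h0, h1, h2]
  · refine key (c + d - b) b (by linarith) (by linarith) (by ring) (by linarith) (by linarith)
      fun w w0 w1 w2 => mem_trace_cubicFake.2 ⟨d - b, by linarith, ?_⟩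
    right; right; right
    refine ⟨by linarith, ?_, ?_, ?_⟩ <;>
    linarith only [w0, w1, w2, h0, h1, h2]

theorem cubic_cover (x : Fin 3 → ℝ) : x ∈ youngPolytope 3 ↔
    (∃ w ∈ weightSet ∅, x ∈ cubicRealLines.trace w) ∨
      ∃ w ∈ weightSet {0, 1}, x ∈ cubicFakeLines.openTrace w := by
  constructor
  swap
  · rintro (⟨w, hw, h⟩ | ⟨w, hw, h⟩)
    exacts [RationalFamily.trace_subset_youngPolytope hw h,
      RationalFamily.trace_subset_youngPolytope hw h.1]
  rintro ⟨hm, hx⟩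
  have x0 := (hx 0).1
  have x1 : x 0 ≤ x 1 := hm (by decide)
  have x2 : x 1 ≤ x 2 := hm (by decide)
  have x3 := (hx 2).2
  obtain ⟨r, hr⟩ : ∃ r, r = min (min (1 - x 2) (x 2 - x 1)) (min (x 1 - x 0) (x 0)) := ⟨_, rfl⟩
  have r0 : 0 ≤ r := by
    rw [hr]
    exact le_min (le_min (by linarith) (by linarith)) (le_min (by linarith) x0)
  have ra : r ≤ 1 - x 2 := by rw [hr]; exact (min_le_left _ _).trans (min_le_left _ _)
  have rb : r ≤ x 2 - x 1 := by rw [hr]; exact (min_le_left _ _).trans (min_le_right _ _)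
  have rc : r ≤ x 1 - x 0 := by rw [hr]; exact (min_le_right _ _).trans (min_le_left _ _)
  have rd : r ≤ x 0 := by rw [hr]; exact (min_le_right _ _).trans (min_le_right _ _)
  refine Or.imp (exists_mem_trace_cubicReal (a := 1 - x 2 - r) (b := x 2 - x 1 - r)
    (c := x 1 - x 0 - r) (d := x 0 - r) r0 (by linarith) (by linarith) (by linarith) (by linarith)
    (by ring) (by ring) (by ring) (by ring))
    (exists_mem_openTrace_cubicFake (a := 1 - x 2 - r) (b := x 2 - x 1 - r)
    (c := x 1 - x 0 - r) (d := x 0 - r) r0 (by linarith) (by linarith) (by linarith) (by linarith)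
    (by ring) (by ring) (by ring) (by ring)) ?_
  -- The minimum is attained, so the residue lies on the boundary of the tetrahedron; the closing
  -- case analysis checks that the eight regions cover it.
  have hz : r = 1 - x 2 ∨ r = x 2 - x 1 ∨ r = x 1 - x 0 ∨ r = x 0 := by grind
  generalize x 0 = y0, x 1 = y1, x 2 = y2 at *
  clear hr hm hx
  rcases hz with rfl | rfl | rfl | rfl <;> grind (splits := 40)

/-- The geometric symmetric chain decomposition of `L(3)`. -/
noncomputable def cubicSystem : ChainSystem (youngPolytope 3) 2 2 :=
  ChainSystem.ofPair cubicRealLines cubicFakeLines {0, 1} cubicReal_unique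
    cubicFake_unique cubic_disjoint cubic_cover RationalFamily.rk_vertex_add_rk_vertex
    RationalFamily.rk_vertex_add_rk_vertex

theorem cubicSystem_isDenominator : ∀ a, (cubicSystem.family a).IsDenominator 1 :=
  Fin.forall_fin_two.2 ⟨cubicRealLines_isDenominator, cubicFakeLines_isDenominator⟩

theorem cubicSystem_trace_subset : ∀ a, ∀ w ∈ weightSet (cubicSystem.req a),
    (cubicSystem.family a).trace w ⊆ youngPolytope 3 :=
  Fin.forall_fin_two.2
    ⟨fun w hw => show cubicRealLines.trace w ⊆ _ from
      RationalFamily.trace_subset_youngPolytope hw,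
    fun w hw => show cubicFakeLines.trace w ⊆ _ from
      RationalFamily.trace_subset_youngPolytope hw⟩

/-! ### The decomposition of `L(4)` -/

/-- The real snake of `L(4)`. -/
def quarticReal : RationalFamily 4 3 where
  k := 5
  -- Vertex 1 is the midpoint of the vertices of rank 0 and 2. The last two are fixed: the midpoint
  -- of those of rank 1 and 3, and the barycentre of those of rank 0, 2 and 4.
  base := ![![0, 0, 0, 0], ![0, 0, 1/2, 1/2], ![0, 1/2, 1/2, 1], ![1/3, 1/3, 2/3, 2/3]]
  dir := fun | 0 => 3 | 1 => 2 | 2 => 1 | 3 => 0 | 4 => 3 | _ => 2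
  len := fun | 0 | 1 => ![1, 0, 0, 0] | 2 | 3 => ![1, 1/2, 0, 0] | _ => ![0, 1/2, 0, 0]
  normal := fun
    | 1 | 5 => ![0, -1, 1, 1] | 3 => ![-1, -1, 1, 0] | _ => ![1, -1, -1, 1]
  level := fun | 1 | 5 => 1 | _ => 0

/-- The fake snake of `L(4)`. -/
def quarticFake : RationalFamily 4 3 where
  k := 5
  base := quarticReal.base
  dir := fun | 0 => 1 | 1 => 0 | 2 => 3 | 3 => 2 | 4 => 1 | _ => 0
  len := fun | 0 | 1 => ![0, 1/2, 0, 0] | 2 | 3 => ![1, 1/2, 0, 0] | _ => ![1, 0, 0, 0]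
  normal := fun
    | 3 => ![0, -1, 1, 1] | 1 | 5 => ![-1, -1, 1, 0] | _ => ![1, -1, -1, 1]
  level := fun | 3 => 1 | _ => 0

theorem quarticReal_isValid : quarticReal.IsValid := by constructor <;> decide +kernel

theorem quarticFake_isValid : quarticFake.IsValid := by constructor <;> decide +kernel

theorem quarticReal_indep : AffineIndependent ℝ fun j c => (quarticReal.base j c : ℝ) := by
  refine affineIndependent_of_sum fun w h0 h1 => ?_
  simp [Fin.sum_univ_succ, funext_iff, Fin.forall_fin_succ, quarticReal] at h0 h1 ⊢
  refine ⟨?_, ?_, ?_, ?_⟩ <;> linarith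

theorem quarticFake_indep : AffineIndependent ℝ fun j c => (quarticFake.base j c : ℝ) :=
  quarticReal_indep

/-- The broken lines of the real snake of `L(4)`. -/
noncomputable abbrev quarticRealLines : BrokenFamily 4 3 :=
  quarticReal.toBrokenFamily quarticReal_isValid quarticReal_indep

/-- The broken lines of the fake snake of `L(4)`. -/
noncomputable abbrev quarticFakeLines : BrokenFamily 4 3 :=
  quarticFake.toBrokenFamily quarticFake_isValid quarticFake_indep

theorem quarticRealLines_isDenominator : quarticRealLines.IsDenominator 1 := by
  refine ⟨one_ne_zero, ?_⟩
  change (∏ r ∈ Finset.range 6, (quarticReal.normal (r + 1) (quarticReal.dir r)).natAbs ∣ 1) ∧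
    (∏ r ∈ Finset.range 6, (quarticReal.normal r (quarticReal.dir r)).natAbs ∣ 1)
  decide +kernel

theorem quarticFakeLines_isDenominator : quarticFakeLines.IsDenominator 1 := by
  refine ⟨one_ne_zero, ?_⟩
  change (∏ r ∈ Finset.range 6, (quarticFake.normal (r + 1) (quarticFake.dir r)).natAbs ∣ 1) ∧
    (∏ r ∈ Finset.range 6, (quarticFake.normal r (quarticFake.dir r)).natAbs ∣ 1)
  decide +kernel

theorem mem_trace_quarticReal {w : Fin 4 → ℝ} {x : Fin 4 → ℝ} :
    x ∈ quarticRealLines.trace w ↔ ∃ t, 0 ≤ t ∧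
    ((t ≤ w 0 ∧ x 0 = w 3 / 3 ∧ x 1 - x 0 = w 2 / 2 ∧ x 2 - x 1 = w 3 / 3 + w 1 / 2 ∧
      x 3 - x 2 = w 2 / 2 + t) ∨
    (t ≤ w 0 ∧ x 0 = w 3 / 3 ∧ x 1 - x 0 = w 2 / 2 ∧ x 2 - x 1 = w 3 / 3 + w 1 / 2 + t ∧
      x 3 - x 2 = w 2 / 2 + w 0 - t) ∨
    (t ≤ w 0 + w 1 / 2 ∧ x 0 = w 3 / 3 ∧ x 1 - x 0 = w 2 / 2 + t ∧ x 2 - x 1 = w 3 / 3 + w 0 +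
      w 1 / 2 - t ∧ x 3 - x 2 = w 2 / 2) ∨
    (t ≤ w 0 + w 1 / 2 ∧ x 0 = w 3 / 3 + t ∧ x 1 - x 0 = w 2 / 2 + w 0 + w 1 / 2 - t ∧
      x 2 - x 1 = w 3 / 3 ∧ x 3 - x 2 = w 2 / 2) ∨
    (t ≤ w 1 / 2 ∧ x 0 = w 3 / 3 + w 0 + w 1 / 2 ∧ x 1 - x 0 = w 2 / 2 ∧ x 2 - x 1 = w 3 / 3 ∧
      x 3 - x 2 = w 2 / 2 + t) ∨
    (t ≤ w 1 / 2 ∧ x 0 = w 3 / 3 + w 0 + w 1 / 2 ∧ x 1 - x 0 = w 2 / 2 ∧ x 2 - x 1 = w 3 / 3 +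
      t ∧ x 3 - x 2 = w 2 / 2 + w 1 / 2 - t)) := by
  rw [RationalFamily.mem_trace_iff]
  constructor
  · rintro ⟨i, hi, t, h0, h⟩
    refine ⟨t, h0, ?_⟩
    change i ≤ 5 at hi
    interval_cases i <;>
    simp [Fin.sum_univ_succ, quarticReal, RationalFamily.vertex, Finset.sum_range_succ,
      Fin.forall_fin_succ] at h <;>
    [left; (iterate 1 right); (iterate 2 right); (iterate 3 right); (iterate 4 right);
      (iterate 5 right)] <;>
    try left
    all_goals
      obtain ⟨e, e0, e1, e2, e3⟩ := h
      exact ⟨by linarith only [e], by linarith only [e0], by linarith only [e0, e1],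
        by linarith only [e1, e2], by linarith only [e2, e3]⟩
  · rintro ⟨t, h0, h⟩
    rcases h with h | h | h | h | h | h <;>
    obtain ⟨e, e0, e1, e2, e3⟩ := h <;>
    [use 0; use 1; use 2; use 3; use 4; use 5] <;>
    refine ⟨by change _ ≤ 5; norm_num, t, h0, ?_⟩ <;>
    simp [Fin.sum_univ_succ, quarticReal, RationalFamily.vertex, Finset.sum_range_succ,
      Fin.forall_fin_succ] <;>
    exact ⟨by linarith only [e], by linarith only [e0], by linarith only [e0, e1],
      by linarith only [e0, e1, e2], by linarith only [e0, e1, e2, e3]⟩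

theorem mem_trace_quarticFake {w : Fin 4 → ℝ} {x : Fin 4 → ℝ} :
    x ∈ quarticFakeLines.trace w ↔ ∃ t, 0 ≤ t ∧
    ((t ≤ w 1 / 2 ∧ x 0 = w 3 / 3 ∧ x 1 - x 0 = w 2 / 2 + t ∧ x 2 - x 1 = w 3 / 3 + w 1 / 2 - t ∧
      x 3 - x 2 = w 2 / 2) ∨
    (t ≤ w 1 / 2 ∧ x 0 = w 3 / 3 + t ∧ x 1 - x 0 = w 2 / 2 + w 1 / 2 - t ∧ x 2 - x 1 = w 3 / 3 ∧
      x 3 - x 2 = w 2 / 2) ∨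
    (t ≤ w 0 + w 1 / 2 ∧ x 0 = w 3 / 3 + w 1 / 2 ∧ x 1 - x 0 = w 2 / 2 ∧ x 2 - x 1 = w 3 / 3 ∧
      x 3 - x 2 = w 2 / 2 + t) ∨
    (t ≤ w 0 + w 1 / 2 ∧ x 0 = w 3 / 3 + w 1 / 2 ∧ x 1 - x 0 = w 2 / 2 ∧ x 2 - x 1 = w 3 / 3 +
      t ∧ x 3 - x 2 = w 2 / 2 + w 0 + w 1 / 2 - t) ∨
    (t ≤ w 0 ∧ x 0 = w 3 / 3 + w 1 / 2 ∧ x 1 - x 0 = w 2 / 2 + t ∧ x 2 - x 1 = w 3 / 3 + w 0 +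
      w 1 / 2 - t ∧ x 3 - x 2 = w 2 / 2) ∨
    (t ≤ w 0 ∧ x 0 = w 3 / 3 + w 1 / 2 + t ∧ x 1 - x 0 = w 2 / 2 + w 0 - t ∧
      x 2 - x 1 = w 3 / 3 + w 1 / 2 ∧ x 3 - x 2 = w 2 / 2)) := by
  rw [RationalFamily.mem_trace_iff]
  constructor
  · rintro ⟨i, hi, t, h0, h⟩
    refine ⟨t, h0, ?_⟩
    change i ≤ 5 at hi
    interval_cases i <;>
    simp [Fin.sum_univ_succ, quarticReal, quarticFake, RationalFamily.vertex, Finset.sum_range_succ,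
      Fin.forall_fin_succ] at h <;>
    [left; (iterate 1 right); (iterate 2 right); (iterate 3 right); (iterate 4 right);
      (iterate 5 right)] <;>
    try left
    all_goals
      obtain ⟨e, e0, e1, e2, e3⟩ := h
      exact ⟨by linarith only [e], by linarith only [e0], by linarith only [e0, e1],
        by linarith only [e1, e2], by linarith only [e2, e3]⟩
  · rintro ⟨t, h0, h⟩
    rcases h with h | h | h | h | h | h <;>
    obtain ⟨e, e0, e1, e2, e3⟩ := h <;>
    [use 0; use 1; use 2; use 3; use 4; use 5] <;>
    refine ⟨by change _ ≤ 5; norm_num, t, h0, ?_⟩ <;>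
    simp [Fin.sum_univ_succ, quarticReal, quarticFake, RationalFamily.vertex, Finset.sum_range_succ,
      Fin.forall_fin_succ] <;>
    exact ⟨by linarith only [e], by linarith only [e0], by linarith only [e0, e1],
      by linarith only [e0, e1, e2], by linarith only [e0, e1, e2, e3]⟩

theorem mem_openTrace_quarticFake {w : Fin 4 → ℝ} {x : Fin 4 → ℝ} {req : Finset (Fin 4)}
    (hw : w ∈ weightSet req) : x ∈ quarticFakeLines.openTrace w ↔
      x ∈ quarticFakeLines.trace w ∧ w 1 + 2 * (w 2 + w 3) < x 0 + x 1 + x 2 + x 3 ∧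
      x 0 + x 1 + x 2 + x 3 < 4 - w 1 - 2 * (w 2 + w 3) := by
  rw [RationalFamily.mem_openTrace_iff hw]
  refine and_congr_right fun _ => ?_
  simp [Fin.sum_univ_succ, quarticReal, quarticFake]
  refine and_congr ⟨fun h => ?_, fun h => ?_⟩ ⟨fun h => ?_, fun h => ?_⟩ <;>
  linarith only [h]

theorem mem_weightSet_four {req : Finset (Fin 4)} {w : Fin 4 → ℝ}
    (hw : w ∈ weightSet req) : 0 ≤ w 0 ∧ 0 ≤ w 1 ∧ w 0 + w 1 + w 2 + w 3 = 1 := by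
  have h := hw.2.1
  rw [Fin.sum_univ_four] at h
  exact ⟨hw.1 0, hw.1 1, h⟩

theorem eq_of_eq_four {w w' : Fin 4 → ℝ} (h : w 0 + w 1 + w 2 + w 3 = 1) (h' : w' 0 + w' 1 +
    w' 2 + w' 3 = 1)
    (hz : w 2 = w' 2 ∧ w 3 = w' 3) (h0 : w 0 = w' 0) : w = w' := by
  obtain ⟨h2, h3⟩ := hz
  ext j
  fin_cases j
  exacts [h0, show w 1 = w' 1 by linarith only [h, h', h0, h2, h3], h2, h3]

/-- On each swipe at least one gap of either group carries only the contribution of its fixed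
vertex, so both fixed weights are multiples of group minima. -/
theorem quarticReal_weights {req : Finset (Fin 4)} {w : Fin 4 → ℝ} {x : Fin 4 → ℝ}
    (hw : w ∈ weightSet req) (hx : x ∈ quarticRealLines.trace w) :
    w 2 = 2 * min (x 3 - x 2) (x 1 - x 0) ∧ w 3 = 3 * min (1 - x 3) (min (x 2 - x 1) (x 0)) := by
  obtain ⟨p0, p1, p⟩ := mem_weightSet_four hw
  obtain ⟨t, h0, ht⟩ := mem_trace_quarticReal.1 hx
  refine ⟨?_, ?_⟩ <;>
  rcases ht with ht | ht | ht | ht | ht | ht <;>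
  obtain ⟨e, e0, e1, e2, e3⟩ := ht
  iterate 6
    rcases le_total (x 3 - x 2) (x 1 - x 0) with h1 | h1 <;>
    [rw [min_eq_left h1]; rw [min_eq_right h1]] <;>
    linarith only [p0, p1, p, h0, h1, e, e0, e1, e2, e3]
  iterate 6
    rcases le_total (x 2 - x 1) (x 0) with h1 | h1 <;>
    simp only [h1, min_eq_left, min_eq_right] <;>
    [rcases le_total (1 - x 3) (x 2 - x 1) with h2 | h2; rcases le_total (1 - x 3)
      (x 0) with h2 | h2] <;>
    simp only [h2, min_eq_left, min_eq_right] <;>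
    linarith only [p0, p1, p, h0, h1, h2, e, e0, e1, e2, e3]

theorem quarticFake_weights {req : Finset (Fin 4)} {w : Fin 4 → ℝ} {x : Fin 4 → ℝ}
    (hw : w ∈ weightSet req) (hx : x ∈ quarticFakeLines.trace w) :
    w 2 = 2 * min (x 3 - x 2) (x 1 - x 0) ∧ w 3 = 3 * min (1 - x 3) (min (x 2 - x 1) (x 0)) := by
  obtain ⟨p0, p1, p⟩ := mem_weightSet_four hw
  obtain ⟨t, h0, ht⟩ := mem_trace_quarticFake.1 hx
  refine ⟨?_, ?_⟩ <;>
  rcases ht with ht | ht | ht | ht | ht | ht <;>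
  obtain ⟨e, e0, e1, e2, e3⟩ := ht
  iterate 6
    rcases le_total (x 3 - x 2) (x 1 - x 0) with h1 | h1 <;>
    [rw [min_eq_left h1]; rw [min_eq_right h1]] <;>
    linarith only [p0, p1, p, h0, h1, e, e0, e1, e2, e3]
  iterate 6
    rcases le_total (x 2 - x 1) (x 0) with h1 | h1 <;>
    simp only [h1, min_eq_left, min_eq_right] <;>
    [rcases le_total (1 - x 3) (x 2 - x 1) with h2 | h2; rcases le_total (1 - x 3)
      (x 0) with h2 | h2] <;>
    simp only [h2, min_eq_left, min_eq_right] <;>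
    linarith only [p0, p1, p, h0, h1, h2, e, e0, e1, e2, e3]

theorem quarticReal_unique (w : Fin 4 → ℝ) (hw : w ∈ weightSet ∅) (w' : Fin 4 → ℝ)
    (hw' : w' ∈ weightSet ∅) (x : Fin 4 → ℝ) (hx : x ∈ quarticRealLines.trace w)
    (hx' : x ∈ quarticRealLines.trace w') : w = w' := by
  obtain ⟨p0, p1, p⟩ := mem_weightSet_four hw
  obtain ⟨q0, q1, q⟩ := mem_weightSet_four hw'
  obtain ⟨a2, a3⟩ := quarticReal_weights hw hx
  obtain ⟨b2, b3⟩ := quarticReal_weights hw' hx'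
  rw [← b2] at a2
  rw [← b3] at a3
  refine eq_of_eq_four p q ⟨a2, a3⟩ ?_
  clear b2 b3
  obtain ⟨t, h0, ht⟩ := mem_trace_quarticReal.1 hx
  obtain ⟨t', h0', ht'⟩ := mem_trace_quarticReal.1 hx'
  rw [← a2, ← a3] at ht' q
  have hs : w 0 + w 1 = w' 0 + w' 1 := by linarith only [p, q]
  clear p q hx hx' hw hw' a2 a3
  generalize x 0 = y0, x 1 - x 0 = y1, x 2 - x 1 = y2, x 3 - x 2 = y3 at ht ht'
  rcases ht with ht | ht | ht | ht | ht | ht <;>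
  obtain ⟨e, rfl, rfl, rfl, rfl⟩ := ht <;>
  rcases ht' with ht | ht | ht | ht | ht | ht <;>
  obtain ⟨f, f0, f1, f2, f3⟩ := ht <;>
  linarith only [hs, p0, p1, q0, q1, h0, h0', e, f, f0, f1, f2, f3]

theorem quarticFake_unique (w : Fin 4 → ℝ) (hw : w ∈ weightSet {0, 1}) (w' : Fin 4 → ℝ)
    (hw' : w' ∈ weightSet {0, 1}) (x : Fin 4 → ℝ) (hx : x ∈ quarticFakeLines.openTrace w)
    (hx' : x ∈ quarticFakeLines.openTrace w') : w = w' := by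
  obtain ⟨p0, p1, p⟩ := mem_weightSet_four hw
  obtain ⟨q0, q1, q⟩ := mem_weightSet_four hw'
  obtain ⟨a2, a3⟩ := quarticFake_weights hw hx.1
  obtain ⟨b2, b3⟩ := quarticFake_weights hw' hx'.1
  rw [← b2] at a2
  rw [← b3] at a3
  refine eq_of_eq_four p q ⟨a2, a3⟩ ?_
  clear b2 b3
  obtain ⟨t, h0, ht⟩ := mem_trace_quarticFake.1 hx.1
  obtain ⟨t', h0', ht'⟩ := mem_trace_quarticFake.1 hx'.1
  rw [← a2, ← a3] at ht' q
  have hs : w 0 + w 1 = w' 0 + w' 1 := by linarith only [p, q]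
  clear p q hx hx' hw hw' a2 a3
  generalize x 0 = y0, x 1 - x 0 = y1, x 2 - x 1 = y2, x 3 - x 2 = y3 at ht ht'
  rcases ht with ht | ht | ht | ht | ht | ht <;>
  obtain ⟨e, rfl, rfl, rfl, rfl⟩ := ht <;>
  rcases ht' with ht | ht | ht | ht | ht | ht <;>
  obtain ⟨f, f0, f1, f2, f3⟩ := ht <;>
  linarith only [hs, p0, p1, q0, q1, h0, h0', e, f, f0, f1, f2, f3]

theorem quartic_disjoint (w : Fin 4 → ℝ) (hw : w ∈ weightSet ∅) (w' : Fin 4 → ℝ)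
    (hw' : w' ∈ weightSet {0, 1}) (x : Fin 4 → ℝ) (hx : x ∈ quarticRealLines.trace w) :
    x ∉ quarticFakeLines.openTrace w' := by
  intro hx'
  obtain ⟨p0, p1, p⟩ := mem_weightSet_four hw
  obtain ⟨-, -, q⟩ := mem_weightSet_four hw'
  have q0 : 0 < w' 0 := hw'.2.2 0 (by decide)
  have q1 : 0 < w' 1 := hw'.2.2 1 (by decide)
  obtain ⟨a2, a3⟩ := quarticReal_weights hw hx
  obtain ⟨b2, b3⟩ := quarticFake_weights hw' hx'.1
  rw [← b2] at a2
  rw [← b3] at a3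
  clear b2 b3
  obtain ⟨hx', r, r'⟩ := (mem_openTrace_quarticFake hw').1 hx'
  obtain ⟨t, h0, ht⟩ := mem_trace_quarticReal.1 hx
  obtain ⟨t', h0', ht'⟩ := mem_trace_quarticFake.1 hx'
  rw [← a2, ← a3] at ht' q r r'
  have hs : w 0 + w 1 = w' 0 + w' 1 := by linarith only [p, q]
  replace r : w' 1 + 2 * (w 2 + w 3) < 4 * (x 0) + 3 * (x 1 - x 0) + 2 * (x 2 - x 1) +
      (x 3 - x 2) := by
    linarith only [r]
  replace r' : 4 * (x 0) + 3 * (x 1 - x 0) + 2 * (x 2 - x 1) + (x 3 - x 2) < 4 - w' 1 - 2 *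
      (w 2 + w 3) := by
    linarith only [r']
  clear hx hx' hw hw' a2 a3
  generalize x 0 = y0, x 1 - x 0 = y1, x 2 - x 1 = y2, x 3 - x 2 = y3 at ht ht' r r'
  rcases ht with ht | ht | ht | ht | ht | ht <;>
  obtain ⟨e, rfl, rfl, rfl, rfl⟩ := ht <;>
  rcases ht' with ht | ht | ht | ht | ht | ht <;>
  obtain ⟨f, f0, f1, f2, f3⟩ := ht <;>
  linarith only [hs, q, p0, p1, q0, q1, h0, h0', e, f, f0, f1, f2, f3, r, r']

theorem exists_mem_weightSet_four {q p s r : ℝ} (hq : 0 ≤ q) (hp : 0 ≤ p) (hs : 0 ≤ s) (hr : 0 ≤ r)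
    (h : q + 2 * p + 2 * s + 3 * r = 1) :
    ∃ w ∈ weightSet (∅ : Finset (Fin 4)), w 0 = q ∧ w 1 = 2 * p ∧ w 2 = 2 * s ∧ w 3 = 3 * r := by
  refine ⟨![q, 2 * p, 2 * s, 3 * r],
    ⟨fun j => ?_, ?_, fun j hj => absurd hj (Finset.notMem_empty j)⟩, rfl, rfl, rfl, rfl⟩
  · fin_cases j
    exacts [hq, mul_nonneg zero_le_two hp, mul_nonneg zero_le_two hs, mul_nonneg zero_le_three hr]
  · rw [Fin.sum_univ_four]
    exact h

theorem exists_mem_weightSet_four_of_pos {q p s r : ℝ} (hq : 0 < q) (hp : 0 < p) (hs : 0 ≤ s)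
    (hr : 0 ≤ r)
    (h : q + 2 * p + 2 * s + 3 * r = 1) :
    ∃ w ∈ weightSet ({0, 1} : Finset (Fin 4)), w 0 = q ∧ w 1 = 2 * p ∧ w 2 = 2 * s ∧
        w 3 = 3 * r := by
  obtain ⟨w, ⟨h1, h2, -⟩, h0, h3, h4⟩ := exists_mem_weightSet_four hq.le hp.le hs hr h
  refine ⟨w, ⟨h1, h2, fun j hj => ?_⟩, h0, h3, h4⟩
  rcases Finset.mem_insert.1 hj with rfl | hj
  · rwa [h0]
  · rw [Finset.mem_singleton.1 hj, h3]
    exact mul_pos zero_lt_two hp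

/-- Two vanishing residual gaps, one from {b, d} and one from {a, c, e}, name a triangle of the
residual sphere, and the inequality names the part of it belonging to one real swipe. -/
theorem exists_mem_trace_quarticReal {x : Fin 4 → ℝ} {s r a b c d e : ℝ} (hs : 0 ≤ s) (hr : 0 ≤ r)
    (ha : 0 ≤ a) (hb : 0 ≤ b) (hc : 0 ≤ c) (hd : 0 ≤ d) (he : 0 ≤ e)
    (h0 : x 0 = r + e) (h1 : x 1 - x 0 = s + d) (h2 : x 2 - x 1 = r + c) (h3 : x 3 - x 2 = s +
      b) (h4 : 1 - x 3 = r + a)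
    (h : (d = 0 ∧ e = 0 ∧ c ≤ a) ∨
      (d = 0 ∧ e = 0 ∧ a ≤ c) ∨
      (b = 0 ∧ e = 0 ∧ a ≤ c + d) ∨
      (b = 0 ∧ c = 0 ∧ a ≤ d + e) ∨
      (c = 0 ∧ d = 0 ∧ a + b ≤ e) ∨
      (a = 0 ∧ d = 0 ∧ b + c ≤ e)) :
    ∃ w ∈ weightSet ∅, x ∈ quarticRealLines.trace w := by
  have key : ∀ q p : ℝ, 0 ≤ q → 0 ≤ p → q + 2 * p = a + b + c + d + e →
      (∀ w : Fin 4 → ℝ, w 0 = q → w 1 = 2 * p → w 2 = 2 * s → w 3 = 3 * r →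
        x ∈ quarticRealLines.trace w) →
      ∃ w ∈ weightSet ∅, x ∈ quarticRealLines.trace w := by
    intro q p hq hp h6 H
    obtain ⟨w, hw, w0, w1, w2, w3⟩ := exists_mem_weightSet_four hq hp hs hr
      (by linarith only [h6, h0, h1, h2, h3, h4])
    exact ⟨w, hw, H w w0 w1 w2 w3⟩
  rcases h with ⟨rfl, rfl, h⟩ | ⟨rfl, rfl, h⟩ | ⟨rfl, rfl, h⟩ | ⟨rfl, rfl, h⟩ | ⟨rfl, rfl, h⟩ |
    ⟨rfl, rfl, h⟩
  · refine key (a + b - c) c (by linarith) (by linarith) (by ring)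
      fun w w0 w1 w2 w3 => mem_trace_quarticReal.2 ⟨b, hb, ?_⟩
    left
    refine ⟨by linarith, ?_, ?_, ?_, ?_⟩ <;>
    linarith only [w0, w1, w2, w3, h0, h1, h2, h3]
  · refine key (b + c - a) a (by linarith) (by linarith) (by ring)
      fun w w0 w1 w2 w3 => mem_trace_quarticReal.2 ⟨c - a, by linarith, ?_⟩
    right; left
    refine ⟨by linarith, ?_, ?_, ?_, ?_⟩ <;>
    linarith only [w0, w1, w2, w3, h0, h1, h2, h3]
  · refine key (c + d - a) a (by linarith) (by linarith) (by ring)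
      fun w w0 w1 w2 w3 => mem_trace_quarticReal.2 ⟨d, hd, ?_⟩
    right; right; left
    refine ⟨by linarith, ?_, ?_, ?_, ?_⟩ <;>
    linarith only [w0, w1, w2, w3, h0, h1, h2, h3]
  · refine key (d + e - a) a (by linarith) (by linarith) (by ring)
      fun w w0 w1 w2 w3 => mem_trace_quarticReal.2 ⟨e, he, ?_⟩
    right; right; right; left
    refine ⟨by linarith, ?_, ?_, ?_, ?_⟩ <;>
    linarith only [w0, w1, w2, w3, h0, h1, h2, h3]
  · refine key (e - a - b) (a + b) (by linarith) (by linarith) (by ring)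
      fun w w0 w1 w2 w3 => mem_trace_quarticReal.2 ⟨b, hb, ?_⟩
    right; right; right; right; left
    refine ⟨by linarith, ?_, ?_, ?_, ?_⟩ <;>
    linarith only [w0, w1, w2, w3, h0, h1, h2, h3]
  · refine key (e - b - c) (b + c) (by linarith) (by linarith) (by ring)
      fun w w0 w1 w2 w3 => mem_trace_quarticReal.2 ⟨c, hc, ?_⟩
    right; right; right; right; right
    refine ⟨by linarith, ?_, ?_, ?_, ?_⟩ <;>
    linarith only [w0, w1, w2, w3, h0, h1, h2, h3]

theorem exists_mem_openTrace_quarticFake {x : Fin 4 → ℝ} {s r a b c d e : ℝ} (hs : 0 ≤ s) (hr :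
    0 ≤ r)
    (ha : 0 ≤ a) (hb : 0 ≤ b) (hc : 0 ≤ c) (hd : 0 ≤ d) (he : 0 ≤ e)
    (h0 : x 0 = r + e) (h1 : x 1 - x 0 = s + d) (h2 : x 2 - x 1 = r + c) (h3 : x 3 - x 2 = s +
      b) (h4 : 1 - x 3 = r + a)
    (h : (b = 0 ∧ e = 0 ∧ 0 < d ∧ c + d < a) ∨
      (b = 0 ∧ c = 0 ∧ 0 < d + e ∧ d + e < a) ∨
      (c = 0 ∧ d = 0 ∧ 0 < e ∧ e < a + b) ∨
      (a = 0 ∧ d = 0 ∧ 0 < e ∧ e < b + c) ∨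
      (a = 0 ∧ b = 0 ∧ 0 < e ∧ e < c) ∨
      (a = 0 ∧ b = 0 ∧ (0 < c ∧ 0 < d) ∧ c ≤ e)) :
    ∃ w ∈ weightSet {0, 1}, x ∈ quarticFakeLines.openTrace w := by
  have key : ∀ q p : ℝ, 0 < q → 0 < p → q + 2 * p = a + b + c + d + e →
      2 * p < 4 * e + 3 * d + 2 * c + b →
      4 * e + 3 * d + 2 * c + b < 4 * q + 6 * p →
      (∀ w : Fin 4 → ℝ, w 0 = q → w 1 = 2 * p → w 2 = 2 * s → w 3 = 3 * r →
        x ∈ quarticFakeLines.trace w) →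
      ∃ w ∈ weightSet {0, 1}, x ∈ quarticFakeLines.openTrace w := by
    intro q p hq hp h6 h7 h8 H
    obtain ⟨w, hw, w0, w1, w2, w3⟩ := exists_mem_weightSet_four_of_pos hq hp hs hr
      (by linarith only [h6, h0, h1, h2, h3, h4])
    refine ⟨w, hw, (mem_openTrace_quarticFake hw).2 ⟨H w w0 w1 w2 w3, ?_, ?_⟩⟩ <;>
    linarith only [w0, w1, w2, w3, h0, h1, h2, h3, h4, h6, h7, h8]
  rcases h with ⟨rfl, rfl, h⟩ | ⟨rfl, rfl, h⟩ | ⟨rfl, rfl, h⟩ | ⟨rfl, rfl, h⟩ | ⟨rfl, rfl, h⟩ |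
    ⟨rfl, rfl, h⟩
  · refine key (a - c - d) (c + d) (by linarith) (by linarith) (by ring) (by linarith) (by linarith)
      fun w w0 w1 w2 w3 => mem_trace_quarticFake.2 ⟨d, hd, ?_⟩
    left
    refine ⟨by linarith, ?_, ?_, ?_, ?_⟩ <;>
    linarith only [w0, w1, w2, w3, h0, h1, h2, h3]
  · refine key (a - d - e) (d + e) (by linarith) (by linarith) (by ring) (by linarith) (by linarith)
      fun w w0 w1 w2 w3 => mem_trace_quarticFake.2 ⟨e, he, ?_⟩
    right; left
    refine ⟨by linarith, ?_, ?_, ?_, ?_⟩ <;>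
    linarith only [w0, w1, w2, w3, h0, h1, h2, h3]
  · refine key (a + b - e) e (by linarith) (by linarith) (by ring) (by linarith) (by linarith)
      fun w w0 w1 w2 w3 => mem_trace_quarticFake.2 ⟨b, hb, ?_⟩
    right; right; left
    refine ⟨by linarith, ?_, ?_, ?_, ?_⟩ <;>
    linarith only [w0, w1, w2, w3, h0, h1, h2, h3]
  · refine key (b + c - e) e (by linarith) (by linarith) (by ring) (by linarith) (by linarith)
      fun w w0 w1 w2 w3 => mem_trace_quarticFake.2 ⟨c, hc, ?_⟩
    right; right; right; left
    refine ⟨by linarith, ?_, ?_, ?_, ?_⟩ <;>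
    linarith only [w0, w1, w2, w3, h0, h1, h2, h3]
  · refine key (c + d - e) e (by linarith) (by linarith) (by ring) (by linarith) (by linarith)
      fun w w0 w1 w2 w3 => mem_trace_quarticFake.2 ⟨d, hd, ?_⟩
    right; right; right; right; left
    refine ⟨by linarith, ?_, ?_, ?_, ?_⟩ <;>
    linarith only [w0, w1, w2, w3, h0, h1, h2, h3]
  · refine key (d + e - c) c (by linarith) (by linarith) (by ring) (by linarith) (by linarith)
      fun w w0 w1 w2 w3 => mem_trace_quarticFake.2 ⟨e - c, by linarith, ?_⟩
    right; right; right; right; right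
    refine ⟨by linarith, ?_, ?_, ?_, ?_⟩ <;>
    linarith only [w0, w1, w2, w3, h0, h1, h2, h3]

theorem quartic_cover (x : Fin 4 → ℝ) : x ∈ youngPolytope 4 ↔
    (∃ w ∈ weightSet ∅, x ∈ quarticRealLines.trace w) ∨
      ∃ w ∈ weightSet {0, 1}, x ∈ quarticFakeLines.openTrace w := by
  constructor
  swap
  · rintro (⟨w, hw, h⟩ | ⟨w, hw, h⟩)
    exacts [RationalFamily.trace_subset_youngPolytope hw h,
      RationalFamily.trace_subset_youngPolytope hw h.1]
  rintro ⟨hm, hx⟩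
  have x0 := (hx 0).1
  have x1 : x 0 ≤ x 1 := hm (by decide)
  have x2 : x 1 ≤ x 2 := hm (by decide)
  have x3 : x 2 ≤ x 3 := hm (by decide)
  have x4 := (hx 3).2
  obtain ⟨s, b, d, hs, hb, hd, h3, h1, hbd⟩ :=
    exists_eq_add_min (y := x 3 - x 2) (z := x 1 - x 0)
      (by linarith) (by linarith)
  obtain ⟨r', a', c', hr', ha', hc', h4', h2', hac'⟩ :=
    exists_eq_add_min (y := 1 - x 3) (z := x 2 - x 1)
      (by linarith) (by linarith)
  obtain ⟨r, q, e, hr, hq, he, h5, h0, hqe⟩ := exists_eq_add_min hr' x0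
  -- The minimum of three gaps is taken in two stages; the excess q of the first common part over
  -- the triple minimum is returned to a and c.
  obtain ⟨a, ha, h4, ha0⟩ : ∃ a, 0 ≤ a ∧ 1 - x 3 = r + a ∧ a = q + a' :=
    ⟨q + a', by linarith, by linarith, rfl⟩
  obtain ⟨c, hc, h2, hc0⟩ : ∃ c, 0 ≤ c ∧ x 2 - x 1 = r + c ∧ c = q + c' :=
    ⟨q + c', by linarith, by linarith, rfl⟩
  refine Or.imp (exists_mem_trace_quarticReal hs hr ha hb hc hd he h0 h1 h2 h3 h4)
    (exists_mem_openTrace_quarticFake hs hr ha hb hc hd he h0 h1 h2 h3 h4) ?_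
  clear h0 h1 h2 h3 h4 h5 h2' h4' hm hx
  have hace : a = 0 ∨ c = 0 ∨ e = 0 := by grind
  clear hac' hqe ha0 hc0
  rcases hace with rfl | rfl | rfl <;> rcases hbd with rfl | rfl <;> grind (splits := 40)

/-- The geometric symmetric chain decomposition of `L(4)`. -/
noncomputable def quarticSystem : ChainSystem (youngPolytope 4) 3 2 :=
  ChainSystem.ofPair quarticRealLines quarticFakeLines {0, 1} quarticReal_unique
    quarticFake_unique quartic_disjoint quartic_cover RationalFamily.rk_vertex_add_rk_vertex
    RationalFamily.rk_vertex_add_rk_vertex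

theorem quarticSystem_isDenominator : ∀ a, (quarticSystem.family a).IsDenominator 1 :=
  Fin.forall_fin_two.2 ⟨quarticRealLines_isDenominator, quarticFakeLines_isDenominator⟩

theorem quarticSystem_trace_subset : ∀ a, ∀ w ∈ weightSet (quarticSystem.req a),
    (quarticSystem.family a).trace w ⊆ youngPolytope 4 :=
  Fin.forall_fin_two.2
    ⟨fun w hw => show quarticRealLines.trace w ⊆ _ from
      RationalFamily.trace_subset_youngPolytope hw,
    fun w hw => show quarticFakeLines.trace w ⊆ _ from
      RationalFamily.trace_subset_youngPolytope hw⟩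

/-! ### The decomposition of `L(5)` -/

/-- The real snake of `L(5)`. -/
def quinticReal : RationalFamily 5 4 where
  k := 7
  -- The fixed vertices must have rank 5/2: the midpoint of the vertices of rank 0 and 5, and the
  -- mixtures of ranks 1 and 3 in ratio 1 : 3 and of ranks 2 and 4 in ratio 3 : 1. Vertex 1 is again
  -- the midpoint of the vertices of rank 0 and 2.
  base := ![![0, 0, 0, 0, 0], ![0, 0, 0, 1/2, 1/2], ![1/2, 1/2, 1/2, 1/2, 1/2],
    ![0, 0, 3/4, 3/4, 1], ![0, 1/4, 1/4, 1, 1]]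
  dir := fun | 0 => 2 | 1 => 1 | 2 => 4 | 3 => 0 | 4 => 3 | 5 => 2 | 6 => 1 | _ => 0
  len := fun
    | 0 | 1 | 3 => ![0, 1/2, 0, 0, 0]
    | 2 | 4 | 5 => ![1, 1/2, 0, 0, 0]
    | _ => ![1, 0, 0, 0, 0]
  -- Most of these say that a pair of gaps is in the proportion of its fixed vertex, i.e. that both
  -- residual gaps vanish or, for x 0 + x 4 = 1, that they agree. The seventh is the sum of two such
  -- equations. The proportion 1 : 3 is the source of the coefficients ±3.
  normal := fun
    | 0 | 2 | 5 => ![0, 1, -1, -3, 3]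
    | 3 => ![1, 0, 0, 0, 1]
    | 7 => ![1, 1, -1, -3, 4]
    | _ => ![3, -3, -1, 1, 0]
  level := fun | 3 | 7 => 1 | _ => 0

/-- The fake snake of `L(5)`. -/
def quinticFake : RationalFamily 5 4 where
  k := 7
  base := quinticReal.base
  dir := fun | 0 => 4 | 1 => 3 | 2 => 2 | 3 => 1 | 4 => 4 | 5 => 0 | 6 => 3 | _ => 2
  len := fun
    | 0 | 1 => ![1, 0, 0, 0, 0]
    | 2 | 3 | 5 => ![1, 1/2, 0, 0, 0]
    | _ => ![0, 1/2, 0, 0, 0]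
  normal := fun
    | 1 => ![4, -3, -1, 1, 1]
    | 3 | 6 | 8 => ![3, -3, -1, 1, 0]
    | 5 => ![1, 0, 0, 0, 1]
    | _ => ![0, 1, -1, -3, 3]
  level := fun | 1 | 5 => 1 | _ => 0

theorem quinticReal_isValid : quinticReal.IsValid := by constructor <;> decide +kernel

theorem quinticFake_isValid : quinticFake.IsValid := by constructor <;> decide +kernel

theorem quinticReal_indep : AffineIndependent ℝ fun j c => (quinticReal.base j c : ℝ) := by
  refine affineIndependent_of_sum fun w h0 h1 => ?_
  simp [Fin.sum_univ_succ, funext_iff, Fin.forall_fin_succ, quinticReal] at h0 h1 ⊢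
  refine ⟨?_, ?_, ?_, ?_, ?_⟩ <;> linarith

theorem quinticFake_indep : AffineIndependent ℝ fun j c => (quinticFake.base j c : ℝ) :=
  quinticReal_indep

/-- The broken lines of the real snake of `L(5)`. -/
noncomputable abbrev quinticRealLines : BrokenFamily 5 4 :=
  quinticReal.toBrokenFamily quinticReal_isValid quinticReal_indep

/-- The broken lines of the fake snake of `L(5)`. -/
noncomputable abbrev quinticFakeLines : BrokenFamily 5 4 :=
  quinticFake.toBrokenFamily quinticFake_isValid quinticFake_indep

/-- In each travel direction three coefficients are ±3 and the others ±1, which gives 27. -/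
theorem quinticRealLines_isDenominator : quinticRealLines.IsDenominator 27 := by
  refine ⟨by norm_num, ?_⟩
  change (∏ r ∈ Finset.range 8, (quinticReal.normal (r + 1) (quinticReal.dir r)).natAbs ∣ 27) ∧
    (∏ r ∈ Finset.range 8, (quinticReal.normal r (quinticReal.dir r)).natAbs ∣ 27)
  decide +kernel

theorem quinticFakeLines_isDenominator : quinticFakeLines.IsDenominator 27 := by
  refine ⟨by norm_num, ?_⟩
  change (∏ r ∈ Finset.range 8, (quinticFake.normal (r + 1) (quinticFake.dir r)).natAbs ∣ 27) ∧
    (∏ r ∈ Finset.range 8, (quinticFake.normal r (quinticFake.dir r)).natAbs ∣ 27)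
  decide +kernel

set_option maxHeartbeats 2000000 in
theorem mem_trace_quinticReal {w x : Fin 5 → ℝ} : x ∈ quinticRealLines.trace w ↔ ∃ t, 0 ≤ t ∧
    ((t ≤ w 1 / 2 ∧ x 0 = w 2 / 2 ∧ x 1 - x 0 = w 4 / 4 ∧ x 2 - x 1 = 3 * w 3 / 4 + t ∧
      x 3 - x 2 = 3 * w 4 / 4 + w 1 / 2 - t ∧ x 4 - x 3 = w 3 / 4) ∨
    (t ≤ w 1 / 2 ∧ x 0 = w 2 / 2 ∧ x 1 - x 0 = w 4 / 4 + t ∧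
      x 2 - x 1 = 3 * w 3 / 4 + w 1 / 2 - t ∧ x 3 - x 2 = 3 * w 4 / 4 ∧ x 4 - x 3 = w 3 / 4) ∨
    (t ≤ w 0 + w 1 / 2 ∧ x 0 = w 2 / 2 ∧ x 1 - x 0 = w 4 / 4 + w 1 / 2 ∧
      x 2 - x 1 = 3 * w 3 / 4 ∧ x 3 - x 2 = 3 * w 4 / 4 ∧ x 4 - x 3 = w 3 / 4 + t) ∨
    (t ≤ w 1 / 2 ∧ x 0 = w 2 / 2 + t ∧ x 1 - x 0 = w 4 / 4 + w 1 / 2 - t ∧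
      x 2 - x 1 = 3 * w 3 / 4 ∧ x 3 - x 2 = 3 * w 4 / 4 ∧ x 4 - x 3 = w 3 / 4 + w 0 + w 1 / 2) ∨
    (t ≤ w 0 + w 1 / 2 ∧ x 0 = w 2 / 2 + w 1 / 2 ∧ x 1 - x 0 = w 4 / 4 ∧
      x 2 - x 1 = 3 * w 3 / 4 ∧ x 3 - x 2 = 3 * w 4 / 4 + t ∧
      x 4 - x 3 = w 3 / 4 + w 0 + w 1 / 2 - t) ∨
    (t ≤ w 0 + w 1 / 2 ∧ x 0 = w 2 / 2 + w 1 / 2 ∧ x 1 - x 0 = w 4 / 4 ∧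
      x 2 - x 1 = 3 * w 3 / 4 + t ∧ x 3 - x 2 = 3 * w 4 / 4 + w 0 + w 1 / 2 - t ∧
      x 4 - x 3 = w 3 / 4) ∨
    (t ≤ w 0 ∧ x 0 = w 2 / 2 + w 1 / 2 ∧ x 1 - x 0 = w 4 / 4 + t ∧
      x 2 - x 1 = 3 * w 3 / 4 + w 0 + w 1 / 2 - t ∧ x 3 - x 2 = 3 * w 4 / 4 ∧
      x 4 - x 3 = w 3 / 4) ∨
    (t ≤ w 0 ∧ x 0 = w 2 / 2 + w 1 / 2 + t ∧ x 1 - x 0 = w 4 / 4 + w 0 - t ∧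
      x 2 - x 1 = 3 * w 3 / 4 + w 1 / 2 ∧ x 3 - x 2 = 3 * w 4 / 4 ∧ x 4 - x 3 = w 3 / 4)) := by
  rw [RationalFamily.mem_trace_iff]
  constructor
  · rintro ⟨i, hi, t, h0, h⟩
    refine ⟨t, h0, ?_⟩
    change i ≤ 7 at hi
    interval_cases i <;>
    simp [Fin.sum_univ_succ, quinticReal, RationalFamily.vertex, Finset.sum_range_succ,
      Fin.forall_fin_succ] at h <;>
    [left; (iterate 1 right); (iterate 2 right); (iterate 3 right); (iterate 4 right);
      (iterate 5 right); (iterate 6 right); (iterate 7 right)] <;>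
    try left
    all_goals
      obtain ⟨e, e0, e1, e2, e3, e4⟩ := h
      exact ⟨by linarith only [e], by linarith only [e0], by linarith only [e0, e1],
        by linarith only [e1, e2], by linarith only [e2, e3], by linarith only [e3, e4]⟩
  · rintro ⟨t, h0, h⟩
    rcases h with h | h | h | h | h | h | h | h <;>
    obtain ⟨e, e0, e1, e2, e3, e4⟩ := h <;>
    [use 0; use 1; use 2; use 3; use 4; use 5; use 6; use 7] <;>
    refine ⟨by change _ ≤ 7; norm_num, t, h0, ?_⟩ <;>
    simp [Fin.sum_univ_succ, quinticReal, RationalFamily.vertex, Finset.sum_range_succ,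
      Fin.forall_fin_succ] <;>
    exact ⟨by linarith only [e], by linarith only [e0], by linarith only [e0, e1],
      by linarith only [e0, e1, e2], by linarith only [e0, e1, e2, e3],
      by linarith only [e0, e1, e2, e3, e4]⟩

set_option maxHeartbeats 2000000 in
theorem mem_trace_quinticFake {w x : Fin 5 → ℝ} : x ∈ quinticFakeLines.trace w ↔ ∃ t, 0 ≤ t ∧
    ((t ≤ w 0 ∧ x 0 = w 2 / 2 ∧ x 1 - x 0 = w 4 / 4 ∧ x 2 - x 1 = 3 * w 3 / 4 ∧
      x 3 - x 2 = 3 * w 4 / 4 + w 1 / 2 ∧ x 4 - x 3 = w 3 / 4 + t) ∨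
    (t ≤ w 0 ∧ x 0 = w 2 / 2 ∧ x 1 - x 0 = w 4 / 4 ∧ x 2 - x 1 = 3 * w 3 / 4 ∧
      x 3 - x 2 = 3 * w 4 / 4 + w 1 / 2 + t ∧ x 4 - x 3 = w 3 / 4 + w 0 - t) ∨
    (t ≤ w 0 + w 1 / 2 ∧ x 0 = w 2 / 2 ∧ x 1 - x 0 = w 4 / 4 ∧ x 2 - x 1 = 3 * w 3 / 4 + t ∧
      x 3 - x 2 = 3 * w 4 / 4 + w 0 + w 1 / 2 - t ∧ x 4 - x 3 = w 3 / 4) ∨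
    (t ≤ w 0 + w 1 / 2 ∧ x 0 = w 2 / 2 ∧ x 1 - x 0 = w 4 / 4 + t ∧
      x 2 - x 1 = 3 * w 3 / 4 + w 0 + w 1 / 2 - t ∧ x 3 - x 2 = 3 * w 4 / 4 ∧
      x 4 - x 3 = w 3 / 4) ∨
    (t ≤ w 1 / 2 ∧ x 0 = w 2 / 2 ∧ x 1 - x 0 = w 4 / 4 + w 0 + w 1 / 2 ∧
      x 2 - x 1 = 3 * w 3 / 4 ∧ x 3 - x 2 = 3 * w 4 / 4 ∧ x 4 - x 3 = w 3 / 4 + t) ∨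
    (t ≤ w 0 + w 1 / 2 ∧ x 0 = w 2 / 2 + t ∧ x 1 - x 0 = w 4 / 4 + w 0 + w 1 / 2 - t ∧
      x 2 - x 1 = 3 * w 3 / 4 ∧ x 3 - x 2 = 3 * w 4 / 4 ∧ x 4 - x 3 = w 3 / 4 + w 1 / 2) ∨
    (t ≤ w 1 / 2 ∧ x 0 = w 2 / 2 + w 0 + w 1 / 2 ∧ x 1 - x 0 = w 4 / 4 ∧
      x 2 - x 1 = 3 * w 3 / 4 ∧ x 3 - x 2 = 3 * w 4 / 4 + t ∧
      x 4 - x 3 = w 3 / 4 + w 1 / 2 - t) ∨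
    (t ≤ w 1 / 2 ∧ x 0 = w 2 / 2 + w 0 + w 1 / 2 ∧ x 1 - x 0 = w 4 / 4 ∧
      x 2 - x 1 = 3 * w 3 / 4 + t ∧ x 3 - x 2 = 3 * w 4 / 4 + w 1 / 2 - t ∧
      x 4 - x 3 = w 3 / 4)) := by
  rw [RationalFamily.mem_trace_iff]
  constructor
  · rintro ⟨i, hi, t, h0, h⟩
    refine ⟨t, h0, ?_⟩
    change i ≤ 7 at hi
    interval_cases i <;>
    simp [Fin.sum_univ_succ, quinticReal, quinticFake, RationalFamily.vertex,
      Finset.sum_range_succ, Fin.forall_fin_succ] at h <;>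
    [left; (iterate 1 right); (iterate 2 right); (iterate 3 right); (iterate 4 right);
      (iterate 5 right); (iterate 6 right); (iterate 7 right)] <;>
    try left
    all_goals
      obtain ⟨e, e0, e1, e2, e3, e4⟩ := h
      exact ⟨by linarith only [e], by linarith only [e0], by linarith only [e0, e1],
        by linarith only [e1, e2], by linarith only [e2, e3], by linarith only [e3, e4]⟩
  · rintro ⟨t, h0, h⟩
    rcases h with h | h | h | h | h | h | h | h <;>
    obtain ⟨e, e0, e1, e2, e3, e4⟩ := h <;>
    [use 0; use 1; use 2; use 3; use 4; use 5; use 6; use 7] <;>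
    refine ⟨by change _ ≤ 7; norm_num, t, h0, ?_⟩ <;>
    simp [Fin.sum_univ_succ, quinticReal, quinticFake, RationalFamily.vertex,
      Finset.sum_range_succ, Fin.forall_fin_succ] <;>
    exact ⟨by linarith only [e], by linarith only [e0], by linarith only [e0, e1],
      by linarith only [e0, e1, e2], by linarith only [e0, e1, e2, e3],
      by linarith only [e0, e1, e2, e3, e4]⟩

theorem mem_openTrace_quinticFake {w x : Fin 5 → ℝ} {req : Finset (Fin 5)}
    (hw : w ∈ weightSet req) : x ∈ quinticFakeLines.openTrace w ↔
      x ∈ quinticFakeLines.trace w ∧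
      w 1 + 5 / 2 * (w 2 + w 3 + w 4) < x 0 + x 1 + x 2 + x 3 + x 4 ∧
      x 0 + x 1 + x 2 + x 3 + x 4 < 5 - w 1 - 5 / 2 * (w 2 + w 3 + w 4) := by
  rw [RationalFamily.mem_openTrace_iff hw]
  refine and_congr_right fun _ => ?_
  simp [Fin.sum_univ_succ, quinticReal, quinticFake]
  refine and_congr ⟨fun h => ?_, fun h => ?_⟩ ⟨fun h => ?_, fun h => ?_⟩ <;>
  linarith only [h]

theorem mem_weightSet_five {req : Finset (Fin 5)} {w : Fin 5 → ℝ} (hw : w ∈ weightSet req) :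
    0 ≤ w 0 ∧ 0 ≤ w 1 ∧ w 0 + w 1 + w 2 + w 3 + w 4 = 1 := by
  have h := hw.2.1
  rw [Fin.sum_univ_five] at h
  exact ⟨hw.1 0, hw.1 1, h⟩

theorem eq_of_eq_five {w w' : Fin 5 → ℝ} (h : w 0 + w 1 + w 2 + w 3 + w 4 = 1)
    (h' : w' 0 + w' 1 + w' 2 + w' 3 + w' 4 = 1) (h2 : w 2 = w' 2 ∧ w 3 = w' 3 ∧ w 4 = w' 4)
    (h0 : w 0 = w' 0) : w = w' := by
  obtain ⟨h2, h3, h4⟩ := h2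
  ext j
  fin_cases j
  exacts [h0, show w 1 = w' 1 by linarith only [h, h', h0, h2, h3, h4], h2, h3, h4]

/-- Every swipe leaves one residual gap of each pair equal to zero; the divisions by 3 reflect the
unequal mixtures at the last two fixed vertices. -/
theorem quinticReal_weights {req : Finset (Fin 5)} {w x : Fin 5 → ℝ} (hw : w ∈ weightSet req)
    (hx : x ∈ quinticRealLines.trace w) :
    w 2 = 2 * min (1 - x 4) (x 0) ∧ w 3 = 4 * min (x 4 - x 3) ((x 2 - x 1) / 3) ∧
      w 4 = 4 * min ((x 3 - x 2) / 3) (x 1 - x 0) := by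
  obtain ⟨p0, p1, p⟩ := mem_weightSet_five hw
  obtain ⟨t, h0, ht⟩ := mem_trace_quinticReal.1 hx
  refine ⟨?_, ?_, ?_⟩ <;>
  rcases ht with ht | ht | ht | ht | ht | ht | ht | ht <;>
  obtain ⟨e, e0, e1, e2, e3, e4⟩ := ht
  iterate 8
    rcases le_total (1 - x 4) (x 0) with h | h <;> [rw [min_eq_left h]; rw [min_eq_right h]] <;>
    linarith only [p0, p1, p, h0, h, e, e0, e1, e2, e3, e4]
  iterate 8
    rcases le_total (x 4 - x 3) ((x 2 - x 1) / 3) with h | h <;>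
    [rw [min_eq_left h]; rw [min_eq_right h]] <;> linarith only [p0, p1, h0, h, e, e2, e4]
  iterate 8
    rcases le_total ((x 3 - x 2) / 3) (x 1 - x 0) with h | h <;>
    [rw [min_eq_left h]; rw [min_eq_right h]] <;> linarith only [p0, p1, h0, h, e, e1, e3]

theorem quinticFake_weights {req : Finset (Fin 5)} {w x : Fin 5 → ℝ} (hw : w ∈ weightSet req)
    (hx : x ∈ quinticFakeLines.trace w) :
    w 2 = 2 * min (1 - x 4) (x 0) ∧ w 3 = 4 * min (x 4 - x 3) ((x 2 - x 1) / 3) ∧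
      w 4 = 4 * min ((x 3 - x 2) / 3) (x 1 - x 0) := by
  obtain ⟨p0, p1, p⟩ := mem_weightSet_five hw
  obtain ⟨t, h0, ht⟩ := mem_trace_quinticFake.1 hx
  refine ⟨?_, ?_, ?_⟩ <;>
  rcases ht with ht | ht | ht | ht | ht | ht | ht | ht <;>
  obtain ⟨e, e0, e1, e2, e3, e4⟩ := ht
  iterate 8
    rcases le_total (1 - x 4) (x 0) with h | h <;> [rw [min_eq_left h]; rw [min_eq_right h]] <;>
    linarith only [p0, p1, p, h0, h, e, e0, e1, e2, e3, e4]
  iterate 8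
    rcases le_total (x 4 - x 3) ((x 2 - x 1) / 3) with h | h <;>
    [rw [min_eq_left h]; rw [min_eq_right h]] <;> linarith only [p0, p1, h0, h, e, e2, e4]
  iterate 8
    rcases le_total ((x 3 - x 2) / 3) (x 1 - x 0) with h | h <;>
    [rw [min_eq_left h]; rw [min_eq_right h]] <;> linarith only [p0, p1, h0, h, e, e1, e3]

theorem quinticReal_unique (w : Fin 5 → ℝ) (hw : w ∈ weightSet ∅) (w' : Fin 5 → ℝ)
    (hw' : w' ∈ weightSet ∅) (x : Fin 5 → ℝ) (hx : x ∈ quinticRealLines.trace w)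
    (hx' : x ∈ quinticRealLines.trace w') : w = w' := by
  obtain ⟨p0, p1, p⟩ := mem_weightSet_five hw
  obtain ⟨q0, q1, q⟩ := mem_weightSet_five hw'
  obtain ⟨a2, a3, a4⟩ := quinticReal_weights hw hx
  obtain ⟨b2, b3, b4⟩ := quinticReal_weights hw' hx'
  rw [← b2] at a2
  rw [← b3] at a3
  rw [← b4] at a4
  refine eq_of_eq_five p q ⟨a2, a3, a4⟩ ?_
  clear b2 b3 b4
  obtain ⟨t, h0, ht⟩ := mem_trace_quinticReal.1 hx
  obtain ⟨t', h0', ht'⟩ := mem_trace_quinticReal.1 hx'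
  rw [← a2, ← a3, ← a4] at ht' q
  have hs : w 0 + w 1 = w' 0 + w' 1 := by linarith only [p, q]
  clear p q hx hx' hw hw' a2 a3 a4
  generalize x 0 = y0, x 1 - x 0 = y1, x 2 - x 1 = y2, x 3 - x 2 = y3, x 4 - x 3 = y4 at ht ht'
  rcases ht with ht | ht | ht | ht | ht | ht | ht | ht <;>
  obtain ⟨e, rfl, rfl, rfl, rfl, rfl⟩ := ht <;>
  rcases ht' with ht | ht | ht | ht | ht | ht | ht | ht <;>
  obtain ⟨f, f0, f1, f2, f3, f4⟩ := ht <;>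
  linarith only [hs, p0, p1, q0, q1, h0, h0', e, f, f0, f1, f2, f3, f4]

theorem quinticFake_unique (w : Fin 5 → ℝ) (hw : w ∈ weightSet {0, 1}) (w' : Fin 5 → ℝ)
    (hw' : w' ∈ weightSet {0, 1}) (x : Fin 5 → ℝ) (hx : x ∈ quinticFakeLines.openTrace w)
    (hx' : x ∈ quinticFakeLines.openTrace w') : w = w' := by
  obtain ⟨p0, p1, p⟩ := mem_weightSet_five hw
  obtain ⟨q0, q1, q⟩ := mem_weightSet_five hw'
  obtain ⟨a2, a3, a4⟩ := quinticFake_weights hw hx.1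
  obtain ⟨b2, b3, b4⟩ := quinticFake_weights hw' hx'.1
  rw [← b2] at a2
  rw [← b3] at a3
  rw [← b4] at a4
  refine eq_of_eq_five p q ⟨a2, a3, a4⟩ ?_
  clear b2 b3 b4
  obtain ⟨t, h0, ht⟩ := mem_trace_quinticFake.1 hx.1
  obtain ⟨t', h0', ht'⟩ := mem_trace_quinticFake.1 hx'.1
  rw [← a2, ← a3, ← a4] at ht' q
  have hs : w 0 + w 1 = w' 0 + w' 1 := by linarith only [p, q]
  clear p q hx hx' hw hw' a2 a3 a4
  generalize x 0 = y0, x 1 - x 0 = y1, x 2 - x 1 = y2, x 3 - x 2 = y3, x 4 - x 3 = y4 at ht ht'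
  rcases ht with ht | ht | ht | ht | ht | ht | ht | ht <;>
  obtain ⟨e, rfl, rfl, rfl, rfl, rfl⟩ := ht <;>
  rcases ht' with ht | ht | ht | ht | ht | ht | ht | ht <;>
  obtain ⟨f, f0, f1, f2, f3, f4⟩ := ht <;>
  linarith only [hs, p0, p1, q0, q1, h0, h0', e, f, f0, f1, f2, f3, f4]

/-- On the octahedral sphere of residues the two snakes are complementary discs. Their common
boundary is cut off by the positivity of the weights at vertices 0 and 1 and by the strict rank
bounds. -/
theorem quintic_disjoint (w : Fin 5 → ℝ) (hw : w ∈ weightSet ∅) (w' : Fin 5 → ℝ)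
    (hw' : w' ∈ weightSet {0, 1}) (x : Fin 5 → ℝ) (hx : x ∈ quinticRealLines.trace w) :
    x ∉ quinticFakeLines.openTrace w' := by
  intro hx'
  obtain ⟨p0, p1, p⟩ := mem_weightSet_five hw
  obtain ⟨-, -, q⟩ := mem_weightSet_five hw'
  have q0 : 0 < w' 0 := hw'.2.2 0 (by decide)
  have q1 : 0 < w' 1 := hw'.2.2 1 (by decide)
  obtain ⟨a2, a3, a4⟩ := quinticReal_weights hw hx
  obtain ⟨b2, b3, b4⟩ := quinticFake_weights hw' hx'.1
  rw [← b2] at a2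
  rw [← b3] at a3
  rw [← b4] at a4
  clear b2 b3 b4
  obtain ⟨hx', r, r'⟩ := (mem_openTrace_quinticFake hw').1 hx'
  obtain ⟨t, h0, ht⟩ := mem_trace_quinticReal.1 hx
  obtain ⟨t', h0', ht'⟩ := mem_trace_quinticFake.1 hx'
  rw [← a2, ← a3, ← a4] at ht' q r r'
  have hs : w 0 + w 1 = w' 0 + w' 1 := by linarith only [p, q]
  replace r : w' 1 + 5 / 2 * (w 2 + w 3 + w 4) < 5 * x 0 + 4 * (x 1 - x 0) + 3 * (x 2 - x 1) +
    2 * (x 3 - x 2) + (x 4 - x 3) := by linarith only [r]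
  replace r' : 5 * x 0 + 4 * (x 1 - x 0) + 3 * (x 2 - x 1) + 2 * (x 3 - x 2) + (x 4 - x 3) <
    5 - w' 1 - 5 / 2 * (w 2 + w 3 + w 4) := by linarith only [r']
  clear hx hx' hw hw' a2 a3 a4
  generalize x 0 = y0, x 1 - x 0 = y1, x 2 - x 1 = y2, x 3 - x 2 = y3, x 4 - x 3 = y4
    at ht ht' r r'
  rcases ht with ht | ht | ht | ht | ht | ht | ht | ht <;>
  obtain ⟨e, rfl, rfl, rfl, rfl, rfl⟩ := ht <;>
  rcases ht' with ht | ht | ht | ht | ht | ht | ht | ht <;>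
  obtain ⟨f, f0, f1, f2, f3, f4⟩ := ht <;>
  linarith only [hs, q, p0, p1, q0, q1, h0, h0', e, f, f0, f1, f2, f3, f4, r, r']

theorem exists_mem_weightSet_five {q p u s r : ℝ} (hq : 0 ≤ q) (hp : 0 ≤ p) (hu : 0 ≤ u)
    (hs : 0 ≤ s) (hr : 0 ≤ r) (h : q + 2 * p + 2 * u + 4 * s + 4 * r = 1) :
    ∃ w ∈ weightSet (∅ : Finset (Fin 5)),
      w 0 = q ∧ w 1 = 2 * p ∧ w 2 = 2 * u ∧ w 3 = 4 * s ∧ w 4 = 4 * r := by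
  refine ⟨![q, 2 * p, 2 * u, 4 * s, 4 * r],
    ⟨fun j => ?_, ?_, fun j hj => absurd hj (Finset.notMem_empty j)⟩, rfl, rfl, rfl, rfl, rfl⟩
  · fin_cases j
    exacts [hq, mul_nonneg zero_le_two hp, mul_nonneg zero_le_two hu, mul_nonneg zero_le_four hs,
      mul_nonneg zero_le_four hr]
  · rw [Fin.sum_univ_five]
    exact h

theorem exists_mem_weightSet_five_of_pos {q p u s r : ℝ} (hq : 0 < q) (hp : 0 < p) (hu : 0 ≤ u)
    (hs : 0 ≤ s) (hr : 0 ≤ r) (h : q + 2 * p + 2 * u + 4 * s + 4 * r = 1) :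
    ∃ w ∈ weightSet ({0, 1} : Finset (Fin 5)),
      w 0 = q ∧ w 1 = 2 * p ∧ w 2 = 2 * u ∧ w 3 = 4 * s ∧ w 4 = 4 * r := by
  obtain ⟨w, ⟨h1, h2, -⟩, h0, h3, h4⟩ := exists_mem_weightSet_five hq.le hp.le hu hs hr h
  refine ⟨w, ⟨h1, h2, fun j hj => ?_⟩, h0, h3, h4⟩
  rcases Finset.mem_insert.1 hj with rfl | hj
  · rwa [h0]
  · rw [Finset.mem_singleton.1 hj, h3]
    exact mul_pos zero_lt_two hp

/-- A triangle of the octahedron keeps one gap from each of the pairs {a, f}, {b, d}, {c, e}. Each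
of the eight triangles is met by exactly one of the eight listed regions, except that the one with a
= b = c = 0 is covered by two real swipes and the one with d = e = f = 0 by none. -/
theorem exists_mem_trace_quinticReal {x : Fin 5 → ℝ} {u s r a b c d e f : ℝ} (hu : 0 ≤ u)
    (hs : 0 ≤ s) (hr : 0 ≤ r) (ha : 0 ≤ a) (hb : 0 ≤ b) (hc : 0 ≤ c) (hd : 0 ≤ d) (he : 0 ≤ e)
    (hf : 0 ≤ f) (h0 : x 0 = u + f) (h1 : x 1 - x 0 = r + e) (h2 : x 2 - x 1 = 3 * s + d)
    (h3 : x 3 - x 2 = 3 * r + c) (h4 : x 4 - x 3 = s + b) (h5 : 1 - x 4 = u + a)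
    (h : (b = 0 ∧ e = 0 ∧ f = 0 ∧ c + d ≤ a) ∨ (b = 0 ∧ c = 0 ∧ f = 0 ∧ d + e ≤ a) ∨
      (c = 0 ∧ d = 0 ∧ f = 0 ∧ e ≤ a + b) ∨ (a = 0 ∧ c = 0 ∧ d = 0 ∧ e + f ≤ b) ∨
      (a = 0 ∧ d = 0 ∧ e = 0 ∧ f ≤ b + c) ∨ (a = 0 ∧ b = 0 ∧ e = 0 ∧ f ≤ c + d) ∨
      (a = 0 ∧ b = 0 ∧ c = 0 ∧ f ≤ d) ∨ (a = 0 ∧ b = 0 ∧ c = 0 ∧ d ≤ f)) :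
    ∃ w ∈ weightSet ∅, x ∈ quinticRealLines.trace w := by
  have key : ∀ q p : ℝ, 0 ≤ q → 0 ≤ p → q + 2 * p = a + b + c + d + e + f →
      (∀ w : Fin 5 → ℝ, w 0 = q → w 1 = 2 * p → w 2 = 2 * u → w 3 = 4 * s → w 4 = 4 * r →
        x ∈ quinticRealLines.trace w) →
      ∃ w ∈ weightSet ∅, x ∈ quinticRealLines.trace w := by
    intro q p hq hp h6 H
    obtain ⟨w, hw, w0, w1, w2, w3, w4⟩ := exists_mem_weightSet_five hq hp hu hs hr
      (by linarith only [h6, h0, h1, h2, h3, h4, h5])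
    exact ⟨w, hw, H w w0 w1 w2 w3 w4⟩
  rcases h with ⟨rfl, rfl, rfl, h⟩ | ⟨rfl, rfl, rfl, h⟩ | ⟨rfl, rfl, rfl, h⟩ | ⟨rfl, rfl, rfl, h⟩ |
    ⟨rfl, rfl, rfl, h⟩ | ⟨rfl, rfl, rfl, h⟩ | ⟨rfl, rfl, rfl, h⟩ | ⟨rfl, rfl, rfl, h⟩
  · refine key (a - c - d) (c + d) (by linarith) (by linarith) (by ring)
      fun w w0 w1 w2 w3 w4 => mem_trace_quinticReal.2 ⟨d, hd, ?_⟩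
    left
    refine ⟨by linarith, ?_, ?_, ?_, ?_, ?_⟩ <;>
    linarith only [w0, w1, w2, w3, w4, h0, h1, h2, h3, h4]
  · refine key (a - d - e) (d + e) (by linarith) (by linarith) (by ring)
      fun w w0 w1 w2 w3 w4 => mem_trace_quinticReal.2 ⟨e, he, ?_⟩
    right; left
    refine ⟨by linarith, ?_, ?_, ?_, ?_, ?_⟩ <;>
    linarith only [w0, w1, w2, w3, w4, h0, h1, h2, h3, h4]
  · refine key (a + b - e) e (by linarith) (by linarith) (by ring)
      fun w w0 w1 w2 w3 w4 => mem_trace_quinticReal.2 ⟨b, hb, ?_⟩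
    right; right; left
    refine ⟨by linarith, ?_, ?_, ?_, ?_, ?_⟩ <;>
    linarith only [w0, w1, w2, w3, w4, h0, h1, h2, h3, h4]
  · refine key (b - e - f) (e + f) (by linarith) (by linarith) (by ring)
      fun w w0 w1 w2 w3 w4 => mem_trace_quinticReal.2 ⟨f, hf, ?_⟩
    right; right; right; left
    refine ⟨by linarith, ?_, ?_, ?_, ?_, ?_⟩ <;>
    linarith only [w0, w1, w2, w3, w4, h0, h1, h2, h3, h4]
  · refine key (b + c - f) f (by linarith) (by linarith) (by ring)
      fun w w0 w1 w2 w3 w4 => mem_trace_quinticReal.2 ⟨c, hc, ?_⟩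
    right; right; right; right; left
    refine ⟨by linarith, ?_, ?_, ?_, ?_, ?_⟩ <;>
    linarith only [w0, w1, w2, w3, w4, h0, h1, h2, h3, h4]
  · refine key (c + d - f) f (by linarith) (by linarith) (by ring)
      fun w w0 w1 w2 w3 w4 => mem_trace_quinticReal.2 ⟨d, hd, ?_⟩
    right; right; right; right; right; left
    refine ⟨by linarith, ?_, ?_, ?_, ?_, ?_⟩ <;>
    linarith only [w0, w1, w2, w3, w4, h0, h1, h2, h3, h4]
  · refine key (d + e - f) f (by linarith) (by linarith) (by ring)
      fun w w0 w1 w2 w3 w4 => mem_trace_quinticReal.2 ⟨e, he, ?_⟩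
    right; right; right; right; right; right; left
    refine ⟨by linarith, ?_, ?_, ?_, ?_, ?_⟩ <;>
    linarith only [w0, w1, w2, w3, w4, h0, h1, h2, h3, h4]
  · refine key (e + f - d) d (by linarith) (by linarith) (by ring)
      fun w w0 w1 w2 w3 w4 => mem_trace_quinticReal.2 ⟨f - d, sub_nonneg.2 h, ?_⟩
    right; right; right; right; right; right; right
    refine ⟨by linarith, ?_, ?_, ?_, ?_, ?_⟩ <;>
    linarith only [w0, w1, w2, w3, w4, h0, h1, h2, h3, h4]

theorem exists_mem_openTrace_quinticFake {x : Fin 5 → ℝ} {u s r a b c d e f : ℝ} (hu : 0 ≤ u)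
    (hs : 0 ≤ s) (hr : 0 ≤ r) (ha : 0 ≤ a) (hb : 0 ≤ b) (hc : 0 ≤ c) (hd : 0 ≤ d) (he : 0 ≤ e)
    (hf : 0 ≤ f) (h0 : x 0 = u + f) (h1 : x 1 - x 0 = r + e) (h2 : x 2 - x 1 = 3 * s + d)
    (h3 : x 3 - x 2 = 3 * r + c) (h4 : x 4 - x 3 = s + b) (h5 : 1 - x 4 = u + a)
    (h : (d = 0 ∧ e = 0 ∧ f = 0 ∧ (0 < c ∧ 0 < b) ∧ c ≤ a) ∨
      (d = 0 ∧ e = 0 ∧ f = 0 ∧ 0 < a ∧ a < c) ∨ (b = 0 ∧ e = 0 ∧ f = 0 ∧ 0 < a ∧ a < c + d) ∨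
      (b = 0 ∧ c = 0 ∧ f = 0 ∧ 0 < a ∧ a < d + e) ∨ (c = 0 ∧ d = 0 ∧ f = 0 ∧ 0 < a + b ∧ a +
        b < e) ∨
      (a = 0 ∧ c = 0 ∧ d = 0 ∧ 0 < b ∧ b < e + f) ∨ (a = 0 ∧ d = 0 ∧ e = 0 ∧ 0 < b + c ∧ b +
        c < f) ∨
      (a = 0 ∧ b = 0 ∧ e = 0 ∧ 0 < c ∧ c + d < f)) :
    ∃ w ∈ weightSet {0, 1}, x ∈ quinticFakeLines.openTrace w := by
  have key : ∀ q p : ℝ, 0 < q → 0 < p → q + 2 * p = a + b + c + d + e + f →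
      2 * p < 5 * f + 4 * e + 3 * d + 2 * c + b → 5 * f + 4 * e + 3 * d + 2 * c + b < 5 * q +
        8 * p →
      (∀ w : Fin 5 → ℝ, w 0 = q → w 1 = 2 * p → w 2 = 2 * u → w 3 = 4 * s → w 4 = 4 * r →
        x ∈ quinticFakeLines.trace w) →
      ∃ w ∈ weightSet {0, 1}, x ∈ quinticFakeLines.openTrace w := by
    intro q p hq hp h6 h7 h8 H
    obtain ⟨w, hw, w0, w1, w2, w3, w4⟩ := exists_mem_weightSet_five_of_pos hq hp hu hs hr
      (by linarith only [h6, h0, h1, h2, h3, h4, h5])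
    refine ⟨w, hw, (mem_openTrace_quinticFake hw).2
      ⟨H w w0 w1 w2 w3 w4, ?_, ?_⟩⟩ <;>
    linarith only [w0, w1, w2, w3, w4, h0, h1, h2, h3, h4, h5, h6, h7, h8]
  rcases h with ⟨rfl, rfl, rfl, h⟩ | ⟨rfl, rfl, rfl, h⟩ | ⟨rfl, rfl, rfl, h⟩ | ⟨rfl, rfl, rfl, h⟩ |
    ⟨rfl, rfl, rfl, h⟩ | ⟨rfl, rfl, rfl, h⟩ | ⟨rfl, rfl, rfl, h⟩ | ⟨rfl, rfl, rfl, h⟩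
  · refine key (a + b - c) c (by linarith) (by linarith) (by ring) (by linarith) (by linarith)
      fun w w0 w1 w2 w3 w4 => mem_trace_quinticFake.2 ⟨b, hb, ?_⟩
    left
    refine ⟨by linarith, ?_, ?_, ?_, ?_, ?_⟩ <;>
    linarith only [w0, w1, w2, w3, w4, h0, h1, h2, h3, h4]
  · refine key (b + c - a) a (by linarith) (by linarith) (by ring) (by linarith) (by linarith)
      fun w w0 w1 w2 w3 w4 => mem_trace_quinticFake.2 ⟨c - a, sub_nonneg.2 h.2.le, ?_⟩
    right; left
    refine ⟨by linarith, ?_, ?_, ?_, ?_, ?_⟩ <;>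
    linarith only [w0, w1, w2, w3, w4, h0, h1, h2, h3, h4]
  · refine key (c + d - a) a (by linarith) (by linarith) (by ring) (by linarith) (by linarith)
      fun w w0 w1 w2 w3 w4 => mem_trace_quinticFake.2 ⟨d, hd, ?_⟩
    right; right; left
    refine ⟨by linarith, ?_, ?_, ?_, ?_, ?_⟩ <;>
    linarith only [w0, w1, w2, w3, w4, h0, h1, h2, h3, h4]
  · refine key (d + e - a) a (by linarith) (by linarith) (by ring) (by linarith) (by linarith)
      fun w w0 w1 w2 w3 w4 => mem_trace_quinticFake.2 ⟨e, he, ?_⟩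
    right; right; right; left
    refine ⟨by linarith, ?_, ?_, ?_, ?_, ?_⟩ <;>
    linarith only [w0, w1, w2, w3, w4, h0, h1, h2, h3, h4]
  · refine key (e - a - b) (a + b) (by linarith) (by linarith) (by ring) (by linarith) (by linarith)
      fun w w0 w1 w2 w3 w4 => mem_trace_quinticFake.2 ⟨b, hb, ?_⟩
    right; right; right; right; left
    refine ⟨by linarith, ?_, ?_, ?_, ?_, ?_⟩ <;>
    linarith only [w0, w1, w2, w3, w4, h0, h1, h2, h3, h4]
  · refine key (e + f - b) b (by linarith) (by linarith) (by ring) (by linarith) (by linarith)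
      fun w w0 w1 w2 w3 w4 => mem_trace_quinticFake.2 ⟨f, hf, ?_⟩
    right; right; right; right; right; left
    refine ⟨by linarith, ?_, ?_, ?_, ?_, ?_⟩ <;>
    linarith only [w0, w1, w2, w3, w4, h0, h1, h2, h3, h4]
  · refine key (f - b - c) (b + c) (by linarith) (by linarith) (by ring) (by linarith) (by linarith)
      fun w w0 w1 w2 w3 w4 => mem_trace_quinticFake.2 ⟨c, hc, ?_⟩
    right; right; right; right; right; right; left
    refine ⟨by linarith, ?_, ?_, ?_, ?_, ?_⟩ <;>
    linarith only [w0, w1, w2, w3, w4, h0, h1, h2, h3, h4]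
  · refine key (f - c - d) (c + d) (by linarith) (by linarith) (by ring) (by linarith) (by linarith)
      fun w w0 w1 w2 w3 w4 => mem_trace_quinticFake.2 ⟨d, hd, ?_⟩
    right; right; right; right; right; right; right
    refine ⟨by linarith, ?_, ?_, ?_, ?_, ?_⟩ <;>
    linarith only [w0, w1, w2, w3, w4, h0, h1, h2, h3, h4]

theorem quintic_cover (x : Fin 5 → ℝ) : x ∈ youngPolytope 5 ↔
    (∃ w ∈ weightSet ∅, x ∈ quinticRealLines.trace w) ∨
      ∃ w ∈ weightSet {0, 1}, x ∈ quinticFakeLines.openTrace w := by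
  constructor
  swap
  · rintro (⟨w, hw, h⟩ | ⟨w, hw, h⟩)
    exacts [RationalFamily.trace_subset_youngPolytope hw h,
      RationalFamily.trace_subset_youngPolytope hw h.1]
  rintro ⟨hm, hx⟩
  have x0 := (hx 0).1
  have x1 : x 0 ≤ x 1 := hm (by decide)
  have x2 : x 1 ≤ x 2 := hm (by decide)
  have x3 : x 2 ≤ x 3 := hm (by decide)
  have x4 : x 3 ≤ x 4 := hm (by decide)
  have x5 := (hx 4).2
  obtain ⟨u, a, f, hu, ha, hf, h5, h0, haf⟩ := exists_eq_add_min (y := 1 - x 4) (z := x 0)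
      (by linarith) (by linarith)
  obtain ⟨s, b, d, hs, hb, hd, h4, h2, hbd⟩ :=
    exists_eq_add_min (y := x 4 - x 3) (z := (x 2 - x 1) / 3)
      (by linarith) (by linarith)
  obtain ⟨r, c, e, hr, hc, he, h3, h1, hce⟩ :=
    exists_eq_add_min (y := (x 3 - x 2) / 3) (z := x 1 - x 0)
      (by linarith) (by linarith)
  -- The common parts of these two pairs were taken after dividing by 3; the residual gaps are now
  -- scaled back to actual mass.
  obtain ⟨d', hd'⟩ : ∃ d', d' = 3 * d := ⟨_, rfl⟩
  obtain ⟨c', hc'⟩ : ∃ c', c' = 3 * c := ⟨_, rfl⟩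
  replace h2 : x 2 - x 1 = 3 * s + d' := by linarith
  replace h3 : x 3 - x 2 = 3 * r + c' := by linarith
  replace hd : 0 ≤ d' := by linarith
  replace hc : 0 ≤ c' := by linarith
  replace hbd : b = 0 ∨ d' = 0 := hbd.imp_right fun h => by rw [hd', h, mul_zero]
  replace hce : c' = 0 ∨ e = 0 := hce.imp_left fun h => by rw [hc', h, mul_zero]
  have real := exists_mem_trace_quinticReal hu hs hr ha hb hc hd he hf h0 h1 h2 h3 h4 h5
  have fake := exists_mem_openTrace_quinticFake hu hs hr ha hb hc hd he hf h0 h1 h2 h3 h4 h5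
  clear hd' hc' h0 h1 h2 h3 h4 h5
  refine Or.imp real fake ?_
  clear real fake
  -- One case for each triangle of the octahedron; in each it remains to see that the real and fake
  -- regions exhaust it.
  rcases haf with rfl | rfl <;> rcases hbd with rfl | rfl <;> rcases hce with rfl | rfl <;>
  grind (splits := 40)

/-- The geometric symmetric chain decomposition of `L(5)`. -/
noncomputable def quinticSystem : ChainSystem (youngPolytope 5) 4 2 :=
  ChainSystem.ofPair quinticRealLines quinticFakeLines {0, 1} quinticReal_unique
    quinticFake_unique quintic_disjoint quintic_cover RationalFamily.rk_vertex_add_rk_vertex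
    RationalFamily.rk_vertex_add_rk_vertex

theorem quinticSystem_isDenominator : ∀ a, (quinticSystem.family a).IsDenominator 27 :=
  Fin.forall_fin_two.2 ⟨quinticRealLines_isDenominator, quinticFakeLines_isDenominator⟩

theorem quinticSystem_trace_subset : ∀ a, ∀ w ∈ weightSet (quinticSystem.req a),
    (quinticSystem.family a).trace w ⊆ youngPolytope 5 :=
  Fin.forall_fin_two.2
    ⟨fun w hw => show quinticRealLines.trace w ⊆ _ from
      RationalFamily.trace_subset_youngPolytope hw,
    fun w hw => show quinticFakeLines.trace w ⊆ _ from
      RationalFamily.trace_subset_youngPolytope hw⟩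

/-! ### The theorem. -/

theorem exists_geometricSCD_of_chainSystem {m d N : ℕ} (S : ChainSystem (youngPolytope m) d N)
    (hD : ∀ a, (S.family a).IsDenominator 1)
    (hP : ∀ a, ∀ w ∈ weightSet (S.req a), (S.family a).trace w ⊆ youngPolytope m) :
    ∃ D : GeometricSCD (youngPolytope m), m ≤ 4 → D.StrongHyperplaneCondition ∧
      ∀ n : ℕ, 1 ≤ n →
        IsSymmetricChainDecomposition n (youngPoset m n) (D.restrictedChains n) :=
  ⟨S.toGeometricSCD, fun _ => ⟨S.strongHyperplaneCondition hD, fun n hn =>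
    S.isSymmetricChainDecomposition hD (by omega) hP (totalRank_youngPoset m (by omega))⟩⟩

end YoungChains

theorem theorem3p1 :
    (∀ m : ℕ, 1 ≤ m → m ≤ 5 →
      ∃ D : YoungChains.GeometricSCD (YoungChains.youngPolytope m),
        m ≤ 4 →
          D.StrongHyperplaneCondition ∧
          ∀ n : ℕ, 1 ≤ n →
            YoungChains.IsSymmetricChainDecomposition n (YoungChains.youngPoset m n)
              (D.restrictedChains n)) ∧
    (∀ n : ℕ, 1 ≤ n →
      ∃ 𝒞 : Set (Set (Fin 5 → ℝ)),
        (∀ C ∈ 𝒞, YoungChains.IsSymmetricChain (27 * n) (YoungChains.youngPoset 5 (27 * n)) C) ∧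
        𝒞.PairwiseDisjoint id ∧
        YoungChains.youngPoset 5 n ⊆ ⋃₀ 𝒞) := by
  refine ⟨fun m h1 h5 => ?_, fun n hn => ?_⟩
  · interval_cases m
    · exact YoungChains.exists_geometricSCD_of_chainSystem YoungChains.linearSystem
        (fun _ => YoungChains.linearLines_isDenominator) fun _ w hw =>
          show YoungChains.linearLines.trace w ⊆ _ from
            YoungChains.RationalFamily.trace_subset_youngPolytope hw
    · exact YoungChains.exists_geometricSCD_of_chainSystem YoungChains.quadraticSystem
        (fun _ => YoungChains.quadraticLines_isDenominator) fun _ w hw =>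
          show YoungChains.quadraticLines.trace w ⊆ _ from
            YoungChains.RationalFamily.trace_subset_youngPolytope hw
    · exact YoungChains.exists_geometricSCD_of_chainSystem YoungChains.cubicSystem
        YoungChains.cubicSystem_isDenominator YoungChains.cubicSystem_trace_subset
    · exact YoungChains.exists_geometricSCD_of_chainSystem YoungChains.quarticSystem
        YoungChains.quarticSystem_isDenominator YoungChains.quarticSystem_trace_subset
    · exact ⟨YoungChains.quinticSystem.toGeometricSCD, fun h => absurd h (by norm_num)⟩
  · rw [mul_comm]
    -- Only lines that turn at points of denominator 27n are used, as the others may skip ranks;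
    -- those others contain no point of denominator n.
    exact ⟨YoungChains.quinticSystem.latticeChains (n * 27),
      fun C hC => YoungChains.quinticSystem.isSymmetricChain_of_mem_latticeChains (by omega)
        YoungChains.quinticSystem_trace_subset
        (YoungChains.totalRank_youngPoset 5 (by omega)) hC,
      YoungChains.quinticSystem.pairwiseDisjoint_latticeChains,
      YoungChains.quinticSystem.subset_sUnion_latticeChains
        YoungChains.quinticSystem_isDenominator (by omega)⟩
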